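/- Let $n\ge 1$ and $d\ge 2$ be integers. Consider the system of $2n+1$ equations in the $n^2$ variables $x_{i,j}$ $(1\le i,j\le n)$ $$\sum_{j=1}^n x_{i,j}^d=\mu\ (1\le i\le n),\quad \sum_{i=1}^n x_{i,j}^d=\mu\ (1\le j\le n-1),\quad \sum_{i=1}^n x_{i,i}^d=\mu,\quad \sum_{i=1}^n x_{i,n+1-i}^d=\mu ,$$ and let $M_0$ be its $(2n+1)\times n^2$ coefficient matrix (with entries $0$ and $1$), with set of columns $\mathrm{Col}(M_0)$. Let $\Psi(M_0)$ be the largest integer $T$ for which there are $T$ pairwise disjoint linearly independent sets of $2n+1$ columns of $M_0$, and assume that $$\Psi(M_0)>\frac{d(2n+2)}{2n+1}$$ (in particular $\Psi(M_0)>d$). Write $e(z)=e^{2\pi i z}$, $S(q,a)=\sum_{1\le x\le q}e(ax^d/q)$ and $I(\beta)=\int_0^1 e(\beta\xi^d)\,d\xi$. For a positive integer $\mu$ and a real $X\ge 1$ define the singular series and the singular integral by $$\mathfrak S=\sum_{q=1}^\infty A(q),\qquad A(q)=q^{-n^2}\sum_{\substack{\mathbf a\in\{1,\dots,q\}^{2n+1}\\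 \gcd(q,\mathbf a)=1}}\ \prod_{\mathbf c\in \mathrm{Col}(M_0)}S(q,\mathbf a\cdot\mathbf c)\; e\Big(-\frac{\mu}{q}\sum_{i=1}^{2n+1}a_i\Big),$$ $$\mathfrak I=\int_{\mathbb R^{2n+1}}\ \prod_{\mathbf c\in \mathrm{Col}(M_0)}I(\boldsymbol\gamma\cdot\mathbf c)\; e\Big(-\frac{\mu}{X^d}\sum_{i=1}^{2n+1}\gamma_i\Big)\,d\boldsymbol\gamma .$$ Then there are constants $\mathfrak c_{n,d}>0$, $\varepsilon\in(0,1/2)$ and $X_0\ge 1$, depending only on $n$ and $d$, such that for every real $X\ge X_0$ there is a prime $p_0$ with $\varepsilon X<p_0<(1-\varepsilon)X$ for which, with $\mu=n p_0^d$, the series $\mathfrak S$ and the integral $\mathfrak I$ converge absolutely, $\mathfrak S\mathfrak I$ is real, and $$\mathfrak S\,\mathfrak I>\mathfrak c_{n,d}.$$ -/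

import Mathlib

open scoped Matrix

noncomputable section

namespace MagicSquare

/-- Labels of the equations of the magic square system: the `n` rows, the first `n - 1` columns,
and the two major diagonals (`0` the main one, `1` the other one). For `n ≥ 1` there are
`2 * n + 1` of them. -/
abbrev Eqn (n : ℕ) : Type := Fin n ⊕ (Fin (n - 1) ⊕ Fin 2)

/-- The coefficient matrix `M₀` of the magic square system. Its rows are indexed by the equations
and its columns by the cells `(i, j)` of the square, i.e. by the variables `x_{i,j}`. -/
def magicMatrix (R : Type*) [Zero R] [One R] (n : ℕ) : Matrix (Eqn n) (Fin n × Fin n) R :=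
  fun r c =>
    match r with
    | Sum.inl i => if c.1 = i then 1 else 0
    | Sum.inr (Sum.inl j) => if (c.2 : ℕ) = (j : ℕ) then 1 else 0
    | Sum.inr (Sum.inr 0) => if c.1 = c.2 then 1 else 0
    | Sum.inr (Sum.inr 1) => if c.2 = Fin.rev c.1 then 1 else 0

/-- Distinct cells have distinct columns, so a product over the set of columns of `M₀` is a product
over the cells. -/
theorem magicMatrix_col_injective (n : ℕ) :
    Function.Injective (magicMatrix ℝ n).col := by
  rintro ⟨i, j⟩ ⟨k, l⟩ h
  have h1 : k = i := by
    have := congrFun h (Sum.inl i)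
    by_contra hne
    simp [Matrix.col, magicMatrix, hne] at this
  have h2 : l = j := by
    by_contra hne
    have hne' : (l : ℕ) ≠ (j : ℕ) := fun hh => hne (Fin.ext hh)
    rcases lt_or_ge (j : ℕ) (n - 1) with hj | hj
    · have := congrFun h (Sum.inr (Sum.inl ⟨j, hj⟩))
      simp [Matrix.col, magicMatrix, hne'] at this
    · have hl : (l : ℕ) < n - 1 := by omega
      have := congrFun h (Sum.inr (Sum.inl ⟨l, hl⟩))
      simp [Matrix.col, magicMatrix, hne'.symm] at this
  rw [h1, h2]

/-- There are `T` pairwise disjoint sets of columns of `M₀`, each of them a linearly independent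
set of `2 * n + 1` columns. -/
def HasDisjointBases (n T : ℕ) : Prop :=
  ∃ D : Fin T → Finset (Fin n × Fin n),
    (∀ t, (D t).card = 2 * n + 1 ∧
      LinearIndependent ℝ (fun c : D t => (magicMatrix ℝ n).col c)) ∧
    ∀ s t, s ≠ t → Disjoint (D s) (D t)

/-- `Ψ(M₀)`: the largest `T` such that there are `T` pairwise disjoint linearly independent sets of
`2 * n + 1` columns of `M₀`. -/
def Psi (n : ℕ) : ℕ := sSup {T | HasDisjointBases n T}

/-- The supremum defining `Psi` is that of a bounded set. -/
theorem bddAbove_hasDisjointBases (n : ℕ) : BddAbove {T | HasDisjointBases n T} := by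
  refine ⟨n * n, ?_⟩
  rintro T ⟨D, hD, hdis⟩
  have h1 : (Finset.univ.biUnion D).card = ∑ t, (D t).card :=
    Finset.card_biUnion (fun s _ t _ hst => hdis s t hst)
  have h2 : (Finset.univ.biUnion D).card ≤ n * n := by
    simpa using Finset.card_le_univ (Finset.univ.biUnion D)
  have h3 : ∑ t, (D t).card = T * (2 * n + 1) := by
    simp [fun t => (hD t).1]
  nlinarith

/-- `e(z) = exp(2 π i z)`. -/
def e (z : ℝ) : ℂ := Complex.exp (2 * Real.pi * Complex.I * z)

/-- The complete exponential sum `S(q, a) = ∑_{1 ≤ x ≤ q} e(a x ^ d / q)`. -/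
def S (d q a : ℕ) : ℂ := ∑ x ∈ Finset.Icc 1 q, e ((a * x ^ d : ℝ) / q)

/-- The vectors `a` of integers with `1 ≤ a ≤ q` and `gcd(q, a) = 1`. -/
def primitiveVectors (n q : ℕ) : Finset (Eqn n → ℕ) :=
  (Fintype.piFinset fun _ => Finset.Icc 1 q).filter
    fun a => Nat.gcd q (Finset.univ.gcd a) = 1

/-- The term `A(q)` of the singular series. -/
def A (n d μ q : ℕ) : ℂ :=
  ((q : ℂ) ^ (n ^ 2))⁻¹ * ∑ a ∈ primitiveVectors n q,
    (∏ c : Fin n × Fin n, S d q (a ⬝ᵥ (magicMatrix ℕ n).col c)) *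
      e (-(μ * ∑ r, (a r : ℝ)) / q)

/-- The singular series `𝔖 = ∑_{q ≥ 1} A(q)`. -/
def singularSeries (n d μ : ℕ) : ℂ := ∑' q : ℕ+, A n d μ q

/-- `I(β) = ∫_0^1 e(β ξ ^ d) dξ`. -/
def I (d : ℕ) (β : ℝ) : ℂ := ∫ ξ in (0 : ℝ)..1, e (β * ξ ^ d)

/-- The integrand of the singular integral. -/
def singularIntegrand (n d μ : ℕ) (X : ℝ) (γ : Eqn n → ℝ) : ℂ :=
  (∏ c : Fin n × Fin n, I d (γ ⬝ᵥ (magicMatrix ℝ n).col c)) *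
    e (-(μ / X ^ d * ∑ r, γ r))

/-- The singular integral `𝔍`, an integral over `ℝ ^ (2 n + 1)`. -/
def singularIntegral (n d μ : ℕ) (X : ℝ) : ℂ :=
  ∫ γ : Eqn n → ℝ, singularIntegrand n d μ X γ

end MagicSquare

end

/-! ### Complete exponential sums to prime power moduli -/

namespace MagicSquare
open Finset

/-! Every equation of the system involves exactly `n` cells, so for `μ = n * p₀ ^ d` the square with
all entries `p₀` is a solution. Both 𝔖 and 𝔍 are bounded below by counting solutions, p-adic or
real, close to this one.

Convergence. Write T for `Psi n`; then T ≥ d + 1 and there are T disjoint blocks of 2n + 1 cells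
with nonzero minors `cellsDet`. A product over all cells of factors in [0, 1] is at most the sum
over the blocks of the T-th powers of the block products (`prod_le_sum_pow`). Inside a block the
linear forms can be taken as new variables, at the cost of a power of the minor, and only T-th
moments in one variable remain. The decay |I(β)| ≪ (1 + |β|)^(-1/d) then gives the absolute
convergence of 𝔍, and |S(p^l, u)| / p^l ≪ p^(-l/d) gives A(p^m) ≪ (m+1)^(2n+1) p^(-m/d), which is
enough for m > d.

For m ≤ d and p outside a finite set there is a sharper bound, A(p^m) ≪ p^(-3/2). If every block has
at least three nonzero forms, each of these gains an extra p^(-1/2). Only O(p^(2m)) vectors fail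
this, and for them the combinatorics of the square is used: a combination of the equations that is
nonzero modulo p involves at least n cells (`card_vecMul_magicMatrix_ge`), where n ≥ 2d + 3.
Altogether the sum of |A(p^m)| over m ≥ 1 is O(p^(-1-1/d)); as A is multiplicative, 𝔖 is an
absolutely convergent Euler product.

Positivity. The partial sums of the factor at p are normalised solution counts modulo p^m. Hensel
lifting around the constant square bounds them below independently of p₀ when p ∤ p₀
(`exists_le_localCount`); this serves the finitely many small p, while the factors at large p, that
at p₀ included, are close to 1. For 𝔍, Gaussian damping turns the integral into the mean over the
unit cube of a Gaussian kernel in the defects of the equations, and this is at least a constant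
because the set of near-solutions around the constant point p₀/X has volume ≫ η^(2n+1)
(`exists_le_volume_nearSolutions`). -/

lemma norm_e (z : ℝ) : ‖e z‖ = 1 := by
  rw [e, Complex.norm_exp]; simp

lemma e_add (x y : ℝ) : e (x + y) = e x * e y := by
  rw [e, e, e, ← Complex.exp_add]; congr 1; push_cast; ring

lemma e_zero : e 0 = 1 := by simp [e]

lemma continuous_e : Continuous e := by unfold e; fun_prop

lemma e_sum {ι : Type*} (s : Finset ι) (f : ι → ℝ) : e (∑ i ∈ s, f i) = ∏ i ∈ s, e (f i) := by
  classical
  induction s using Finset.induction_on with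
  | empty => simp [e_zero]
  | insert a s ha ih => rw [sum_insert ha, prod_insert ha, e_add, ih]

lemma e_intCast_div (q : ℕ) [NeZero q] (a : ℤ) :
    e ((a : ℝ) / q) = ZMod.stdAddChar ((a : ℤ) : ZMod q) := by
  rw [ZMod.stdAddChar_coe, e]
  congr 1
  push_cast
  ring

lemma e_natCast_div (q : ℕ) [NeZero q] (a : ℕ) :
    e ((a : ℝ) / q) = ZMod.stdAddChar ((a : ℕ) : ZMod q) := by
  simpa using e_intCast_div q a

lemma bijOn_natCast_Icc (q : ℕ) [NeZero q] :
    Set.BijOn (fun x : ℕ => (x : ZMod q)) (Icc 1 q : Finset ℕ) Set.univ := by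
  have hq : 0 < q := Nat.pos_of_ne_zero (NeZero.ne q)
  refine ⟨fun _ _ => Set.mem_univ _, ?_, ?_⟩
  · intro x hx y hy hxy
    simp only [coe_Icc, Set.mem_Icc] at hx hy
    have h := (ZMod.natCast_eq_natCast_iff x y q).1 hxy
    have h1 : (x - 1) + 1 ≡ (y - 1) + 1 [MOD q] := by
      rwa [Nat.sub_add_cancel hx.1, Nat.sub_add_cancel hy.1]
    have h2 := Nat.ModEq.add_right_cancel' 1 h1
    have h3 := Nat.ModEq.eq_of_lt_of_lt h2 (by omega) (by omega)
    omega
  · intro x _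
    rcases eq_or_ne x 0 with rfl | hx
    · exact ⟨q, by simp [Nat.one_le_iff_ne_zero, hq.ne'], by simp⟩
    · refine ⟨x.val, ?_, by simp⟩
      have h1 : x.val ≠ 0 := by simpa [ZMod.val_eq_zero] using hx
      have h2 := x.val_lt
      simp only [coe_Icc, Set.mem_Icc]; omega

lemma sum_Icc_eq_sum_zmod {R : Type*} [AddCommMonoid R] (q : ℕ) [NeZero q] (f : ZMod q → R) :
    ∑ x ∈ Icc 1 q, f (x : ZMod q) = ∑ x, f x :=
  sum_nbij (fun x : ℕ => (x : ZMod q)) (by simp) (bijOn_natCast_Icc q).2.1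
    (by simpa using (bijOn_natCast_Icc q).2.2) (by simp)

lemma sum_range_eq_sum_zmod {R : Type*} [AddCommMonoid R] (q : ℕ) [NeZero q] (f : ZMod q → R) :
    ∑ x ∈ range q, f (x : ZMod q) = ∑ x, f x := by
  refine sum_nbij' (fun x : ℕ => (x : ZMod q)) ZMod.val (by simp)
    (fun a _ => mem_range.2 a.val_lt) ?_ (by simp) (by simp)
  intro a ha
  exact ZMod.val_cast_of_lt (mem_range.1 ha)

lemma sum_range_mul_eq_nsmul {R : Type*} [AddCommMonoid R] (q : ℕ) [NeZero q] (f : ZMod q → R)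
    (g : ℕ) : ∑ x ∈ range (g * q), f (x : ZMod q) = g • ∑ x, f x := by
  induction g with
  | zero => simp
  | succ g ih =>
    rw [add_mul, one_mul, sum_range_add, ih, add_smul, one_smul]
    congr 1
    rw [← sum_range_eq_sum_zmod]
    simp

/-- The complete sum `∑ x, ψ (b * x ^ d)` over residues modulo `q`. -/
noncomputable def powSum (d q : ℕ) [NeZero q] (b : ZMod q) : ℂ :=
  ∑ x : ZMod q, ZMod.stdAddChar (b * x ^ d)

lemma S_eq_powSum (d q a : ℕ) [NeZero q] : S d q a = powSum d q (a : ZMod q) := by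
  rw [S, powSum, ← sum_Icc_eq_sum_zmod]
  refine sum_congr rfl fun x _ => ?_
  have := e_natCast_div q (a * x ^ d)
  push_cast at this
  exact this

lemma S_eq_sum_range (d q a : ℕ) [NeZero q] :
    S d q a = ∑ x ∈ range q, e ((a * x ^ d : ℝ) / q) := by
  rw [S_eq_powSum, powSum, ← sum_range_eq_sum_zmod]
  refine sum_congr rfl fun x _ => ?_
  have := e_natCast_div q (a * x ^ d)
  push_cast at this
  exact this.symm

lemma sum_range_mul_e (d q a g : ℕ) [NeZero q] :
    ∑ x ∈ range (g * q), e ((a * x ^ d : ℝ) / q) = g * S d q a := by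
  have := sum_range_mul_eq_nsmul q (fun x : ZMod q => (ZMod.stdAddChar ((a : ZMod q) * x ^ d) : ℂ)) g
  rw [S_eq_powSum, powSum, ← nsmul_eq_mul, ← this]
  refine sum_congr rfl fun x _ => ?_
  have := e_natCast_div q (a * x ^ d)
  push_cast at this
  exact this

lemma S_mul_mul (d q a g : ℕ) (hg : g ≠ 0) [NeZero q] : S d (g * q) (g * a) = g * S d q a := by
  have : NeZero (g * q) := ⟨mul_ne_zero hg (NeZero.ne q)⟩
  rw [S_eq_sum_range, ← sum_range_mul_e]
  refine sum_congr rfl fun x _ => ?_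
  congr 1
  have : (g : ℝ) ≠ 0 := by exact_mod_cast hg
  push_cast
  field_simp

lemma norm_powSum_le (d q : ℕ) [NeZero q] (b : ZMod q) : ‖powSum d q b‖ ≤ q := by
  refine (norm_sum_le _ _).trans ?_
  simp [ZMod.card]

lemma norm_S_le (d q a : ℕ) : ‖S d q a‖ ≤ q := by
  refine (norm_sum_le _ _).trans ?_
  simp [norm_e]

/-- Only multiples of `p` contribute to the complete sum modulo a high power of `p`. -/
lemma powSum_prime_pow_eq_sum_filter {p : ℕ} [Fact p.Prime] {d d' τ l u : ℕ} (hd : 2 ≤ d)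
    (hdd : d = p ^ τ * d') (hd' : ¬ p ∣ d') (hl : 2 * τ + 2 ≤ l) (hu : ¬ p ∣ u) :
    powSum d (p ^ l) (u : ZMod (p ^ l)) =
      ∑ x : ZMod (p ^ l) with p ∣ x.val, ZMod.stdAddChar ((u : ZMod (p ^ l)) * x ^ d) := by
  have hp : p.Prime := Fact.out
  set q := p ^ l with hq
  -- The sum is averaged over the shifts x + h z with z < p. As l ≥ 2τ + 2, h² vanishes modulo p^l,
  -- so (x + h z)^d is affine in z. Since p^τ exactly divides d, the slope is a multiple of p^(l-1),
  -- and it is nonzero precisely when p ∤ x; then the geometric sum over z vanishes.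
  set h : ZMod q := (p : ZMod q) ^ (l - τ - 1) with hh
  have hpl : ∀ j, l ≤ j → (p : ZMod q) ^ j = 0 := by
    intro j hj
    have : ((p ^ j : ℕ) : ZMod q) = 0 := (ZMod.natCast_eq_zero_iff _ _).2 (pow_dvd_pow p hj)
    exact_mod_cast this
  have hh2 : h ^ 2 = 0 := by
    rw [hh, ← pow_mul]; exact hpl _ (by omega)
  have hbin : ∀ x y : ZMod q, (x + h * y) ^ d = x ^ d + d * x ^ (d - 1) * (h * y) := by
    intro x y
    obtain ⟨k, hk⟩ := Polynomial.powAddExpansion x (h * y) d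
    rw [hk, mul_pow, hh2]; ring
  have key : (p : ℂ) * powSum d q (u : ZMod q) =
      ∑ x : ZMod q, ∑ z ∈ range p,
        ZMod.stdAddChar ((u : ZMod q) * (x + h * (z : ZMod q)) ^ d) := by
    rw [sum_comm]
    have : ∀ z ∈ range p, ∑ x : ZMod q,
        (ZMod.stdAddChar ((u : ZMod q) * (x + h * (z : ZMod q)) ^ d) : ℂ) =
        powSum d q (u : ZMod q) := by
      intro z _
      exact Equiv.sum_comp (Equiv.addRight (h * (z : ZMod q)))
        (fun x : ZMod q => (ZMod.stdAddChar ((u : ZMod q) * x ^ d) : ℂ))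
    rw [sum_congr rfl this]; simp
  have inner : ∀ x : ZMod q, ∑ z ∈ range p,
      (ZMod.stdAddChar ((u : ZMod q) * (x + h * (z : ZMod q)) ^ d) : ℂ) =
      if p ∣ x.val then (p : ℂ) * ZMod.stdAddChar ((u : ZMod q) * x ^ d) else 0 := by
    intro x
    set w : ZMod q := (u : ZMod q) * (d * x ^ (d - 1) * h) with hw
    have h1 : ∀ z ∈ range p, (ZMod.stdAddChar ((u : ZMod q) * (x + h * (z : ZMod q)) ^ d) : ℂ) =
        ZMod.stdAddChar ((u : ZMod q) * x ^ d) * (ZMod.stdAddChar w) ^ z := by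
      intro z _
      rw [hbin, ← AddChar.map_nsmul_eq_pow, ← AddChar.map_add_eq_mul]
      congr 1
      rw [nsmul_eq_mul, hw]; ring
    rw [sum_congr rfl h1, ← mul_sum]
    have hw' : w = ((u * d' * x.val ^ (d - 1) : ℕ) : ZMod q) * (p : ZMod q) ^ (l - 1) := by
      have : (p : ZMod q) ^ (l - 1) = (p : ZMod q) ^ τ * (p : ZMod q) ^ (l - τ - 1) := by
        rw [← pow_add]; congr 1; omega
      rw [this, hw]
      push_cast
      rw [ZMod.natCast_zmod_val, hdd, hh]; push_cast; ring
    have hpw : (p : ZMod q) * w = 0 := by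
      rw [hw', mul_left_comm, ← pow_succ', hpl _ (by omega), mul_zero]
    split_ifs with hx
    · have : w = 0 := by
        obtain ⟨t, ht⟩ := hx
        obtain ⟨d1, hd1⟩ : ∃ d1, d - 1 = d1 + 1 := ⟨d - 2, by omega⟩
        have h2 : ((u * d' * x.val ^ (d - 1) : ℕ) : ZMod q) = p * ((u * d' * (t * x.val ^ d1) : ℕ) : ZMod q) := by
          rw [hd1, pow_succ]
          nth_rewrite 2 [ht]
          push_cast; ring
        rw [hw', h2, mul_right_comm, ← pow_succ', hpl _ (by omega), zero_mul]
      rw [this]; simp [mul_comm]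
    · have hw0 : w ≠ 0 := by
        intro h0
        rw [hw'] at h0
        have h2 : ((u * d' * x.val ^ (d - 1) * p ^ (l - 1) : ℕ) : ZMod q) = 0 := by
          push_cast; push_cast at h0; exact h0
        rw [ZMod.natCast_eq_zero_iff] at h2
        have h3 : q = p * p ^ (l - 1) := by rw [hq, ← pow_succ', Nat.sub_add_cancel (by omega)]
        have h4 := Nat.dvd_of_mul_dvd_mul_right (pow_pos hp.pos _) (h3.symm.dvd.trans h2)
        rcases (hp.dvd_mul).1 h4 with h5 | h5
        · rcases (hp.dvd_mul).1 h5 with h6 | h6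
          · exact hu h6
          · exact hd' h6
        · exact hx (hp.dvd_of_dvd_pow h5)
      have hne : (ZMod.stdAddChar w : ℂ) ≠ 1 := by
        intro h1
        rw [← AddChar.map_zero_eq_one (ZMod.stdAddChar (N := q))] at h1
        exact hw0 (ZMod.injective_stdAddChar h1)
      have hpp : (ZMod.stdAddChar w : ℂ) ^ p = 1 := by
        rw [← AddChar.map_nsmul_eq_pow, nsmul_eq_mul, hpw, AddChar.map_zero_eq_one]
      rw [geom_sum_eq hne, hpp]; simp
  rw [sum_congr rfl (fun x _ => inner x), ← sum_filter, ← mul_sum] at key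
  exact mul_left_cancel₀ (by exact_mod_cast hp.ne_zero) key

lemma S_prime_pow_eq_sum_range {p : ℕ} [Fact p.Prime] {d d' τ l u : ℕ} (hd : 2 ≤ d)
    (hdd : d = p ^ τ * d') (hd' : ¬ p ∣ d') (hl : 2 * τ + 2 ≤ l) (hu : ¬ p ∣ u) :
    S d (p ^ l) u = ∑ y ∈ range (p ^ (l - 1)), e ((u * (p * y) ^ d : ℝ) / (p : ℝ) ^ l) := by
  have hp : p.Prime := Fact.out
  rw [S_eq_powSum, powSum_prime_pow_eq_sum_filter hd hdd hd' hl hu]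
  have hpl : p ^ l = p * p ^ (l - 1) := by rw [← pow_succ']; congr 1; omega
  symm
  refine sum_nbij' (fun y : ℕ => ((p * y : ℕ) : ZMod (p ^ l))) (fun x => x.val / p) ?_ ?_ ?_ ?_ ?_
  · intro y hy
    have : p * y < p ^ l := by
      rw [hpl]; exact Nat.mul_lt_mul_of_pos_left (mem_range.1 hy) hp.pos
    simp only [mem_filter, mem_univ, true_and]
    rw [ZMod.val_cast_of_lt this]; exact dvd_mul_right _ _
  · intro x _
    rw [mem_range]
    exact Nat.div_lt_of_lt_mul (hpl ▸ x.val_lt)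
  · intro y hy
    have : p * y < p ^ l := by
      rw [hpl]; exact Nat.mul_lt_mul_of_pos_left (mem_range.1 hy) hp.pos
    rw [ZMod.val_cast_of_lt this, Nat.mul_div_cancel_left _ hp.pos]
  · intro x hx
    simp only [mem_filter, mem_univ, true_and] at hx
    rw [Nat.mul_div_cancel' hx]; simp
  · intro y _
    have := e_natCast_div (p ^ l) (u * (p * y) ^ d)
    push_cast at this ⊢
    exact this

lemma e_natCast (m : ℕ) : e m = 1 := by
  have := e_natCast_div 1 m
  rw [Nat.cast_one, div_one] at this
  rw [this, Subsingleton.elim ((m : ℕ) : ZMod 1) 0, AddChar.map_zero_eq_one]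

/-- The surviving x = p y satisfy p^d ∣ x^d, so for l ≤ d each of the p^(l-1) terms is 1. -/
lemma S_prime_pow_of_le {p : ℕ} [Fact p.Prime] {d d' τ l u : ℕ} (hd : 2 ≤ d)
    (hdd : d = p ^ τ * d') (hd' : ¬ p ∣ d') (hl : 2 * τ + 2 ≤ l) (hu : ¬ p ∣ u) (hld : l ≤ d) :
    S d (p ^ l) u = p ^ (l - 1) := by
  have hp : p.Prime := Fact.out
  rw [S_prime_pow_eq_sum_range hd hdd hd' hl hu]
  have : ∀ y ∈ range (p ^ (l - 1)), e ((u * (p * y) ^ d : ℝ) / (p : ℝ) ^ l) = 1 := by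
    intro y _
    rw [← e_natCast (u * (p ^ (d - l) * y ^ d))]
    congr 1
    have h1 : (p : ℝ) ^ d = p ^ (d - l) * p ^ l := by rw [← pow_add]; congr 1; omega
    have hp0 : (p : ℝ) ≠ 0 := by exact_mod_cast hp.ne_zero
    push_cast
    rw [mul_pow, h1]; field_simp
  rw [sum_congr rfl this]; simp

/-- With x = p y, the factor p^d cancels against the modulus, and y runs through p^(d-1) full
periods modulo p^(l-d). Relative to the modulus, each such step gains exactly 1/p. -/
lemma S_prime_pow_of_ge {p : ℕ} [Fact p.Prime] {d d' τ l u : ℕ} (hd : 2 ≤ d)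
    (hdd : d = p ^ τ * d') (hd' : ¬ p ∣ d') (hl : 2 * τ + 2 ≤ l) (hu : ¬ p ∣ u) (hld : d ≤ l) :
    S d (p ^ l) u = p ^ (d - 1) * S d (p ^ (l - d)) u := by
  have hp : p.Prime := Fact.out
  rw [S_prime_pow_eq_sum_range hd hdd hd' hl hu]
  have h1 : p ^ (l - 1) = p ^ (d - 1) * p ^ (l - d) := by rw [← pow_add]; congr 1; omega
  have h2 := sum_range_mul_e d (p ^ (l - d)) u (p ^ (d - 1))
  push_cast at h2
  rw [h1, ← h2]
  refine sum_congr rfl fun y _ => ?_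
  congr 1
  have h1 : (p : ℝ) ^ l = p ^ (l - d) * p ^ d := by rw [← pow_add]; congr 1; omega
  have hp0 : (p : ℝ) ≠ 0 := by exact_mod_cast hp.ne_zero
  rw [mul_pow, h1]; field_simp

end MagicSquare

/-! ### Upper bounds for the normalised complete sums -/

namespace MagicSquare
open Finset

lemma card_filter_pow_eq_le {F : Type*} [Field F] [Fintype F] [DecidableEq F] {d : ℕ} (hd : 0 < d)
    (a : F) : #{x : F | x ^ d = a} ≤ d := by
  have h : ({x : F | x ^ d = a} : Finset F) ⊆ (Polynomial.nthRoots d a).toFinset := by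
    intro x hx
    rw [Multiset.mem_toFinset, Polynomial.mem_nthRoots hd]
    simpa using hx
  exact (card_le_card h).trans ((Multiset.toFinset_card_le _).trans (Polynomial.card_nthRoots d a))

/-- By Parseval the second moment is p times the number of pairs with x^d = y^d, and each y admits
at most d values of x. -/
lemma sum_norm_powSum_sq_le {p : ℕ} [Fact p.Prime] {d : ℕ} (hd : 0 < d) :
    ∑ b : ZMod p, ‖powSum d p b‖ ^ 2 ≤ d * (p : ℝ) ^ 2 := by
  have key : (∑ b : ZMod p, (‖powSum d p b‖ ^ 2 : ℝ) : ℂ) =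
      ∑ x : ZMod p, ∑ y : ZMod p, if x ^ d - y ^ d = 0 then (p : ℂ) else 0 := by
    have h1 : ∀ b : ZMod p, ((‖powSum d p b‖ ^ 2 : ℝ) : ℂ) = ∑ x : ZMod p, ∑ y : ZMod p,
        ZMod.stdAddChar (b * (x ^ d - y ^ d)) := by
      intro b
      push_cast
      rw [← Complex.mul_conj', powSum, map_sum, sum_mul_sum]
      refine sum_congr rfl fun x _ => sum_congr rfl fun y _ => ?_
      rw [← AddChar.map_neg_eq_conj, ← AddChar.map_add_eq_mul]
      congr 1; ring
    rw [sum_congr rfl fun b _ => h1 b, sum_comm]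
    refine sum_congr rfl fun x _ => ?_
    rw [sum_comm]
    refine sum_congr rfl fun y _ => ?_
    rw [AddChar.sum_mulShift _ (ZMod.isPrimitive_stdAddChar p), ZMod.card]
    simp
  have h2 : ∑ b : ZMod p, (‖powSum d p b‖ ^ 2 : ℝ) =
      ∑ y : ZMod p, ∑ x : ZMod p, if x ^ d = y ^ d then (p : ℝ) else 0 := by
    rw [sum_comm]
    apply Complex.ofReal_injective
    simpa [sub_eq_zero, apply_ite] using key
  rw [h2]
  have h3 : ∀ y : ZMod p, (∑ x : ZMod p, if x ^ d = y ^ d then (p : ℝ) else 0) ≤ d * p := by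
    intro y
    rw [← sum_filter, sum_const, nsmul_eq_mul]
    gcongr
    exact card_filter_pow_eq_le hd _
  refine (sum_le_sum fun y _ => h3 y).trans ?_
  simp [ZMod.card]; ring_nf; rfl

lemma powSum_mul_pow {p : ℕ} [Fact p.Prime] (d : ℕ) (u t : ZMod p) (ht : t ≠ 0) :
    powSum d p (u * t ^ d) = powSum d p u := by
  rw [powSum, powSum]
  conv_rhs => rw [← Equiv.sum_comp (Equiv.mulLeft₀ t ht)]
  refine sum_congr rfl fun x _ => ?_
  simp only [Equiv.mulLeft₀_apply]
  congr 1; ring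

/-- Square-root cancellation from the second moment alone: the sum is unchanged when u is replaced
by u t^d, and t ↦ u t^d is at most d-to-one, so p - 1 copies of the same value fit into d times the
second moment. The factor 2 comes from p - 1 ≥ p/2. -/
lemma norm_powSum_prime_sq_le {p : ℕ} [Fact p.Prime] {d : ℕ} (hd : 0 < d) {u : ZMod p}
    (hu : u ≠ 0) : ‖powSum d p u‖ ^ 2 ≤ 2 * d ^ 2 * p := by
  have hp : p.Prime := Fact.out
  have h1 : ((p : ℝ) - 1) * ‖powSum d p u‖ ^ 2 ≤ d * (d * (p : ℝ) ^ 2) := by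
    have hc : (#(univ.erase (0 : ZMod p)) : ℝ) = p - 1 := by
      rw [card_erase_of_mem (mem_univ _), card_univ, ZMod.card, Nat.cast_sub hp.one_le]; simp
    calc ((p : ℝ) - 1) * ‖powSum d p u‖ ^ 2
        = ∑ t ∈ univ.erase (0 : ZMod p), ‖powSum d p (u * t ^ d)‖ ^ 2 := by
          rw [sum_congr rfl fun t ht => by rw [powSum_mul_pow d u t (ne_of_mem_erase ht)],
            sum_const, nsmul_eq_mul, hc]
      _ ≤ ∑ t : ZMod p, ‖powSum d p (u * t ^ d)‖ ^ 2 :=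
          sum_le_sum_of_subset_of_nonneg (subset_univ _) fun _ _ _ => by positivity
      _ = ∑ b : ZMod p, ∑ t : ZMod p with u * t ^ d = b, ‖powSum d p (u * t ^ d)‖ ^ 2 :=
          (sum_fiberwise _ _ _).symm
      _ ≤ ∑ b : ZMod p, d * ‖powSum d p b‖ ^ 2 := by
          refine sum_le_sum fun b _ => ?_
          rw [sum_congr rfl (g := fun _ => ‖powSum d p b‖ ^ 2)
            (fun t ht => by rw [(mem_filter.1 ht).2]), sum_const, nsmul_eq_mul]
          gcongr
          refine le_trans (card_le_card fun t ht => ?_) (card_filter_pow_eq_le hd (u⁻¹ * b))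
          simp only [mem_filter, mem_univ, true_and] at ht ⊢
          rw [← ht, inv_mul_cancel_left₀ hu]
      _ ≤ d * (d * (p : ℝ) ^ 2) := by
          rw [← mul_sum]
          exact mul_le_mul_of_nonneg_left (sum_norm_powSum_sq_le hd) (by positivity)
  have hp2 : (2 : ℝ) ≤ p := by exact_mod_cast hp.two_le
  have h2 : (p : ℝ) / 2 * ‖powSum d p u‖ ^ 2 ≤ (p / 2) * (2 * d ^ 2 * p) := by
    calc (p : ℝ) / 2 * ‖powSum d p u‖ ^ 2 ≤ ((p : ℝ) - 1) * ‖powSum d p u‖ ^ 2 := by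
          gcongr; linarith
      _ ≤ _ := h1
      _ = _ := by ring
  exact le_of_mul_le_mul_left h2 (by positivity)

/-- The normalised complete sum modulo `q`. -/
noncomputable def relSum (d q : ℕ) [NeZero q] (b : ZMod q) : ℝ := ‖powSum d q b‖ / q

lemma relSum_nonneg (d q : ℕ) [NeZero q] (b : ZMod q) : 0 ≤ relSum d q b := by
  unfold relSum; positivity

lemma relSum_le_one (d q : ℕ) [NeZero q] (b : ZMod q) : relSum d q b ≤ 1 :=
  div_le_one_of_le₀ (norm_powSum_le d q b) (by positivity)

lemma norm_S_div_le_one (d q a : ℕ) : ‖S d q a‖ / q ≤ 1 :=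
  div_le_one_of_le₀ (norm_S_le d q a) (by positivity)

/-- An element of `ZMod (p ^ m)` of additive order `p ^ l` behaves like a unit modulo `p ^ l`. -/
lemma exists_addOrderOf_relSum {p : ℕ} [Fact p.Prime] (d m : ℕ) (b : ZMod (p ^ m)) :
    ∃ l u : ℕ, l ≤ m ∧ ¬ p ∣ u ∧ addOrderOf b = p ^ l ∧
      relSum d (p ^ m) b = ‖S d (p ^ l) u‖ / (p : ℝ) ^ l := by
  have hp : p.Prime := Fact.out
  obtain ⟨l, u, hl, hu, hb⟩ : ∃ l u : ℕ, l ≤ m ∧ ¬ p ∣ u ∧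
      b = ((p ^ (m - l) * u : ℕ) : ZMod (p ^ m)) := by
    rcases eq_or_ne b 0 with rfl | hb
    · refine ⟨0, 1, by simp, hp.one_lt.ne' ∘ Nat.dvd_one.1, ?_⟩
      rw [eq_comm, ZMod.natCast_eq_zero_iff]; simp
    · have hv : b.val ≠ 0 := by simpa [ZMod.val_eq_zero] using hb
      obtain ⟨v, u, hu, hvu⟩ := Nat.exists_eq_pow_mul_and_not_dvd hv p hp.one_lt.ne'
      have hvm : v < m := by
        have h1 := b.val_lt
        have h2 : p ^ v ≤ b.val := Nat.le_of_dvd (Nat.pos_of_ne_zero hv) ⟨u, hvu⟩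
        exact (Nat.pow_lt_pow_iff_right hp.one_lt).1 (h2.trans_lt h1)
      refine ⟨m - v, u, by omega, hu, ?_⟩
      have : m - (m - v) = v := by omega
      rw [this, ← hvu]; simp
  have hpm : p ^ m = p ^ (m - l) * p ^ l := by rw [← pow_add]; congr 1; omega
  refine ⟨l, u, hl, hu, ?_, ?_⟩
  · rw [hb, ZMod.addOrderOf_coe _ (NeZero.ne _)]
    have h1 : Nat.gcd (p ^ m) (p ^ (m - l) * u) = p ^ (m - l) := by
      rw [hpm, Nat.gcd_mul_left]
      have : Nat.gcd (p ^ l) u = 1 := Nat.Coprime.pow_left _ ((Nat.Prime.coprime_iff_not_dvd hp).2 hu)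
      rw [this, mul_one]
    rw [h1, hpm, Nat.mul_div_cancel_left _ (pow_pos hp.pos _)]
  · have h1 := S_mul_mul d (p ^ l) u (p ^ (m - l)) (pow_ne_zero _ hp.ne_zero)
    rw [← hpm] at h1
    rw [relSum, hb, ← S_eq_powSum, h1, norm_mul]
    have h2 : ((p ^ m : ℕ) : ℝ) = p ^ (m - l) * p ^ l := by exact_mod_cast hpm
    have hp0 : (p : ℝ) ≠ 0 := by exact_mod_cast hp.ne_zero
    rw [h2]; simp; field_simp

lemma norm_S_prime_div_le {p : ℕ} [Fact p.Prime] {d u : ℕ} (hd : 0 < d) (hu : ¬ p ∣ u) :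
    ‖S d p u‖ / p ≤ 2 * d * (p : ℝ) ^ (-(1 / 2 : ℝ)) := by
  have hp : p.Prime := Fact.out
  have hp0 : (0 : ℝ) < p := by exact_mod_cast hp.pos
  have h1 := norm_powSum_prime_sq_le (p := p) hd (u := (u : ZMod p))
    (by rwa [Ne, ZMod.natCast_eq_zero_iff])
  rw [← S_eq_powSum] at h1
  rw [div_le_iff₀ hp0]
  have h3 : (p : ℝ) ^ (-(1 / 2 : ℝ)) * p = √p := by
    rw [Real.sqrt_eq_rpow]
    nth_rewrite 2 [← Real.rpow_one (p : ℝ)]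
    rw [← Real.rpow_add hp0]; norm_num
  rw [mul_assoc, h3]
  refine abs_le_of_sq_le_sq' ?_ (by positivity) |>.2
  rw [mul_pow, Real.sq_sqrt hp0.le]
  nlinarith [sq_nonneg (d : ℝ)]

lemma norm_S_prime_pow_div_le_inv {p : ℕ} [Fact p.Prime] {d l u : ℕ} (hd : 2 ≤ d) (hpd : ¬ p ∣ d)
    (hl : 2 ≤ l) (hld : l ≤ d) (hu : ¬ p ∣ u) : ‖S d (p ^ l) u‖ / (p : ℝ) ^ l ≤ (p : ℝ)⁻¹ := by
  have hp : p.Prime := Fact.out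
  have hp0 : (0 : ℝ) < p := by exact_mod_cast hp.pos
  rw [S_prime_pow_of_le (τ := 0) (d' := d) hd (by simp) hpd (by simpa using hl) hu hld]
  have h1 : (p : ℝ) ^ l = p ^ (l - 1) * p := by rw [← pow_succ]; congr 1; omega
  rw [h1]; simp; field_simp; rfl

/-- Induction on l in steps of d, each of which gains 1/p on both sides. The constant d³ has to
cover only the initial values of l. -/
lemma norm_S_prime_pow_div_le {p : ℕ} [Fact p.Prime] {d : ℕ} (hd : 2 ≤ d) (l u : ℕ)
    (hu : ¬ p ∣ u) :
    ‖S d (p ^ l) u‖ / (p : ℝ) ^ l ≤ d ^ 3 * (p : ℝ) ^ (-((l : ℝ) / d)) := by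
  have hp : p.Prime := Fact.out
  have hp0 : (0 : ℝ) < p := by exact_mod_cast hp.pos
  have hp1 : (1 : ℝ) ≤ p := by exact_mod_cast hp.one_le
  have hd0 : (0 : ℝ) < d := by positivity
  have hd2 : (2 : ℝ) ≤ d := by exact_mod_cast hd
  have hle1 : ‖S d (p ^ l) u‖ / (p : ℝ) ^ l ≤ 1 := by simpa using norm_S_div_le_one d (p ^ l) u
  induction l using Nat.strong_induction_on with
  | _ l ih =>
  obtain ⟨τ, d', hd', hdd⟩ := Nat.exists_eq_pow_mul_and_not_dvd (n := d) (by omega) p hp.one_lt.ne'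
  have hd1 : (1 : ℝ) ≤ (d : ℝ) ^ 3 := one_le_pow₀ (by linarith)
  by_cases hl : 2 * τ + 2 ≤ l ∧ d ≤ l
  · rw [S_prime_pow_of_ge hd hdd hd' hl.1 hu hl.2]
    have h1 : (p : ℝ) ^ l = p ^ (d - 1) * p * p ^ (l - d) := by
      rw [← pow_succ, ← pow_add]; congr 1; omega
    have h2 := ih (l - d) (by omega) (by simpa using norm_S_div_le_one d (p ^ (l - d)) u)
    have h3 : (p : ℝ) ^ (-((l : ℝ) / d)) = (p : ℝ)⁻¹ * (p : ℝ) ^ (-(((l - d : ℕ) : ℝ) / d)) := by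
      rw [← Real.rpow_neg_one, ← Real.rpow_add hp0]
      congr 1
      rw [Nat.cast_sub hl.2]; field_simp; ring
    rw [h3, h1, norm_mul]
    have h4 : ‖(p : ℂ) ^ (d - 1)‖ = (p : ℝ) ^ (d - 1) := by simp
    rw [h4]
    calc _ = (p : ℝ)⁻¹ * (‖S d (p ^ (l - d)) u‖ / (p : ℝ) ^ (l - d)) := by field_simp
      _ ≤ (p : ℝ)⁻¹ * _ := mul_le_mul_of_nonneg_left h2 (by positivity)
      _ = _ := by ring
  · by_cases hpd : p ∣ d
    · have hτ : τ < d := by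
        have : p ^ τ ≤ d := Nat.le_of_dvd (by omega) ⟨d', hdd⟩
        exact (Nat.lt_pow_self hp.one_lt).trans_le this
      have hpd' : (p : ℝ) ≤ d := by exact_mod_cast Nat.le_of_dvd (by omega) hpd
      -- Here l ≤ 2τ + 1 or l < d, and τ < d. As p ≤ d, the claimed bound is at least d³ p^(-3) ≥ 1,
      -- so the trivial estimate suffices.
      have h1 : (l : ℝ) / d ≤ 3 := by
        rw [div_le_iff₀ hd0]
        have : l ≤ 3 * d := by
          rw [not_and_or] at hl
          omega
        exact_mod_cast this
      refine hle1.trans ?_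
      rw [Real.rpow_neg hp0.le, ← div_eq_mul_inv, le_div_iff₀ (by positivity), one_mul]
      calc (p : ℝ) ^ ((l : ℝ) / d) ≤ (p : ℝ) ^ (3 : ℝ) := Real.rpow_le_rpow_of_exponent_le hp1 h1
        _ = (p : ℝ) ^ 3 := by norm_cast
        _ ≤ _ := by gcongr
    · have hτ : τ = 0 := by
        by_contra h
        exact hpd (hdd ▸ (dvd_pow_self p h).mul_right d')
      subst hτ
      have hl' : l < d := by omega
      rcases Nat.lt_or_ge l 2 with h2 | h2
      · interval_cases l
        · simpa using hle1.trans hd1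
        · have h1 := norm_S_prime_div_le (p := p) (d := d) (by omega) hu
          have h3 : (p : ℝ) ^ (-(1 / 2 : ℝ)) ≤ (p : ℝ) ^ (-(((1 : ℕ) : ℝ) / d)) := by
            apply Real.rpow_le_rpow_of_exponent_le hp1
            have : ((1 : ℕ) : ℝ) / d ≤ 1 / 2 := by
              push_cast; exact one_div_le_one_div_of_le (by norm_num) hd2
            linarith
          have h4 : (2 : ℝ) * d ≤ d ^ 3 := by nlinarith [mul_pos hd0 hd0]
          simp only [pow_one]
          refine h1.trans (mul_le_mul h4 h3 (by positivity) (by positivity))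
      · refine (norm_S_prime_pow_div_le_inv hd hpd h2 hl'.le hu).trans ?_
        rw [← Real.rpow_neg_one]
        have h3 : (p : ℝ) ^ (-1 : ℝ) ≤ (p : ℝ) ^ (-((l : ℝ) / d)) := by
          apply Real.rpow_le_rpow_of_exponent_le hp1
          have : (l : ℝ) / d ≤ 1 := by
            rw [div_le_one hd0]; exact_mod_cast hl'.le
          linarith
        exact h3.trans (le_mul_of_one_le_left (by positivity) hd1)

end MagicSquare

/-! ### Terms of the singular series and congruence counts -/

namespace MagicSquare
open Finset

/-- The solutions of the magic square system of exponent `d` and line sum `μ` over a ring. -/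
def Solutions (n d μ : ℕ) (R : Type*) [CommRing R] : Type _ :=
  {x : Fin n × Fin n → R // ∀ r, ∑ c, magicMatrix R n r c * x c ^ d = (μ : R)}

lemma map_magicMatrix {R R' : Type*} [CommRing R] [CommRing R'] (f : R →+* R') (n : ℕ) (r : Eqn n)
    (c : Fin n × Fin n) : f (magicMatrix R n r c) = magicMatrix R' n r c := by
  rcases r with i | j | k
  · simp only [magicMatrix]; split_ifs <;> simp
  · simp only [magicMatrix]; split_ifs <;> simp
  · fin_cases k <;> simp only [magicMatrix] <;> split_ifs <;> simp

lemma natCast_magicMatrix {R : Type*} [CommRing R] (n : ℕ) (r : Eqn n)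
    (c : Fin n × Fin n) : ((magicMatrix ℕ n r c : ℕ) : R) = magicMatrix R n r c := by
  rcases r with i | j | k
  · simp only [magicMatrix]; split_ifs <;> simp
  · simp only [magicMatrix]; split_ifs <;> simp
  · fin_cases k <;> simp only [magicMatrix] <;> split_ifs <;> simp

lemma natCast_dotProduct_col {R : Type*} [CommRing R] (n : ℕ) (a : Eqn n → ℕ) (c : Fin n × Fin n) :
    ((a ⬝ᵥ (magicMatrix ℕ n).col c : ℕ) : R) =
      ((fun r => (a r : R)) ᵥ* magicMatrix R n) c := by
  simp [dotProduct, Matrix.vecMul, Matrix.col, natCast_magicMatrix]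

lemma solutions_map {R R' : Type*} [CommRing R] [CommRing R'] (f : R →+* R') {n d μ : ℕ}
    {x : Fin n × Fin n → R} (hx : ∀ r, ∑ c, magicMatrix R n r c * x c ^ d = (μ : R)) (r : Eqn n) :
    ∑ c, magicMatrix R' n r c * f (x c) ^ d = (μ : R') := by
  have := congrArg f (hx r)
  simpa [map_magicMatrix] using this

/-- Solutions over isomorphic rings correspond. -/
def solutionsCongr {R R' : Type*} [CommRing R] [CommRing R'] (f : R ≃+* R') (n d μ : ℕ) :
    Solutions n d μ R ≃ Solutions n d μ R' where
  toFun x := ⟨fun c => f (x.1 c), solutions_map f.toRingHom x.2⟩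
  invFun x := ⟨fun c => f.symm (x.1 c), solutions_map f.symm.toRingHom x.2⟩
  left_inv x := Subtype.ext (by funext c; simp)
  right_inv x := Subtype.ext (by funext c; simp)

/-- Solutions over a product ring are pairs of solutions. -/
def solutionsProd (R R' : Type*) [CommRing R] [CommRing R'] (n d μ : ℕ) :
    Solutions n d μ (R × R') ≃ Solutions n d μ R × Solutions n d μ R' where
  toFun x := (⟨fun c => (x.1 c).1, solutions_map (RingHom.fst R R') x.2⟩,
    ⟨fun c => (x.1 c).2, solutions_map (RingHom.snd R R') x.2⟩)
  invFun x := ⟨fun c => (x.1.1 c, x.2.1 c), fun r => by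
    have h1 := x.1.2 r
    have h2 := x.2.2 r
    refine Prod.ext ?_ ?_
    · rw [Prod.fst_sum, Prod.fst_natCast]
      refine Eq.trans ?_ h1
      refine sum_congr rfl fun c _ => ?_
      rw [Prod.fst_mul, Prod.pow_fst, ← map_magicMatrix (RingHom.fst R R')]; rfl
    · rw [Prod.snd_sum, Prod.snd_natCast]
      refine Eq.trans ?_ h2
      refine sum_congr rfl fun c _ => ?_
      rw [Prod.snd_mul, Prod.pow_snd, ← map_magicMatrix (RingHom.snd R R')]; rfl⟩
  left_inv _ := rfl
  right_inv _ := rfl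

/-- The number of solutions modulo `q`. -/
noncomputable def solCount (n d μ q : ℕ) : ℕ := Nat.card (Solutions n d μ (ZMod q))

lemma solCount_mul (n d μ : ℕ) {q q' : ℕ} (h : q.Coprime q') :
    solCount n d μ (q * q') = solCount n d μ q * solCount n d μ q' := by
  rw [solCount, solCount, solCount, ← Nat.card_prod]
  exact Nat.card_congr ((solutionsCongr (ZMod.chineseRemainder h) n d μ).trans
    (solutionsProd _ _ n d μ))

lemma solCount_one (n d μ : ℕ) : solCount n d μ 1 = 1 := by
  rw [solCount, Nat.card_eq_one_iff_unique]
  refine ⟨⟨fun a b => Subtype.ext (Subsingleton.elim _ _)⟩, ⟨⟨fun _ => 0, fun r => ?_⟩⟩⟩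
  exact Subsingleton.elim _ _

lemma solCount_eq_card (n d μ q : ℕ) [NeZero q] : solCount n d μ q =
    #{x : Fin n × Fin n → ZMod q | ∀ r, ∑ c, magicMatrix (ZMod q) n r c * x c ^ d = (μ : ZMod q)} := by
  rw [solCount, Solutions, Nat.card_eq_fintype_card, Fintype.card_subtype]

/-- The product of complete sums and the additive twist that make up the singular series. -/
noncomputable def sumTerm (n d μ q : ℕ) (a : Eqn n → ℕ) : ℂ :=
  (∏ c : Fin n × Fin n, S d q (a ⬝ᵥ (magicMatrix ℕ n).col c)) * e (-(μ * ∑ r, (a r : ℝ)) / q)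

lemma A_eq (n d μ q : ℕ) :
    A n d μ q = ((q : ℂ) ^ (n ^ 2))⁻¹ * ∑ a ∈ primitiveVectors n q, sumTerm n d μ q a := rfl

lemma sumTerm_mul_mul (n d μ q g : ℕ) (hg : g ≠ 0) [NeZero q] (a : Eqn n → ℕ) :
    sumTerm n d μ (g * q) (fun r => g * a r) = (g : ℂ) ^ (n ^ 2) * sumTerm n d μ q a := by
  have hg' : (g : ℝ) ≠ 0 := by exact_mod_cast hg
  have h1 : ∀ c : Fin n × Fin n, (fun r => g * a r) ⬝ᵥ (magicMatrix ℕ n).col c =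
      g * (a ⬝ᵥ (magicMatrix ℕ n).col c) := by
    intro c
    simp only [dotProduct, mul_sum, mul_assoc]
  rw [sumTerm, sumTerm]
  simp_rw [h1, S_mul_mul _ _ _ _ hg]
  rw [prod_mul_distrib, prod_const, card_univ, Fintype.card_prod, Fintype.card_fin, sq, mul_assoc]
  congr 3
  push_cast
  rw [← mul_sum]; field_simp

lemma sumTerm_eq (n d μ q : ℕ) [NeZero q] (a : Eqn n → ℕ) :
    sumTerm n d μ q a = (∏ c : Fin n × Fin n,
      powSum d q (((fun r => (a r : ZMod q)) ᵥ* magicMatrix (ZMod q) n) c)) *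
      ZMod.stdAddChar (-((μ : ZMod q) * ∑ r, (a r : ZMod q))) := by
  rw [sumTerm]
  congr 1
  · refine prod_congr rfl fun c _ => ?_
    rw [S_eq_powSum, natCast_dotProduct_col]
  · have := e_intCast_div q (-(μ * ∑ r, (a r : ℤ)))
    push_cast at this
    exact this

lemma sum_piFinset_Icc_eq {ι : Type*} [Fintype ι] [DecidableEq ι] {R : Type*} [AddCommMonoid R]
    (q : ℕ) [NeZero q] (f : (ι → ZMod q) → R) :
    ∑ a ∈ Fintype.piFinset (fun _ : ι => Icc 1 q), f (fun r => (a r : ZMod q)) = ∑ a, f a := by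
  have hb := bijOn_natCast_Icc q
  refine sum_nbij (fun a r => (a r : ZMod q)) (by simp) ?_ ?_ (by simp)
  · intro a ha b hb' hab
    funext r
    exact hb.2.1 (Fintype.mem_piFinset.1 ha r) (Fintype.mem_piFinset.1 hb' r) (congrFun hab r)
  · intro a _
    choose b hb1 hb2 using fun r => hb.2.2 (Set.mem_univ (a r))
    exact ⟨b, mem_coe.2 (Fintype.mem_piFinset.2 fun r => hb1 r), funext hb2⟩

lemma addChar_map_sum {G R ι : Type*} [AddCommGroup G] [CommRing R] (ψ : AddChar G R)
    (s : Finset ι) (f : ι → G) : ψ (∑ i ∈ s, f i) = ∏ i ∈ s, ψ (f i) := by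
  classical
  induction s using Finset.induction_on with
  | empty => simp
  | insert a s ha ih => rw [sum_insert ha, prod_insert ha, AddChar.map_add_eq_mul, ih]

/-- Orthogonality of additive characters, one for each equation: expanding the product over the
cells and summing over the coefficient vector detects the solutions modulo q. -/
lemma sum_prod_powSum_eq (n d μ q : ℕ) [NeZero q] :
    ∑ a : Eqn n → ZMod q, (∏ c : Fin n × Fin n, powSum d q ((a ᵥ* magicMatrix (ZMod q) n) c)) *
      ZMod.stdAddChar (-((μ : ZMod q) * ∑ r, a r)) =
      (q : ℂ) ^ Fintype.card (Eqn n) * solCount n d μ q := by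
  have h1 : ∀ a : Eqn n → ZMod q,
      (∏ c : Fin n × Fin n, powSum d q ((a ᵥ* magicMatrix (ZMod q) n) c)) *
      ZMod.stdAddChar (-((μ : ZMod q) * ∑ r, a r)) = ∑ x : Fin n × Fin n → ZMod q,
        ∏ r, (ZMod.stdAddChar (a r * (∑ c, magicMatrix (ZMod q) n r c * x c ^ d - (μ : ZMod q))) : ℂ) := by
    intro a
    simp only [powSum]
    rw [prod_univ_sum, Fintype.piFinset_univ, sum_mul]
    refine sum_congr rfl fun x _ => ?_
    rw [← addChar_map_sum, ← addChar_map_sum, ← AddChar.map_add_eq_mul]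
    congr 1
    simp only [Matrix.vecMul, dotProduct, mul_sub, sum_sub_distrib, sum_mul, mul_sum]
    rw [sum_comm, sub_eq_add_neg]
    simp only [mul_assoc, mul_comm (μ : ZMod q)]
  simp_rw [h1]
  rw [sum_comm]
  have h2 : ∀ x : Fin n × Fin n → ZMod q, ∑ a : Eqn n → ZMod q,
      ∏ r, (ZMod.stdAddChar (a r * (∑ c, magicMatrix (ZMod q) n r c * x c ^ d - (μ : ZMod q))) : ℂ) =
      if ∀ r, ∑ c, magicMatrix (ZMod q) n r c * x c ^ d = (μ : ZMod q)
        then (q : ℂ) ^ Fintype.card (Eqn n) else 0 := by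
    intro x
    have := prod_univ_sum (fun _ : Eqn n => (univ : Finset (ZMod q)))
      (fun r b => (ZMod.stdAddChar (b * (∑ c, magicMatrix (ZMod q) n r c * x c ^ d - (μ : ZMod q))) : ℂ))
    rw [Fintype.piFinset_univ] at this
    rw [← this]
    simp_rw [AddChar.sum_mulShift _ (ZMod.isPrimitive_stdAddChar q), ZMod.card, sub_eq_zero]
    split_ifs with h
    · simp [h]
    · push Not at h
      obtain ⟨r, hr⟩ := h
      exact prod_eq_zero (mem_univ r) (by simp [hr])
  simp_rw [h2]
  rw [← sum_filter, sum_const, nsmul_eq_mul, solCount_eq_card, mul_comm]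

lemma sum_sumTerm_eq (n d μ q : ℕ) [NeZero q] :
    ∑ a ∈ Fintype.piFinset (fun _ : Eqn n => Icc 1 q), sumTerm n d μ q a =
      (q : ℂ) ^ Fintype.card (Eqn n) * solCount n d μ q := by
  rw [← sum_prod_powSum_eq, ← sum_piFinset_Icc_eq]
  exact sum_congr rfl fun a _ => sumTerm_eq n d μ q a

/-- A vector having gcd g with the modulus g q is g times a primitive vector modulo q. The fractions
are unchanged, so each of the n² complete sums just acquires a factor g. -/
lemma sum_filter_gcd_eq (n d μ : ℕ) {q g : ℕ} (hq : q ≠ 0) (hg : g ≠ 0) :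
    ∑ a ∈ (Fintype.piFinset fun _ : Eqn n => Icc 1 (g * q)) with
      Nat.gcd (g * q) (univ.gcd a) = g, sumTerm n d μ (g * q) a =
    (g : ℂ) ^ (n ^ 2) * ∑ a ∈ primitiveVectors n q, sumTerm n d μ q a := by
  have : NeZero q := ⟨hq⟩
  rw [mul_sum]
  symm
  have hgcd : ∀ a : Eqn n → ℕ, univ.gcd (fun r => g * a r) = g * univ.gcd a := by
    intro a
    rw [Finset.gcd_mul_left]; simp
  refine sum_bij (fun a _ r => g * a r) ?_ ?_ ?_ ?_
  · intro a ha
    simp only [primitiveVectors, mem_filter, Fintype.mem_piFinset, mem_Icc] at ha ⊢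
    refine ⟨fun r => ⟨Nat.mul_pos (Nat.pos_of_ne_zero hg) (ha.1 r).1,
      Nat.mul_le_mul_left _ (ha.1 r).2⟩, ?_⟩
    rw [hgcd, Nat.gcd_mul_left, ha.2, mul_one]
  · intro a _ b _ hab
    funext r
    exact Nat.eq_of_mul_eq_mul_left (Nat.pos_of_ne_zero hg) (congrFun hab r)
  · intro b hb
    simp only [mem_filter, Fintype.mem_piFinset, mem_Icc] at hb
    have hdvd : ∀ r, g ∣ b r := fun r =>
      ((hb.2 ▸ Nat.gcd_dvd_right _ _ : g ∣ univ.gcd b)).trans (gcd_dvd (mem_univ r))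
    choose a ha using hdvd
    have hba : b = fun r => g * a r := funext ha
    refine ⟨a, ?_, hba.symm⟩
    have hg' := Nat.pos_of_ne_zero hg
    simp only [primitiveVectors, mem_filter, Fintype.mem_piFinset, mem_Icc]
    refine ⟨fun r => ?_, ?_⟩
    · have h1 := hb.1 r
      rw [ha r] at h1
      exact ⟨Nat.pos_of_mul_pos_left (Nat.lt_of_lt_of_le Nat.zero_lt_one h1.1),
        Nat.le_of_mul_le_mul_left h1.2 hg'⟩
    · have h1 := hb.2
      rw [hba, hgcd, Nat.gcd_mul_left] at h1
      exact Nat.eq_of_mul_eq_mul_left hg' (by rw [h1, mul_one])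
  · intro a _
    exact (sumTerm_mul_mul n d μ q g hg a).symm

/-- The bridge from the series to solution counts: all vectors modulo q are sorted by their gcd with
q, and the normalisation in A absorbs the powers of the gcd. -/
lemma sum_divisors_A (n d μ q : ℕ) [NeZero q] :
    ∑ q' ∈ q.divisors, A n d μ q' =
      ((q : ℂ) ^ (n ^ 2))⁻¹ * ((q : ℂ) ^ Fintype.card (Eqn n) * solCount n d μ q) := by
  have hq : q ≠ 0 := NeZero.ne q
  rw [← sum_sumTerm_eq, ← Nat.sum_div_divisors,
    ← sum_fiberwise_of_maps_to (s := Fintype.piFinset fun _ : Eqn n => Icc 1 q) (t := q.divisors)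
      (g := fun a => Nat.gcd q (univ.gcd a)) (fun a _ => by simp [hq, Nat.gcd_dvd_left]), mul_sum]
  refine sum_congr rfl fun g hg => ?_
  obtain ⟨q', rfl⟩ := Nat.dvd_of_mem_divisors hg
  have hg0 : g ≠ 0 := left_ne_zero_of_mul hq
  have hq0 : q' ≠ 0 := right_ne_zero_of_mul hq
  rw [sum_filter_gcd_eq n d μ hq0 hg0, Nat.mul_div_cancel_left _ (Nat.pos_of_ne_zero hg0), A_eq]
  have h1 : (g : ℂ) ^ (n ^ 2) ≠ 0 := pow_ne_zero _ (by exact_mod_cast hg0)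
  have h2 : (q' : ℂ) ^ (n ^ 2) ≠ 0 := pow_ne_zero _ (by exact_mod_cast hq0)
  push_cast
  rw [mul_pow]; field_simp

lemma A_zero (n d μ : ℕ) : A n d μ 0 = 0 := by
  have : primitiveVectors n 0 = ∅ := by
    rw [primitiveVectors, filter_eq_empty_iff]
    intro a ha
    have := Fintype.mem_piFinset.1 ha (Sum.inr (Sum.inr 0))
    simp at this
  rw [A, this]; simp

-- The divisor sums of A are multiplicative by the Chinese remainder theorem for solution counts.
-- Möbius inversion writes A as their Dirichlet product with the Möbius function, so A is
-- multiplicative too.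
open ArithmeticFunction in
lemma A_mul (n d μ : ℕ) {q q' : ℕ} (h : q.Coprime q') :
    A n d μ (q * q') = A n d μ q * A n d μ q' := by
  set F : ArithmeticFunction ℂ := ⟨A n d μ, A_zero n d μ⟩ with hF
  have hG : (F * (zeta : ArithmeticFunction ℂ)).IsMultiplicative := by
    refine IsMultiplicative.iff_ne_zero.2 ⟨?_, ?_⟩
    · rw [coe_mul_zeta_apply]
      have := sum_divisors_A n d μ 1
      rw [solCount_one] at this
      simpa [hF] using this
    · intro a b ha hb hab
      have : NeZero a := ⟨ha⟩
      have : NeZero b := ⟨hb⟩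
      have : NeZero (a * b) := ⟨mul_ne_zero ha hb⟩
      rw [coe_mul_zeta_apply, coe_mul_zeta_apply, coe_mul_zeta_apply]
      have h1 := sum_divisors_A n d μ (a * b)
      have h2 := sum_divisors_A n d μ a
      have h3 := sum_divisors_A n d μ b
      simp only [hF, coe_mk] at *
      rw [h1, h2, h3, solCount_mul _ _ _ hab]
      push_cast
      rw [mul_pow, mul_pow, mul_inv]; ring
  have hFm : F.IsMultiplicative := by
    have : F = (F * (zeta : ArithmeticFunction ℂ)) * (moebius : ArithmeticFunction ℂ) := by
      rw [mul_assoc, coe_zeta_mul_coe_moebius, mul_one]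
    rw [this]
    exact hG.mul isMultiplicative_moebius.intCast
  exact hFm.map_mul_of_coprime h

lemma A_one (n d μ : ℕ) : A n d μ 1 = 1 := by
  have := sum_divisors_A n d μ 1
  rw [solCount_one] at this
  simpa using this

lemma sum_range_A_prime_pow {p : ℕ} (hp : p.Prime) (n d μ m : ℕ) :
    ∑ j ∈ range (m + 1), A n d μ (p ^ j) = (((p : ℂ) ^ m) ^ (n ^ 2))⁻¹ *
      (((p : ℂ) ^ m) ^ Fintype.card (Eqn n) * solCount n d μ (p ^ m)) := by
  have : NeZero (p ^ m) := ⟨pow_ne_zero _ hp.ne_zero⟩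
  have h := sum_divisors_A n d μ (p ^ m)
  rw [Nat.sum_divisors_prime_pow hp] at h
  simpa using h

end MagicSquare

/-! ### Minimum weight of combinations of the equations -/

namespace MagicSquare
open Finset

section Weight

variable {K : Type*} [AddCommGroup K] {n : ℕ}

/-- The contribution of the two diagonals to the cells. -/
def diagPart (u v : K) (i j : Fin n) : K :=
  (if i = j then u else 0) + if j = Fin.rev i then v else 0

lemma diagPart_of_ne {u v : K} {i j : Fin n} (h1 : i ≠ j) (h2 : j ≠ Fin.rev i) :
    diagPart u v i j = 0 := by simp [diagPart, h1, h2]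

lemma diagPart_self {u v : K} {i : Fin n} (h : i ≠ Fin.rev i) : diagPart u v i i = u := by
  simp [diagPart, h]

lemma diagPart_rev {u v : K} {i : Fin n} (h : i ≠ Fin.rev i) :
    diagPart u v i (Fin.rev i) = v := by
  simp [diagPart, h]

lemma card_compl_ge (s : Finset (Fin n)) (k : ℕ) (h : #s ≤ k) : n - k ≤ #sᶜ := by
  rw [card_compl, Fintype.card_fin]; omega

/-- The expression is what remains of a combination once the row and column weights have been
eliminated through a zero row i₀ and a zero column j₀. The diagonal part lives on two cells per
line, so away from a few lines only single terms survive, and these can be counted. -/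
lemma diagPart_eq_zero_of_card_lt [DecidableEq K] (hn : 7 ≤ n) (u v : K) (i₀ j₀ : Fin n)
    (h : #{c : Fin n × Fin n | diagPart u v c.1 c.2 - diagPart u v i₀ c.2 - diagPart u v c.1 j₀ +
      diagPart u v i₀ j₀ ≠ 0} < n) : u = 0 ∧ v = 0 := by
  set supp : Finset (Fin n × Fin n) := {c | diagPart u v c.1 c.2 - diagPart u v i₀ c.2 -
    diagPart u v c.1 j₀ + diagPart u v i₀ j₀ ≠ 0} with hsupp
  have hmem : ∀ i j, (i, j) ∈ supp ↔ diagPart u v i j - diagPart u v i₀ j -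
    diagPart u v i j₀ + diagPart u v i₀ j₀ ≠ 0 := by intro i j; simp [hsupp]
  have hrev : ∀ {i j : Fin n}, j ≠ Fin.rev i → i ≠ Fin.rev j := by
    intro i j h1 h2; exact h1 (by rw [h2, Fin.rev_rev])
  have hc : diagPart u v i₀ j₀ = 0 := by
    by_contra hc
    have hsub : ((({j₀, Fin.rev j₀} : Finset (Fin n))ᶜ ×ˢ ({i₀, Fin.rev i₀} : Finset (Fin n))ᶜ) \
        (univ.image (fun i : Fin n => (i, i)) ∪ univ.image (fun i : Fin n => (i, Fin.rev i)))) ⊆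
        supp := by
      rintro ⟨i, j⟩ hij
      simp only [mem_sdiff, mem_product, mem_compl, mem_insert, mem_singleton, mem_union,
        mem_image, mem_univ, true_and, not_or, Prod.mk.injEq, not_exists, not_and] at hij
      obtain ⟨⟨⟨h1, h2⟩, h3, h4⟩, h5, h6⟩ := hij
      rw [hmem, diagPart_of_ne (h5 i rfl) (Ne.symm (h6 i rfl)), diagPart_of_ne (Ne.symm h3) h4,
        diagPart_of_ne h1 (hrev h2)]
      simpa using hc
    have h1 := card_le_card hsub
    have h2 := le_card_sdiff (univ.image (fun i : Fin n => (i, i)) ∪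
      univ.image (fun i : Fin n => (i, Fin.rev i)))
      (({j₀, Fin.rev j₀} : Finset (Fin n))ᶜ ×ˢ ({i₀, Fin.rev i₀} : Finset (Fin n))ᶜ)
    have h3 : #(univ.image (fun i : Fin n => (i, i)) ∪
      univ.image (fun i : Fin n => (i, Fin.rev i))) ≤ 2 * n := by
      refine (card_union_le _ _).trans ?_
      have a1 := card_image_le (s := univ) (f := fun i : Fin n => (i, i))
      have a2 := card_image_le (s := univ) (f := fun i : Fin n => (i, Fin.rev i))
      rw [card_univ, Fintype.card_fin] at a1 a2
      omega
    rw [card_product] at h2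
    have h4 := card_compl_ge ({j₀, Fin.rev j₀} : Finset (Fin n)) 2 card_le_two
    have h5 := card_compl_ge ({i₀, Fin.rev i₀} : Finset (Fin n)) 2 card_le_two
    have h6 := Nat.mul_le_mul h4 h5
    obtain ⟨m, rfl⟩ : ∃ m, n = m + 7 := ⟨n - 7, by omega⟩
    have h7 : m + 7 - 2 = m + 5 := by omega
    rw [h7] at h6
    -- A nonzero corner value would be the value at every cell off both diagonals and off two rows
    -- and two columns, at least (n - 2)² - 2n ≥ n cells when n ≥ 7.
    have h8 : (m + 5) * (m + 5) ≥ 3 * (m + 7) := by nlinarith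
    omega
  by_contra huv
  have hW : ∀ i j, (i, j) ∈ supp ↔
      diagPart u v i j - diagPart u v i₀ j - diagPart u v i j₀ ≠ 0 := by
    intro i j; rw [hmem, hc, add_zero]
  have hdiag : ∀ i, i ≠ i₀ → i ≠ Fin.rev i₀ → i ≠ j₀ → i ≠ Fin.rev j₀ → i ≠ Fin.rev i →
      ((i, i) ∈ supp ↔ u ≠ 0) ∧ ((i, Fin.rev i) ∈ supp ↔ v ≠ 0) := by
    intro i h1 h2 h3 h4 h5
    have h6 : i₀ ≠ Fin.rev i := hrev h2
    have h7 : Fin.rev i ≠ Fin.rev i₀ := fun h => h1 (Fin.rev_injective h)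
    rw [hW, hW, diagPart_self h5, diagPart_rev h5, diagPart_of_ne (Ne.symm h1) h2,
      diagPart_of_ne h3 (hrev h4), diagPart_of_ne h6 h7]
    simp
  by_cases hx : (∃ x, diagPart u v i₀ x ≠ 0) ∧ ∃ y, diagPart u v y j₀ ≠ 0
  · obtain ⟨⟨x, hx⟩, y, hy⟩ := hx
    have hx' : x = i₀ ∨ x = Fin.rev i₀ := by
      by_contra h1
      push Not at h1
      exact hx (diagPart_of_ne (Ne.symm h1.1) h1.2)
    have hy' : y = j₀ ∨ y = Fin.rev j₀ := by
      by_contra h1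
      push Not at h1
      exact hy (diagPart_of_ne h1.1 (hrev h1.2))
    set s : Finset (Fin n) := {i₀, Fin.rev i₀, j₀, Fin.rev j₀} with hs
    have hs4 : #s ≤ 4 := card_le_four
    have hsc : ∀ i, i ∈ sᶜ ↔ i ≠ i₀ ∧ i ≠ Fin.rev i₀ ∧ i ≠ j₀ ∧ i ≠ Fin.rev j₀ := by
      intro i; simp [hs]
    have hcard := card_compl_ge s 4 hs4
    obtain ⟨i₁, hi₁s, hi₁⟩ : ∃ i ∈ sᶜ, i ≠ Fin.rev i := by
      have h1 : 1 < #sᶜ := by omega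
      obtain ⟨a, ha, b, hb, hab⟩ := one_lt_card.1 h1
      by_cases haa : a = Fin.rev a
      · refine ⟨b, hb, fun hbb => hab ?_⟩
        have h2 := congrArg Fin.val haa
        have h3 := congrArg Fin.val hbb
        rw [Fin.val_rev] at h2 h3
        exact Fin.ext (by omega)
      · exact ⟨a, ha, haa⟩
    obtain ⟨z, hz, hzz⟩ : ∃ z, (i₁, z) ∈ supp ∧ z ∈ sᶜ := by
      obtain ⟨g1, g2, g3, g4⟩ := (hsc i₁).1 hi₁s
      obtain ⟨h1, h2⟩ := hdiag i₁ g1 g2 g3 g4 hi₁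
      by_cases hu : u = 0
      · refine ⟨Fin.rev i₁, h2.2 fun hv => huv ⟨hu, hv⟩, (hsc _).2 ⟨?_, ?_, ?_, ?_⟩⟩
        · exact fun h => g2 (by rw [← h, Fin.rev_rev])
        · exact fun h => g1 (Fin.rev_injective h)
        · exact fun h => g4 (by rw [← h, Fin.rev_rev])
        · exact fun h => g3 (Fin.rev_injective h)
      · exact ⟨i₁, h1.2 hu, hi₁s⟩
    have hxs : x ∉ sᶜ := by rw [hsc]; rcases hx' with rfl | rfl <;> simp
    have hys : y ∉ sᶜ := by rw [hsc]; rcases hy' with rfl | rfl <;> simp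
    -- Column x and row y contribute n - 4 cells each. One further cell on a diagonal is needed to
    -- reach 2(n - 4) + 1 ≥ n already for n = 7.
    have hsub : insert (i₁, z) (sᶜ.image (fun i => (i, x)) ∪ sᶜ.image (fun j => (y, j))) ⊆
        supp := by
      intro c hc'
      rw [mem_insert, mem_union, mem_image, mem_image] at hc'
      rcases hc' with rfl | ⟨i, hi, rfl⟩ | ⟨j, hj, rfl⟩
      · exact hz
      · obtain ⟨g1, g2, g3, g4⟩ := (hsc i).1 hi
        have h1 : diagPart u v i x = 0 := by
          rcases hx' with rfl | rfl
          · exact diagPart_of_ne g1 (hrev g2)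
          · exact diagPart_of_ne g2 fun h => g1 (Fin.rev_injective h).symm
        rw [hW, h1, diagPart_of_ne g3 (hrev g4)]
        simpa using hx
      · obtain ⟨g1, g2, g3, g4⟩ := (hsc j).1 hj
        have h1 : diagPart u v y j = 0 := by
          rcases hy' with rfl | rfl
          · exact diagPart_of_ne (Ne.symm g3) g4
          · exact diagPart_of_ne (Ne.symm g4) (by rwa [Fin.rev_rev])
        rw [hW, h1, diagPart_of_ne (Ne.symm g1) g2]
        simpa using hy
    have h1 := card_le_card hsub
    rw [card_insert_of_notMem, card_union_of_disjoint, card_image_of_injective,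
      card_image_of_injective] at h1
    · omega
    · intro a b hab; exact (Prod.mk.inj hab).2
    · intro a b hab; exact (Prod.mk.inj hab).1
    · rw [disjoint_left]
      intro c h2 h3
      obtain ⟨i, hi, rfl⟩ := mem_image.1 h2
      obtain ⟨j, hj, hj'⟩ := mem_image.1 h3
      exact hys ((Prod.mk.inj hj').1 ▸ hi)
    · rw [mem_union, mem_image, mem_image]
      rintro (⟨i, hi, hi'⟩ | ⟨j, hj, hj'⟩)
      · exact hxs ((Prod.mk.inj hi').2 ▸ hzz)
      · exact hys ((Prod.mk.inj hj').1 ▸ hi₁s)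
  -- The diagonal part vanishes along row i₀ or column j₀ only if the two diagonals meet there and
  -- cancel, so the index is the middle one and u = -v ≠ 0. Both diagonals then survive outside
  -- three indices, which leaves 2(n - 3) ≥ n cells.
  · have hcen : u ≠ 0 ∧ v ≠ 0 ∧ (i₀ = Fin.rev i₀ ∨ j₀ = Fin.rev j₀) := by
      have key : ∀ i : Fin n, (∀ x, diagPart u v i x = 0) ∨ (∀ x, diagPart u v x i = 0) →
          u ≠ 0 ∧ v ≠ 0 ∧ i = Fin.rev i := by
        intro i hi
        have hir : i = Fin.rev i := by
          by_contra hne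
          have hne' : Fin.rev i ≠ Fin.rev (Fin.rev i) := by rw [Fin.rev_rev]; exact Ne.symm hne
          rcases hi with hi | hi
          · exact huv ⟨by rw [← hi i, diagPart_self hne], by rw [← hi (Fin.rev i), diagPart_rev hne]⟩
          · refine huv ⟨by rw [← hi i, diagPart_self hne], ?_⟩
            have := hi (Fin.rev i)
            have h2 := diagPart_rev (u := u) (v := v) hne'
            rw [Fin.rev_rev] at h2
            rw [← h2, this]
        have h0 : u + v = 0 := by
          have : diagPart u v i i = u + v := by simp [diagPart, ← hir]
          rcases hi with hi | hi <;> rw [← this, hi i]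
        refine ⟨?_, ?_, hir⟩
        · rintro rfl; exact huv ⟨rfl, by simpa using h0⟩
        · rintro rfl; exact huv ⟨by simpa using h0, rfl⟩
      rw [not_and_or] at hx
      push Not at hx
      rcases hx with hx | hx
      · obtain ⟨a, b, c⟩ := key i₀ (Or.inl hx); exact ⟨a, b, Or.inl c⟩
      · obtain ⟨a, b, c⟩ := key j₀ (Or.inr hx); exact ⟨a, b, Or.inr c⟩
    obtain ⟨hu, hv, hcen⟩ := hcen
    obtain ⟨s, hs3, hs⟩ : ∃ s : Finset (Fin n), #s ≤ 3 ∧ ∀ i ∈ sᶜ,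
        i ≠ i₀ ∧ i ≠ Fin.rev i₀ ∧ i ≠ j₀ ∧ i ≠ Fin.rev j₀ ∧ i ≠ Fin.rev i := by
      have huniq : ∀ a b : Fin n, a = Fin.rev a → b = Fin.rev b → b = a := by
        intro a b ha hb
        have h2 := congrArg Fin.val ha
        have h3 := congrArg Fin.val hb
        rw [Fin.val_rev] at h2 h3
        exact Fin.ext (by omega)
      rcases hcen with hcen | hcen
      · refine ⟨{i₀, j₀, Fin.rev j₀}, card_le_three, fun i hi => ?_⟩
        simp only [mem_compl, mem_insert, mem_singleton, not_or] at hi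
        exact ⟨hi.1, hcen ▸ hi.1, hi.2.1, hi.2.2, fun h => hi.1 (huniq _ _ hcen h)⟩
      · refine ⟨{j₀, i₀, Fin.rev i₀}, card_le_three, fun i hi => ?_⟩
        simp only [mem_compl, mem_insert, mem_singleton, not_or] at hi
        exact ⟨hi.2.1, hi.2.2, hi.1, hcen ▸ hi.1, fun h => hi.1 (huniq _ _ hcen h)⟩
    have hcard := card_compl_ge s 3 hs3
    have hsub : sᶜ.image (fun i => (i, i)) ∪ sᶜ.image (fun i => (i, Fin.rev i)) ⊆ supp := by
      intro c hc'
      rw [mem_union, mem_image, mem_image] at hc'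
      rcases hc' with ⟨i, hi, rfl⟩ | ⟨i, hi, rfl⟩ <;> obtain ⟨g1, g2, g3, g4, g5⟩ := hs i hi
      · exact (hdiag i g1 g2 g3 g4 g5).1.2 hu
      · exact (hdiag i g1 g2 g3 g4 g5).2.2 hv
    have h1 := card_le_card hsub
    rw [card_union_of_disjoint, card_image_of_injective, card_image_of_injective] at h1
    · omega
    · intro a b hab; exact (Prod.mk.inj hab).1
    · intro a b hab; exact (Prod.mk.inj hab).1
    · rw [disjoint_left]
      intro c h2 h3
      obtain ⟨i, hi, rfl⟩ := mem_image.1 h2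
      obtain ⟨j, hj, hj'⟩ := mem_image.1 h3
      obtain ⟨h4, h5⟩ := Prod.mk.inj hj'
      exact (hs j hj).2.2.2.2 (by rw [h5, h4])

/-- A nonzero combination of row, column and diagonal indicators has at least `n` nonzero cells. -/
lemma card_support_ge [DecidableEq K] (hn : 7 ≤ n) (r s : Fin n → K) (u v : K)
    (h : ∃ i j, r i + s j + diagPart u v i j ≠ 0) :
    n ≤ #{c : Fin n × Fin n | r c.1 + s c.2 + diagPart u v c.1 c.2 ≠ 0} := by
  by_contra! hlt
  set supp : Finset (Fin n × Fin n) := {c | r c.1 + s c.2 + diagPart u v c.1 c.2 ≠ 0} with hsupp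
  -- Fewer than n nonzero cells leave some row, and likewise some column, entirely zero.
  obtain ⟨i₀, hi₀⟩ : ∃ i₀, ∀ j, r i₀ + s j + diagPart u v i₀ j = 0 := by
    by_contra! hne
    have : (univ : Finset (Fin n)) ⊆ supp.image Prod.fst := by
      intro i _
      obtain ⟨j, hj⟩ := hne i
      exact mem_image.2 ⟨(i, j), by simpa [hsupp] using hj, rfl⟩
    have h1 := (card_le_card this).trans card_image_le
    rw [card_univ, Fintype.card_fin] at h1
    omega
  obtain ⟨j₀, hj₀⟩ : ∃ j₀, ∀ i, r i + s j₀ + diagPart u v i j₀ = 0 := by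
    by_contra! hne
    have : (univ : Finset (Fin n)) ⊆ supp.image Prod.snd := by
      intro j _
      obtain ⟨i, hi⟩ := hne j
      exact mem_image.2 ⟨(i, j), by simpa [hsupp] using hi, rfl⟩
    have h1 := (card_le_card this).trans card_image_le
    rw [card_univ, Fintype.card_fin] at h1
    omega
  have hform : ∀ i j, r i + s j + diagPart u v i j = diagPart u v i j - diagPart u v i₀ j -
      diagPart u v i j₀ + diagPart u v i₀ j₀ := by
    intro i j
    have h1 : diagPart u v i₀ j = -(r i₀ + s j) := by rw [eq_neg_iff_add_eq_zero, add_comm, hi₀]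
    have h2 : diagPart u v i j₀ = -(r i + s j₀) := by rw [eq_neg_iff_add_eq_zero, add_comm, hj₀]
    have h3 : diagPart u v i₀ j₀ = -(r i₀ + s j₀) := by rw [eq_neg_iff_add_eq_zero, add_comm, hj₀]
    rw [h1, h2, h3]; abel
  simp only [hform] at hsupp h
  obtain ⟨rfl, rfl⟩ := diagPart_eq_zero_of_card_lt hn u v i₀ j₀ (hsupp ▸ hlt)
  obtain ⟨i, j, hij⟩ := h
  simp [diagPart] at hij

end Weight

/-- Every nonzero combination of the equations involves at least `n` of the variables. -/
lemma card_vecMul_magicMatrix_ge {K : Type*} [CommRing K] [DecidableEq K] {n : ℕ} (hn : 7 ≤ n)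
    (a : Eqn n → K) (h : a ᵥ* magicMatrix K n ≠ 0) :
    n ≤ #{c : Fin n × Fin n | (a ᵥ* magicMatrix K n) c ≠ 0} := by
  -- The last column has no equation of its own, hence its weight 0.
  have hform : ∀ c : Fin n × Fin n, (a ᵥ* magicMatrix K n) c = a (Sum.inl c.1) +
      (if hj : (c.2 : ℕ) < n - 1 then a (Sum.inr (Sum.inl ⟨c.2, hj⟩)) else 0) +
      diagPart (a (Sum.inr (Sum.inr 0))) (a (Sum.inr (Sum.inr 1))) c.1 c.2 := by
    intro c
    rw [Matrix.vecMul, dotProduct, Fintype.sum_sum_type, Fintype.sum_sum_type, Fin.sum_univ_two]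
    simp only [magicMatrix, mul_ite, mul_one, mul_zero, diagPart]
    rw [sum_ite_eq univ c.1 (fun i => a (Sum.inl i))]
    simp only [mem_univ, if_true, add_assoc]
    congr 2
    split_ifs with hj
    · rw [sum_eq_single ⟨c.2, hj⟩]
      · simp
      · intro b _ hb
        rw [if_neg]
        intro h1; exact hb (Fin.ext h1.symm)
      · simp
    · refine sum_eq_zero fun b _ => ?_
      rw [if_neg]
      intro h1; exact hj (h1 ▸ b.2)
  simp only [hform]
  refine card_support_ge hn (fun i => a (Sum.inl i))
    (fun j => if hj : (j : ℕ) < n - 1 then a (Sum.inr (Sum.inl ⟨j, hj⟩)) else 0) _ _ ?_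
  by_contra! hall
  exact h (funext fun c => by rw [hform]; exact hall c.1 c.2)

end MagicSquare

/-! ### Moments of complete sums over residues modulo a prime power -/

namespace MagicSquare
open Finset

lemma card_nsmul_eq_zero_le {q : ℕ} [NeZero q] {k : ℕ} (hk : 0 < k) :
    #{x : ZMod q | k • x = 0} ≤ k := by
  have : IsAddCyclic (ZMod q) := inferInstance
  exact IsAddCyclic.card_nsmul_eq_zero_le hk

lemma card_mul_int_eq_zero_le {q : ℕ} [NeZero q] {δ : ℤ} (hδ : δ ≠ 0) :
    #{x : ZMod q | (δ : ZMod q) * x = 0} ≤ δ.natAbs := by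
  refine le_trans (card_le_card fun x hx => ?_)
    (card_nsmul_eq_zero_le (q := q) (Int.natAbs_pos.2 hδ))
  simp only [mem_filter, mem_univ, true_and] at hx ⊢
  rw [nsmul_eq_mul]
  rcases Int.natAbs_eq δ with h | h
  · rw [h] at hx; simpa using hx
  · rw [h] at hx; simpa using hx

lemma card_smul_eq_zero_le {ι : Type*} [Fintype ι] [DecidableEq ι] {q : ℕ} [NeZero q] {δ : ℤ}
    (hδ : δ ≠ 0) : #{a : ι → ZMod q | ∀ i, (δ : ZMod q) * a i = 0} ≤
      δ.natAbs ^ Fintype.card ι := by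
  have h : ({a : ι → ZMod q | ∀ i, (δ : ZMod q) * a i = 0} : Finset _) ⊆
      Fintype.piFinset fun _ => {x : ZMod q | (δ : ZMod q) * x = 0} := by
    intro a ha
    rw [Fintype.mem_piFinset]
    simpa using ha
  refine (card_le_card h).trans ?_
  rw [Fintype.card_piFinset, prod_const, card_univ]
  exact Nat.pow_le_pow_left (card_mul_int_eq_zero_le hδ) _

/-- The adjugate inverts B up to its determinant, which also serves at primes dividing the minor. -/
lemma det_mul_eq_of_vecMul {ι R : Type*} [Fintype ι] [DecidableEq ι] [CommRing R]
    (B : Matrix ι ι R) (a : ι → R) (i : ι) : B.det * a i = ((a ᵥ* B) ᵥ* B.adjugate) i := by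
  rw [Matrix.vecMul_vecMul, Matrix.mul_adjugate, Matrix.vecMul_smul, Matrix.vecMul_one]
  rfl

/-- A substitution by an integer matrix is at most `|det| ^ k` to one modulo `q`. -/
lemma sum_vecMul_le {ι : Type*} [Fintype ι] [DecidableEq ι] {q : ℕ} [NeZero q]
    (B : Matrix ι ι (ZMod q)) {δ : ℤ} (hδ : δ ≠ 0) (hB : B.det = (δ : ZMod q))
    (G : (ι → ZMod q) → ℝ) (hG : ∀ b, 0 ≤ G b) :
    ∑ a : ι → ZMod q, G (a ᵥ* B) ≤ (δ.natAbs : ℝ) ^ Fintype.card ι * ∑ b, G b := by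
  rw [← sum_fiberwise univ (fun a : ι → ZMod q => a ᵥ* B), mul_sum]
  refine sum_le_sum fun b _ => ?_
  rw [sum_congr rfl (g := fun _ => G b) (fun a ha => by rw [(mem_filter.1 ha).2]), sum_const,
    nsmul_eq_mul]
  refine mul_le_mul_of_nonneg_right ?_ (hG b)
  have key : #{a : ι → ZMod q | a ᵥ* B = b} ≤ δ.natAbs ^ Fintype.card ι := by
    rcases ({a : ι → ZMod q | a ᵥ* B = b} : Finset _).eq_empty_or_nonempty with h | ⟨a₀, ha₀⟩
    · rw [h]; simp
    · refine le_trans ?_ (card_smul_eq_zero_le (ι := ι) (q := q) hδ)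
      refine card_le_card_of_injOn (fun a => a - a₀) ?_ (fun a _ a' _ h => sub_left_injective h)
      intro a ha
      simp only [mem_filter, mem_univ, true_and, coe_filter, Set.mem_ofPred_eq] at ha ha₀ ⊢
      intro i
      rw [← hB, det_mul_eq_of_vecMul, Matrix.sub_vecMul, ha, ha₀, sub_self, Matrix.zero_vecMul]
      rfl
  exact_mod_cast key

lemma addOrderOf_zmod_pos {q : ℕ} [NeZero q] (b : ZMod q) : 0 < addOrderOf b :=
  addOrderOf_pos b

/-- For each l ≤ m at most p^l elements have order p^l, so they contribute at most 1. -/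
lemma sum_inv_addOrderOf_le {p : ℕ} [Fact p.Prime] (m : ℕ) :
    ∑ b : ZMod (p ^ m), ((addOrderOf b : ℝ))⁻¹ ≤ m + 1 := by
  have hp : p.Prime := Fact.out
  have hmaps : ∀ b ∈ (univ : Finset (ZMod (p ^ m))), Nat.log p (addOrderOf b) ∈ range (m + 1) := by
    intro b _
    obtain ⟨l, u, hl, -, ho, -⟩ := exists_addOrderOf_relSum 1 m b
    rw [ho, Nat.log_pow hp.one_lt, mem_range]; omega
  rw [← sum_fiberwise_of_maps_to hmaps]
  refine (sum_le_card_nsmul _ _ 1 fun l hl => ?_).trans (by simp)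
  have hpl : (0 : ℝ) < p ^ l := by have := hp.pos; positivity
  have ho : ∀ b : ZMod (p ^ m), Nat.log p (addOrderOf b) = l → addOrderOf b = p ^ l := by
    intro b hb
    obtain ⟨l', u, hl, -, ho, -⟩ := exists_addOrderOf_relSum 1 m b
    rw [ho, Nat.log_pow hp.one_lt] at hb
    rw [ho, hb]
  rw [sum_congr rfl (g := fun _ => ((p : ℝ) ^ l)⁻¹)
    (fun b hb => by rw [ho b (mem_filter.1 hb).2]; push_cast; rfl), sum_const, nsmul_eq_mul,
    ← div_eq_mul_inv, div_le_one hpl]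
  have : #{b : ZMod (p ^ m) | Nat.log p (addOrderOf b) = l} ≤ p ^ l := by
    refine le_trans (card_le_card fun b hb => ?_)
      (card_nsmul_eq_zero_le (q := p ^ m) (pow_pos hp.pos l))
    simp only [mem_filter, mem_univ, true_and] at hb ⊢
    rw [← ho b hb, addOrderOf_nsmul_eq_zero]
  exact_mod_cast this

lemma sum_prod_inv_addOrderOf_le {ι : Type*} [Fintype ι] [DecidableEq ι] {p : ℕ} [Fact p.Prime]
    (m : ℕ) (B : Matrix ι ι (ZMod (p ^ m))) {δ : ℤ} (hδ : δ ≠ 0)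
    (hB : B.det = (δ : ZMod (p ^ m))) :
    ∑ a : ι → ZMod (p ^ m), ∏ i, ((addOrderOf ((a ᵥ* B) i) : ℝ))⁻¹ ≤
      (δ.natAbs : ℝ) ^ Fintype.card ι * ((m : ℝ) + 1) ^ Fintype.card ι := by
  refine (sum_vecMul_le B hδ hB (fun b => ∏ i, ((addOrderOf (b i) : ℝ))⁻¹)
    fun b => prod_nonneg fun i _ => by positivity).trans ?_
  refine mul_le_mul_of_nonneg_left ?_ (by positivity)
  have := prod_univ_sum (fun _ : ι => (univ : Finset (ZMod (p ^ m))))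
    (fun _ b => ((addOrderOf b : ℝ))⁻¹)
  rw [Fintype.piFinset_univ] at this
  rw [← this, prod_const, card_univ]
  exact pow_le_pow_left₀ (sum_nonneg fun b _ => by positivity) (sum_inv_addOrderOf_le m) _

lemma relSum_le_rpow {p : ℕ} [Fact p.Prime] {d : ℕ} (hd : 2 ≤ d) (m : ℕ) (b : ZMod (p ^ m)) :
    relSum d (p ^ m) b ≤ d ^ 3 * (addOrderOf b : ℝ) ^ (-(1 / d : ℝ)) := by
  have hp : p.Prime := Fact.out
  obtain ⟨l, u, hl, hu, ho, hr⟩ := exists_addOrderOf_relSum d m b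
  rw [hr, ho]
  refine (norm_S_prime_pow_div_le hd l u hu).trans (le_of_eq ?_)
  have hp0 : (0 : ℝ) ≤ p := by positivity
  push_cast
  rw [← Real.rpow_natCast (p : ℝ) l, ← Real.rpow_mul hp0]
  congr 2; ring

/-- T/d ≥ 1 + 1/d: the exponent 1 pays for the summation over residues, and the surplus 1/d produces
the decay in p^m. -/
lemma relSum_pow_le {p : ℕ} [Fact p.Prime] {d T : ℕ} (hd : 2 ≤ d) (hT : d + 1 ≤ T) (m : ℕ)
    (b : ZMod (p ^ m)) : relSum d (p ^ m) b ^ T ≤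
      ((d : ℝ) ^ 3) ^ T * ((addOrderOf b : ℝ)⁻¹ * (addOrderOf b : ℝ) ^ (-(1 / d : ℝ))) := by
  have ho : (1 : ℝ) ≤ addOrderOf b := by exact_mod_cast addOrderOf_zmod_pos b
  have ho0 : (0 : ℝ) < addOrderOf b := by linarith
  refine (pow_le_pow_left₀ (relSum_nonneg _ _ _) (relSum_le_rpow hd m b) T).trans ?_
  rw [mul_pow]
  refine mul_le_mul_of_nonneg_left ?_ (by positivity)
  rw [← Real.rpow_neg_one, ← Real.rpow_add ho0, ← Real.rpow_natCast, ← Real.rpow_mul ho0.le]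
  apply Real.rpow_le_rpow_of_exponent_le ho
  have hd0 : (0 : ℝ) < d := by positivity
  have hT' : (d : ℝ) + 1 ≤ T := by exact_mod_cast hT
  have : ((d : ℝ) + 1) / d ≤ T / d := by gcongr
  rw [add_div, div_self hd0.ne'] at this
  have h2 : -(1 / (d : ℝ)) * T = -(T / d) := by ring
  rw [h2]; linarith

/-- For order p the square-root bound gives exponent T/2 ≥ 3/2; for order p^l with 2 ≤ l ≤ d the
bound 1/p gives exponent T ≥ l + 1. Either way at least 1/2 is left beyond the order itself. -/
lemma relSum_pow_le_of_ne_zero {p : ℕ} [Fact p.Prime] {d T m : ℕ} (hd : 2 ≤ d) (hT : d + 1 ≤ T)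
    (hpd : ¬ p ∣ d) (hm : m ≤ d) {b : ZMod (p ^ m)} (hb : b ≠ 0) :
    relSum d (p ^ m) b ^ T ≤
      (2 * (d : ℝ)) ^ T * ((addOrderOf b : ℝ)⁻¹ * (p : ℝ) ^ (-(1 / 2 : ℝ))) := by
  have hp : p.Prime := Fact.out
  have hp0 : (0 : ℝ) < p := by exact_mod_cast hp.pos
  have hp1 : (1 : ℝ) ≤ p := by exact_mod_cast hp.one_le
  have hd1 : (1 : ℝ) ≤ 2 * d := by
    have : (2 : ℝ) ≤ d := by exact_mod_cast hd
    linarith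
  obtain ⟨l, u, hl, hu, ho, hr⟩ := exists_addOrderOf_relSum d m b
  have hl0 : l ≠ 0 := by
    rintro rfl
    rw [pow_zero, AddMonoid.addOrderOf_eq_one_iff] at ho
    exact hb ho
  have hpow : ((addOrderOf b : ℕ) : ℝ)⁻¹ * (p : ℝ) ^ (-(1 / 2 : ℝ)) =
      (p : ℝ) ^ (-((l : ℝ) + 1 / 2)) := by
    rw [ho]; push_cast
    rw [← Real.rpow_natCast, ← Real.rpow_neg hp0.le, ← Real.rpow_add hp0]; congr 1; ring
  rw [hpow, hr]
  rcases Nat.lt_or_ge l 2 with h2 | h2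
  · obtain rfl : l = 1 := by omega
    simp only [pow_one]
    refine (pow_le_pow_left₀ (by positivity) (norm_S_prime_div_le (by omega) hu) T).trans ?_
    rw [mul_pow]
    refine mul_le_mul_of_nonneg_left ?_ (by positivity)
    rw [← Real.rpow_natCast, ← Real.rpow_mul hp0.le]
    apply Real.rpow_le_rpow_of_exponent_le hp1
    have : (3 : ℝ) ≤ T := by exact_mod_cast (by omega : 3 ≤ T)
    push_cast; linarith
  · refine (pow_le_pow_left₀ (by positivity)
      (norm_S_prime_pow_div_le_inv hd hpd h2 (hl.trans hm) hu) T).trans ?_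
    refine le_trans ?_ (le_mul_of_one_le_left (by positivity) (one_le_pow₀ hd1))
    rw [inv_pow, ← Real.rpow_natCast, ← Real.rpow_neg hp0.le]
    apply Real.rpow_le_rpow_of_exponent_le hp1
    have : (l : ℝ) + 1 ≤ T := by exact_mod_cast (by omega : l + 1 ≤ T)
    linarith

lemma addOrderOf_of_isUnit {q : ℕ} {b : ZMod q} (hb : IsUnit b) : addOrderOf b = q := by
  refine Nat.dvd_antisymm ?_ ?_
  · rw [addOrderOf_dvd_iff_nsmul_eq_zero]; simp
  · have h := addOrderOf_nsmul_eq_zero b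
    rw [nsmul_eq_mul] at h
    exact (ZMod.natCast_eq_zero_iff _ _).1 ((hb.mul_left_eq_zero).1 h)

lemma relSum_le_of_isUnit {p : ℕ} [Fact p.Prime] {d m : ℕ} (hd : 2 ≤ d)
    (hpd : ¬ p ∣ d) (hm : m ≤ d) {b : ZMod (p ^ m)} (hb : IsUnit b) :
    (m = 1 → relSum d (p ^ m) b ≤ 2 * d * (p : ℝ) ^ (-(1 / 2 : ℝ))) ∧
      (2 ≤ m → relSum d (p ^ m) b ≤ (p : ℝ)⁻¹) := by
  have hp : p.Prime := Fact.out
  obtain ⟨l, u, hl, hu, ho, hr⟩ := exists_addOrderOf_relSum d m b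
  rw [addOrderOf_of_isUnit hb] at ho
  obtain rfl := Nat.pow_right_injective hp.two_le ho
  rw [hr]
  refine ⟨?_, fun h2 => norm_S_prime_pow_div_le_inv hd hpd h2 hm hu⟩
  rintro rfl
  simpa using norm_S_prime_div_le (p := p) (d := d) (by omega) hu

/-- Cells outside the blocks are dropped since their factors are at most 1. The product of the block
products is at most the T-th power of the largest, hence at most the sum of all T-th powers. -/
lemma prod_le_sum_pow {κ ι τ : Type*} [Fintype κ] [Fintype ι] [Fintype τ] [Nonempty τ]
    (j : τ → ι → κ) (hj : Function.Injective fun x : τ × ι => j x.1 x.2) (f : κ → ℝ)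
    (h0 : ∀ c, 0 ≤ f c) (h1 : ∀ c, f c ≤ 1) :
    ∏ c, f c ≤ ∑ t, ∏ i, f (j t i) ^ Fintype.card τ := by
  classical
  have hle : ∏ c, f c ≤ ∏ t, ∏ i, f (j t i) := by
    rw [← univ.prod_mul_prod_compl, ← Fintype.prod_prod_type' (fun t i => f (j t i)),
      ← prod_image (s := univ) (g := fun x : τ × ι => j x.1 x.2) (f := f) (fun x _ y _ h => hj h)]
    rw [← prod_mul_prod_compl (univ.image fun x : τ × ι => j x.1 x.2) f]
    simp only [compl_univ, prod_empty, mul_one]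
    exact mul_le_of_le_one_right (prod_nonneg fun _ _ => h0 _)
      (prod_le_one (fun _ _ => h0 _) fun _ _ => h1 _)
  have hn : ∀ t, 0 ≤ ∏ i, f (j t i) := fun t => prod_nonneg fun _ _ => h0 _
  obtain ⟨t₀, -, ht₀⟩ := exists_max_image univ (fun t => ∏ i, f (j t i)) univ_nonempty
  refine hle.trans ((prod_le_prod (fun t _ => hn t) fun t ht => ht₀ t ht).trans ?_)
  rw [prod_const, card_univ, ← prod_pow]
  exact single_le_sum (f := fun t => ∏ i, f (j t i) ^ Fintype.card τ)
    (fun t _ => prod_nonneg fun _ _ => pow_nonneg (h0 _) _) (mem_univ t₀)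

/-- The singular series terms at prime powers are sums over vectors with a unit entry. -/
lemma norm_A_prime_pow_le {p : ℕ} [Fact p.Prime] (n d μ : ℕ) {m : ℕ} (hm : m ≠ 0) :
    ‖A n d μ (p ^ m)‖ ≤ ∑ a : Eqn n → ZMod (p ^ m) with ∃ r, IsUnit (a r),
      ∏ c, relSum d (p ^ m) ((a ᵥ* magicMatrix (ZMod (p ^ m)) n) c) := by
  have hp : p.Prime := Fact.out
  set q := p ^ m with hq
  have : NeZero q := ⟨pow_ne_zero _ hp.ne_zero⟩
  set F : (Eqn n → ZMod q) → ℝ := fun a =>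
    ∏ c, relSum d q ((a ᵥ* magicMatrix (ZMod q) n) c) with hF
  have hF0 : ∀ a, 0 ≤ F a := fun a => prod_nonneg fun _ _ => relSum_nonneg _ _ _
  have hterm : ∀ a : Eqn n → ℕ, ‖((q : ℂ) ^ (n ^ 2))⁻¹ * sumTerm n d μ q a‖ =
      F fun r => (a r : ZMod q) := by
    intro a
    rw [sumTerm_eq, norm_mul, norm_mul, norm_prod, AddChar.norm_apply, mul_one, hF]
    simp only [relSum]
    rw [prod_div_distrib, prod_const, card_univ, Fintype.card_prod, Fintype.card_fin, ← sq,
      div_eq_inv_mul]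
    simp
  have hunit : ∀ a ∈ primitiveVectors n q, ∃ r, IsUnit ((a r : ℕ) : ZMod q) := by
    intro a ha
    by_contra! hno
    have hdvd : ∀ r ∈ univ, p ∣ a r := by
      intro r _
      by_contra hpa
      refine hno r ((ZMod.isUnit_iff_coprime _ _).2 ?_)
      exact Nat.Coprime.pow_right _ ((Nat.Prime.coprime_iff_not_dvd hp).2 hpa).symm
    have h1 : p ∣ Nat.gcd q (univ.gcd a) := Nat.dvd_gcd (dvd_pow_self p hm) (dvd_gcd hdvd)
    rw [(mem_filter.1 ha).2] at h1
    exact hp.one_lt.ne' (Nat.dvd_one.1 h1)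
  rw [A_eq, mul_sum]
  refine (norm_sum_le _ _).trans ?_
  refine (sum_congr rfl fun a _ => hterm a).le.trans ?_
  have hsub : primitiveVectors n q ⊆ (Fintype.piFinset fun _ : Eqn n => Icc 1 q) :=
    filter_subset _ _
  rw [sum_filter, ← sum_piFinset_Icc_eq]
  refine le_trans ?_ (sum_le_sum_of_subset_of_nonneg hsub fun a _ _ => ?_)
  · refine sum_le_sum fun a ha => ?_
    rw [if_pos (hunit a ha)]
  · split_ifs
    · exact hF0 _
    · exact le_rfl

end MagicSquare

/-! ### Uniform bounds for the terms A(p^m) -/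

namespace MagicSquare
open Finset

/-- The minor of the coefficient matrix on the columns of the given cells. -/
def cellsDet (n : ℕ) (i : Eqn n → Fin n × Fin n) : ℤ :=
  ((magicMatrix ℤ n).submatrix id i).det

lemma det_submatrix_eq (R : Type*) [CommRing R] (n : ℕ) (i : Eqn n → Fin n × Fin n) :
    ((magicMatrix R n).submatrix id i).det = (cellsDet n i : R) := by
  have h := (Int.castRingHom R).map_det ((magicMatrix ℤ n).submatrix id i)
  rw [cellsDet, ← eq_intCast (Int.castRingHom R), h]
  congr 1
  ext r c
  simp only [Matrix.submatrix_apply, RingHom.mapMatrix_apply, Matrix.map_apply, map_magicMatrix]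

/-- Orders are powers of p, so the largest order o among the coordinates of aB kills them all. By
the adjugate o δ kills every entry of a, and a unit entry forces p^m ∣ o δ. -/
lemma exists_le_mul_addOrderOf {ι : Type*} [Fintype ι] [DecidableEq ι] {p m : ℕ} [Fact p.Prime]
    (B : Matrix ι ι (ZMod (p ^ m))) {δ : ℤ} (hδ : δ ≠ 0)
    (hB : B.det = (δ : ZMod (p ^ m))) (a : ι → ZMod (p ^ m)) (ha : ∃ r, IsUnit (a r)) :
    ∃ r, p ^ m ≤ δ.natAbs * addOrderOf ((a ᵥ* B) r) := by
  obtain ⟨r₁, hr₁⟩ := ha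
  obtain ⟨r₀, -, hmax⟩ := exists_max_image univ (fun r => addOrderOf ((a ᵥ* B) r)) ⟨r₁, mem_univ _⟩
  refine ⟨r₀, ?_⟩
  set o := addOrderOf ((a ᵥ* B) r₀) with ho
  have ho0 : 0 < o := addOrderOf_zmod_pos _
  have hz : ∀ r, (o : ZMod (p ^ m)) * (a ᵥ* B) r = 0 := by
    intro r
    obtain ⟨l, u, -, -, h1, -⟩ := exists_addOrderOf_relSum 1 m ((a ᵥ* B) r)
    obtain ⟨l', u', -, -, h2, -⟩ := exists_addOrderOf_relSum 1 m ((a ᵥ* B) r₀)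
    have h3 := hmax r (mem_univ r)
    have hdvd : addOrderOf ((a ᵥ* B) r) ∣ o := by
      rw [ho, h1, h2]
      rw [h1, ho, h2] at h3
      exact pow_dvd_pow p ((Nat.pow_le_pow_iff_right (Fact.out : p.Prime).one_lt).1 h3)
    rw [← nsmul_eq_mul]
    exact addOrderOf_dvd_iff_nsmul_eq_zero.1 hdvd
  have h4 : (o : ZMod (p ^ m)) * ((δ : ZMod (p ^ m)) * a r₁) = 0 := by
    rw [← hB, det_mul_eq_of_vecMul, Matrix.vecMul, dotProduct, mul_sum]
    refine sum_eq_zero fun r _ => ?_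
    rw [← mul_assoc, hz, zero_mul]
  rw [← mul_assoc] at h4
  have h5 := (hr₁.mul_left_eq_zero).1 h4
  have h6 : (((o : ℤ) * δ : ℤ) : ZMod (p ^ m)) = 0 := by push_cast; exact h5
  rw [ZMod.intCast_zmod_eq_zero_iff_dvd, Int.natCast_dvd, Int.natAbs_mul, Int.natAbs_natCast,
    mul_comm] at h6
  exact Nat.le_of_dvd (Nat.mul_pos (Int.natAbs_pos.2 hδ) ho0) h6

variable {n d T : ℕ}

/-- A bound for the singular series at all prime powers, uniform in `μ`. -/
theorem exists_norm_A_prime_pow_le [NeZero T] (hd : 2 ≤ d) (hT : d + 1 ≤ T)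
    (j : Fin T → Eqn n → Fin n × Fin n)
    (hj : Function.Injective fun x : Fin T × Eqn n => j x.1 x.2)
    (hdet : ∀ t, cellsDet n (j t) ≠ 0) :
    ∃ C : ℝ, 0 ≤ C ∧ ∀ p : ℕ, p.Prime → ∀ m μ : ℕ, m ≠ 0 →
      ‖A n d μ (p ^ m)‖ ≤ C * ((m : ℝ) + 1) ^ Fintype.card (Eqn n) * (p : ℝ) ^ (-((m : ℝ) / d)) := by
  set k := Fintype.card (Eqn n) with hk
  refine ⟨∑ t, (((d : ℝ) ^ 3) ^ T) ^ k * (cellsDet n (j t)).natAbs *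
    ((cellsDet n (j t)).natAbs : ℝ) ^ k, sum_nonneg fun t _ => by positivity, ?_⟩
  intro p hp m μ hm
  have : Fact p.Prime := ⟨hp⟩
  have hp0 : (0 : ℝ) < p := by exact_mod_cast hp.pos
  have hd0 : (0 : ℝ) < d := by positivity
  refine (norm_A_prime_pow_le n d μ hm).trans ?_
  have hpt : ∀ t, ∀ a : Eqn n → ZMod (p ^ m), (∃ r, IsUnit (a r)) →
      ∏ r, relSum d (p ^ m) ((a ᵥ* magicMatrix (ZMod (p ^ m)) n) (j t r)) ^ T ≤
      (((d : ℝ) ^ 3) ^ T) ^ k * (cellsDet n (j t)).natAbs * (p : ℝ) ^ (-((m : ℝ) / d)) *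
      ∏ r, ((addOrderOf ((a ᵥ* (magicMatrix (ZMod (p ^ m)) n).submatrix id (j t)) r) : ℝ))⁻¹ := by
    intro t a ha
    set b := a ᵥ* (magicMatrix (ZMod (p ^ m)) n).submatrix id (j t) with hb
    have hbr : ∀ r, (a ᵥ* magicMatrix (ZMod (p ^ m)) n) (j t r) = b r := fun r => rfl
    simp_rw [hbr]
    have ho : ∀ r, (1 : ℝ) ≤ addOrderOf (b r) := fun r => by
      exact_mod_cast addOrderOf_zmod_pos (b r)
    obtain ⟨r₀, hr₀⟩ := exists_le_mul_addOrderOf _ (hdet t) (det_submatrix_eq _ n (j t)) a ha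
    -- The surplus exponent 1/d is used at one coordinate only, the one of order at least p^m / |δ|.
    have hprod : ∏ r, (addOrderOf (b r) : ℝ) ^ (-(1 / d : ℝ)) ≤
        (cellsDet n (j t)).natAbs * (p : ℝ) ^ (-((m : ℝ) / d)) := by
      have h1 : ∏ r, (addOrderOf (b r) : ℝ) ^ (-(1 / d : ℝ)) ≤
          (addOrderOf (b r₀) : ℝ) ^ (-(1 / d : ℝ)) := by
        rw [← mul_prod_erase univ _ (mem_univ r₀)]
        refine mul_le_of_le_one_right (by positivity) (prod_le_one (fun _ _ => by positivity) ?_)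
        intro r _
        apply Real.rpow_le_one_of_one_le_of_nonpos (ho r)
        simp
      refine h1.trans ?_
      set δ : ℝ := ((cellsDet n (j t)).natAbs : ℝ) with hδ
      have hδ1 : 1 ≤ δ := by
        rw [hδ]; exact_mod_cast Int.natAbs_pos.2 (hdet t)
      have h2 : (p : ℝ) ^ m ≤ δ * addOrderOf (b r₀) := by
        rw [hδ]; exact_mod_cast hr₀
      have h3 : (p : ℝ) ^ (-((m : ℝ) / d)) = ((p : ℝ) ^ m) ^ (-(1 / d : ℝ)) := by
        rw [← Real.rpow_natCast, ← Real.rpow_mul hp0.le]; congr 1; ring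
      have h4 : (δ * addOrderOf (b r₀)) ^ (-(1 / d : ℝ)) ≤ ((p : ℝ) ^ m) ^ (-(1 / d : ℝ)) :=
        Real.rpow_le_rpow_of_nonpos (by positivity) h2 (by simp)
      rw [Real.mul_rpow (by linarith) (by positivity)] at h4
      have h5 : δ⁻¹ ≤ δ ^ (-(1 / d : ℝ)) := by
        rw [← Real.rpow_neg_one]
        apply Real.rpow_le_rpow_of_exponent_le hδ1
        have : (1 : ℝ) / d ≤ 1 := by
          rw [div_le_one hd0]; exact_mod_cast (by omega : 1 ≤ d)
        linarith
      rw [h3]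
      have h6 : (0 : ℝ) ≤ (addOrderOf (b r₀) : ℝ) ^ (-(1 / d : ℝ)) := by positivity
      calc (addOrderOf (b r₀) : ℝ) ^ (-(1 / d : ℝ))
          = δ * (δ⁻¹ * (addOrderOf (b r₀) : ℝ) ^ (-(1 / d : ℝ))) := by
            rw [mul_inv_cancel_left₀ (by linarith)]
        _ ≤ δ * (δ ^ (-(1 / d : ℝ)) * (addOrderOf (b r₀) : ℝ) ^ (-(1 / d : ℝ))) := by gcongr
        _ ≤ _ := by gcongr
    calc ∏ r, relSum d (p ^ m) (b r) ^ T
        ≤ ∏ r, (((d : ℝ) ^ 3) ^ T * ((addOrderOf (b r) : ℝ)⁻¹ *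
            (addOrderOf (b r) : ℝ) ^ (-(1 / d : ℝ)))) :=
          prod_le_prod (fun _ _ => pow_nonneg (relSum_nonneg _ _ _) _)
            fun r _ => relSum_pow_le hd hT m (b r)
      _ = (((d : ℝ) ^ 3) ^ T) ^ k * ((∏ r, (addOrderOf (b r) : ℝ) ^ (-(1 / d : ℝ))) *
            ∏ r, (addOrderOf (b r) : ℝ)⁻¹) := by
          rw [prod_mul_distrib, prod_mul_distrib, prod_const, card_univ]; ring
      _ ≤ (((d : ℝ) ^ 3) ^ T) ^ k * (((cellsDet n (j t)).natAbs * (p : ℝ) ^ (-((m : ℝ) / d))) *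
            ∏ r, (addOrderOf (b r) : ℝ)⁻¹) := by
          have : 0 ≤ ∏ r, (addOrderOf (b r) : ℝ)⁻¹ := prod_nonneg fun _ _ => by positivity
          gcongr
      _ = _ := by ring
  calc _ ≤ ∑ a : Eqn n → ZMod (p ^ m) with ∃ r, IsUnit (a r), ∑ t,
        (((d : ℝ) ^ 3) ^ T) ^ k * (cellsDet n (j t)).natAbs * (p : ℝ) ^ (-((m : ℝ) / d)) *
        ∏ r, ((addOrderOf ((a ᵥ* (magicMatrix (ZMod (p ^ m)) n).submatrix id (j t)) r) : ℝ))⁻¹ := by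
        refine sum_le_sum fun a ha => ?_
        refine (prod_le_sum_pow j hj _ (fun _ => relSum_nonneg _ _ _)
          fun _ => relSum_le_one _ _ _).trans (sum_le_sum fun t _ => ?_)
        rw [Fintype.card_fin]
        exact hpt t a (mem_filter.1 ha).2
    _ ≤ ∑ a : Eqn n → ZMod (p ^ m), ∑ t,
        (((d : ℝ) ^ 3) ^ T) ^ k * (cellsDet n (j t)).natAbs * (p : ℝ) ^ (-((m : ℝ) / d)) *
        ∏ r, ((addOrderOf ((a ᵥ* (magicMatrix (ZMod (p ^ m)) n).submatrix id (j t)) r) : ℝ))⁻¹ :=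
        sum_le_sum_of_subset_of_nonneg (subset_univ _) fun a _ _ => sum_nonneg fun t _ =>
          mul_nonneg (by positivity) (prod_nonneg fun _ _ => by positivity)
    _ ≤ ∑ t, (((d : ℝ) ^ 3) ^ T) ^ k * (cellsDet n (j t)).natAbs * (p : ℝ) ^ (-((m : ℝ) / d)) *
        (((cellsDet n (j t)).natAbs : ℝ) ^ k * ((m : ℝ) + 1) ^ k) := by
        rw [sum_comm]
        refine sum_le_sum fun t _ => ?_
        rw [← mul_sum]
        refine mul_le_mul_of_nonneg_left ?_ (by positivity)
        exact sum_prod_inv_addOrderOf_le m _ (hdet t) (det_submatrix_eq _ n (j t))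
    _ = _ := by
        rw [sum_mul, sum_mul]
        exact sum_congr rfl fun t _ => by ring

/-- Two positions and two values determine such a vector. These are the exceptional vectors in the
sharper bound for m ≤ d. -/
lemma card_le_two_support_le {ι R : Type*} [Fintype ι] [DecidableEq ι] [Nonempty ι] [Fintype R]
    [DecidableEq R] [Zero R] :
    #{b : ι → R | #{r | b r ≠ 0} ≤ 2} ≤ Fintype.card ι ^ 2 * Fintype.card R ^ 2 := by
  have h : ({b : ι → R | #{r | b r ≠ 0} ≤ 2} : Finset _) ⊆
      (univ : Finset ((ι × ι) × (R × R))).image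
        (fun x r => if r = x.1.1 then x.2.1 else if r = x.1.2 then x.2.2 else 0) := by
    intro b hb
    simp only [mem_filter, mem_univ, true_and] at hb
    obtain ⟨r₁, r₂, h12⟩ : ∃ r₁ r₂, ∀ r, b r ≠ 0 → r = r₁ ∨ r = r₂ := by
      obtain ⟨i₀⟩ := ‹Nonempty ι›
      by_contra! hno
      obtain ⟨x, hx, -, -⟩ := hno i₀ i₀
      obtain ⟨y, hy, hyx, -⟩ := hno x x
      obtain ⟨z, hz, hzx, hzy⟩ := hno x y
      have : #{x, y, z} ≤ #{r | b r ≠ 0} := card_le_card fun w hw => by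
        simp only [mem_insert, mem_singleton] at hw
        rcases hw with rfl | rfl | rfl <;> simpa
      rw [card_eq_three.2 ⟨x, y, z, hyx.symm, hzx.symm, hzy.symm, rfl⟩] at this
      omega
    refine mem_image.2 ⟨((r₁, r₂), (b r₁, b r₂)), mem_univ _, ?_⟩
    funext r
    by_cases h1 : r = r₁
    · simp [h1]
    · by_cases h2 : r = r₂
      · subst h2; simp only [if_neg h1, if_true]
      · simp only [h1, if_false, h2]
        by_contra h3
        rcases h12 r (Ne.symm h3) with h4 | h4
        · exact h1 h4
        · exact h2 h4
  refine (card_le_card h).trans (card_image_le.trans ?_)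
  simp [sq]

lemma isUnit_iff_cast_ne_zero {p : ℕ} [Fact p.Prime] {m : ℕ} (hm : m ≠ 0) (b : ZMod (p ^ m)) :
    IsUnit b ↔ ZMod.castHom (dvd_pow_self p hm) (ZMod p) b ≠ 0 := by
  have hp : p.Prime := Fact.out
  have h1 : b = ((b.val : ℕ) : ZMod (p ^ m)) := by simp
  rw [h1, map_natCast, Ne, ZMod.natCast_eq_zero_iff, ZMod.isUnit_iff_coprime,
    Nat.coprime_pow_right_iff (Nat.pos_of_ne_zero hm), Nat.coprime_comm,
    Nat.Prime.coprime_iff_not_dvd hp]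

/-- Units modulo p^m are the residues that are nonzero modulo p. There a is nonzero and the minor is
invertible, so the combination does not vanish and the weight bound over Z/p applies. -/
lemma card_isUnit_vecMul_ge {p : ℕ} [Fact p.Prime] {m : ℕ} (hm : m ≠ 0) (hn : 7 ≤ n)
    (i : Eqn n → Fin n × Fin n) (hi : ¬ (p : ℤ) ∣ cellsDet n i) (a : Eqn n → ZMod (p ^ m))
    (ha : ∃ r, IsUnit (a r)) :
    n ≤ #{c : Fin n × Fin n | IsUnit ((a ᵥ* magicMatrix (ZMod (p ^ m)) n) c)} := by
  set φ := ZMod.castHom (dvd_pow_self p hm) (ZMod p) with hφ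
  have hmap : ∀ c, φ ((a ᵥ* magicMatrix (ZMod (p ^ m)) n) c) =
      ((fun r => φ (a r)) ᵥ* magicMatrix (ZMod p) n) c := by
    intro c
    simp only [Matrix.vecMul, dotProduct, map_sum, map_mul, map_magicMatrix]
  simp_rw [isUnit_iff_cast_ne_zero hm, ← hφ, hmap]
  refine card_vecMul_magicMatrix_ge hn _ fun h0 => ?_
  obtain ⟨r, hr⟩ := ha
  rw [isUnit_iff_cast_ne_zero hm] at hr
  have h1 := det_mul_eq_of_vecMul ((magicMatrix (ZMod p) n).submatrix id i) (fun r => φ (a r)) r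
  have h2 : (fun r => φ (a r)) ᵥ* (magicMatrix (ZMod p) n).submatrix id i = 0 := by
    funext s
    exact congrFun h0 (i s)
  rw [h2, Matrix.zero_vecMul, det_submatrix_eq] at h1
  rcases mul_eq_zero.1 h1 with h3 | h3
  · exact hi ((ZMod.intCast_zmod_eq_zero_iff_dvd _ _).1 h3)
  · exact hr h3

/-- The factor p^(2m) matches the number of exceptional vectors. It is beaten by the n cells with
unit argument: 2 - n/2 ≤ -3/2 if m = 1, as n ≥ 7, and 2m - n ≤ -3 if 2 ≤ m ≤ d, as n ≥ 2d + 3. -/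
lemma prod_relSum_le {p : ℕ} [Fact p.Prime] {m : ℕ} (hd : 2 ≤ d) (hpd : ¬ p ∣ d) (hm : m ≠ 0)
    (hmd : m ≤ d) (hn : 2 * d + 3 ≤ n) (i : Eqn n → Fin n × Fin n)
    (hi : ¬ (p : ℤ) ∣ cellsDet n i) (a : Eqn n → ZMod (p ^ m)) (ha : ∃ r, IsUnit (a r)) :
    ((p : ℝ) ^ m) ^ 2 * ∏ c, relSum d (p ^ m) ((a ᵥ* magicMatrix (ZMod (p ^ m)) n) c) ≤
      (2 * (d : ℝ)) ^ n * (p : ℝ) ^ (-(3 / 2 : ℝ)) := by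
  have hp : p.Prime := Fact.out
  have hp0 : (0 : ℝ) < p := by exact_mod_cast hp.pos
  have hp1 : (1 : ℝ) ≤ p := by exact_mod_cast hp.one_le
  have hd1 : (1 : ℝ) ≤ 2 * d := by
    have : (2 : ℝ) ≤ d := by exact_mod_cast hd
    linarith
  set f := fun c => relSum d (p ^ m) ((a ᵥ* magicMatrix (ZMod (p ^ m)) n) c) with hf
  have hf0 : ∀ c, 0 ≤ f c := fun _ => relSum_nonneg _ _ _
  have hf1 : ∀ c, f c ≤ 1 := fun _ => relSum_le_one _ _ _
  obtain ⟨s, hs, hsn⟩ := exists_subset_card_eq (card_isUnit_vecMul_ge hm (by omega) i hi a ha)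
  have hprod : ∀ B : ℝ, (∀ c ∈ s, f c ≤ B) → ∏ c, f c ≤ B ^ n := by
    intro B hB
    have hBn : B ^ n = ∏ _c ∈ s, B := by rw [prod_const, hsn]
    rw [← prod_mul_prod_compl s f, hBn]
    exact (mul_le_of_le_one_right (prod_nonneg fun _ _ => hf0 _)
      (prod_le_one (fun _ _ => hf0 _) fun _ _ => hf1 _)).trans
      (prod_le_prod (fun _ _ => hf0 _) hB)
  have hun := fun c (hc : c ∈ s) => relSum_le_of_isUnit hd hpd hmd (mem_filter.1 (hs hc)).2
  have hnR : (2 : ℝ) * d + 3 ≤ n := by exact_mod_cast hn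
  have hdR : (2 : ℝ) ≤ d := by exact_mod_cast hd
  rcases Nat.lt_or_ge m 2 with h2 | h2
  · obtain rfl : m = 1 := by omega
    have h3 := hprod _ fun c hc => (hun c hc).1 rfl
    calc _ ≤ ((p : ℝ) ^ 1) ^ 2 * (2 * d * (p : ℝ) ^ (-(1 / 2 : ℝ))) ^ n := by gcongr
      _ = (2 * d) ^ n * (p : ℝ) ^ ((2 : ℝ) - n / 2) := by
        rw [mul_pow, pow_one, ← Real.rpow_natCast ((p : ℝ) ^ (-(1 / 2 : ℝ))),
          ← Real.rpow_mul hp0.le, ← Real.rpow_natCast (p : ℝ) 2, mul_left_comm,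
          ← Real.rpow_add hp0]
        congr 2; push_cast; ring
      _ ≤ _ := by
        refine mul_le_mul_of_nonneg_left ?_ (by positivity)
        exact Real.rpow_le_rpow_of_exponent_le hp1 (by linarith)
  · have h3 := hprod _ fun c hc => (hun c hc).2 h2
    calc _ ≤ ((p : ℝ) ^ m) ^ 2 * ((p : ℝ)⁻¹) ^ n := by gcongr
      _ = (p : ℝ) ^ ((2 : ℝ) * m - n) := by
        rw [← pow_mul, inv_pow, ← Real.rpow_natCast, ← Real.rpow_natCast, ← Real.rpow_neg hp0.le,
          ← Real.rpow_add hp0]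
        congr 1; push_cast; ring
      _ ≤ (p : ℝ) ^ (-(3 / 2 : ℝ)) := by
        apply Real.rpow_le_rpow_of_exponent_le hp1
        have : (m : ℝ) ≤ d := by exact_mod_cast hmd
        linarith
      _ ≤ _ := le_mul_of_one_le_left (by positivity) (one_le_pow₀ hd1)

/-- A sharper bound for small powers of large primes. -/
theorem exists_norm_A_prime_pow_le_of_le [NeZero T] (hd : 2 ≤ d) (hT : d + 1 ≤ T)
    (hn : 2 * d + 3 ≤ n) (j : Fin T → Eqn n → Fin n × Fin n)
    (hj : Function.Injective fun x : Fin T × Eqn n => j x.1 x.2)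
    (hdet : ∀ t, cellsDet n (j t) ≠ 0) :
    ∃ C : ℝ, 0 ≤ C ∧ ∀ p : ℕ, p.Prime → ¬ p ∣ d → (∀ t, ¬ (p : ℤ) ∣ cellsDet n (j t)) →
      ∀ m μ : ℕ, m ≠ 0 → m ≤ d → ‖A n d μ (p ^ m)‖ ≤ C * (p : ℝ) ^ (-(3 / 2 : ℝ)) := by
  set k := Fintype.card (Eqn n) with hk
  set C₁ : ℝ := ∑ t, ((cellsDet n (j t)).natAbs : ℝ) ^ k * (k : ℝ) ^ 2 * (2 * (d : ℝ)) ^ n with hC₁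
  set C₂ : ℝ := ∑ t, ((2 * (d : ℝ)) ^ T) ^ k * (((cellsDet n (j t)).natAbs : ℝ) ^ k *
    ((d : ℝ) + 1) ^ k) with hC₂
  refine ⟨C₁ + C₂, add_nonneg (sum_nonneg fun t _ => by positivity)
    (sum_nonneg fun t _ => by positivity), ?_⟩
  intro p hp hpd hpdet m μ hm hmd
  have : Fact p.Prime := ⟨hp⟩
  have hp0 : (0 : ℝ) < p := by exact_mod_cast hp.pos
  have hp1 : (1 : ℝ) ≤ p := by exact_mod_cast hp.one_le
  have hd1 : (1 : ℝ) ≤ 2 * d := by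
    have : (2 : ℝ) ≤ d := by exact_mod_cast hd
    linarith
  have hne : Nonempty (Eqn n) := ⟨Sum.inr (Sum.inr 0)⟩
  refine (norm_A_prime_pow_le n d μ hm).trans ?_
  set M := magicMatrix (ZMod (p ^ m)) n with hM
  set F : (Eqn n → ZMod (p ^ m)) → ℝ := fun a => ∏ c, relSum d (p ^ m) ((a ᵥ* M) c) with hF
  have hF0 : ∀ a, 0 ≤ F a := fun a => prod_nonneg fun _ _ => relSum_nonneg _ _ _
  set G₁ : (Eqn n → ZMod (p ^ m)) → ℝ := fun b => if #{r | b r ≠ 0} ≤ 2 then 1 else 0 with hG₁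
  have hG₁0 : ∀ b, 0 ≤ G₁ b := fun b => by rw [hG₁]; dsimp only; split_ifs <;> norm_num
  set G₂ : (Eqn n → ZMod (p ^ m)) → ℝ := fun b => ∏ r, ((addOrderOf (b r) : ℝ))⁻¹ with hG₂
  have hG₂0 : ∀ b, 0 ≤ G₂ b := fun b => prod_nonneg fun _ _ => by positivity
  set P : ℝ := (p : ℝ) ^ (-(3 / 2 : ℝ)) with hP
  have hP0 : 0 < P := by positivity
  set q2 : ℝ := ((p : ℝ) ^ m) ^ 2 with hq2
  have hq20 : 0 < q2 := by positivity
  set U : Fin T → Matrix (Eqn n) (Eqn n) (ZMod (p ^ m)) := fun t => M.submatrix id (j t) with hU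
  have hUr : ∀ a t r, (a ᵥ* M) (j t r) = (a ᵥ* U t) r := fun _ _ _ => rfl
  -- If some block sees at most two nonzero coordinates, a is exceptional and the pointwise bound
  -- `prod_relSum_le` is used. Otherwise every block has three nonzero coordinates, each giving
  -- p^(-1/2), and the inverse orders remain to be summed.
  have hpt : ∀ a : Eqn n → ZMod (p ^ m), (∃ r, IsUnit (a r)) →
      F a ≤ (∑ t, G₁ (a ᵥ* U t) * (q2⁻¹ * ((2 * (d : ℝ)) ^ n * P))) +
        ∑ t, ((2 * (d : ℝ)) ^ T) ^ k * P * G₂ (a ᵥ* U t) := by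
    intro a ha
    by_cases hX : ∃ t, #{r | (a ᵥ* U t) r ≠ 0} ≤ 2
    · obtain ⟨t₀, ht₀⟩ := hX
      have h1 := prod_relSum_le hd hpd hm hmd hn (j t₀) (hpdet t₀) a ha
      have h2 : F a ≤ q2⁻¹ * ((2 * (d : ℝ)) ^ n * P) := by
        rw [← div_eq_inv_mul, le_div_iff₀ hq20, mul_comm]
        exact h1
      have h3 : G₁ (a ᵥ* U t₀) = 1 := if_pos ht₀
      have h4 : G₁ (a ᵥ* U t₀) * (q2⁻¹ * ((2 * (d : ℝ)) ^ n * P)) ≤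
          ∑ t, G₁ (a ᵥ* U t) * (q2⁻¹ * ((2 * (d : ℝ)) ^ n * P)) :=
        single_le_sum (f := fun t => G₁ (a ᵥ* U t) * (q2⁻¹ * ((2 * (d : ℝ)) ^ n * P)))
          (fun t _ => mul_nonneg (hG₁0 _) (by positivity)) (mem_univ t₀)
      rw [h3, one_mul] at h4
      exact (h2.trans h4).trans (le_add_of_nonneg_right
        (sum_nonneg fun t _ => mul_nonneg (by positivity) (hG₂0 _)))
    · push Not at hX
      refine le_trans ?_ (le_add_of_nonneg_left
        (sum_nonneg fun t _ => mul_nonneg (hG₁0 _) (by positivity)))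
      refine (prod_le_sum_pow j hj _ (fun _ => relSum_nonneg _ _ _)
          fun _ => relSum_le_one _ _ _).trans (sum_le_sum fun t _ => ?_)
      rw [Fintype.card_fin]
      simp_rw [hUr]
      set b := a ᵥ* U t with hb
      have h1 : ∀ r, relSum d (p ^ m) (b r) ^ T ≤ (2 * (d : ℝ)) ^ T *
          ((addOrderOf (b r) : ℝ)⁻¹ * if b r ≠ 0 then (p : ℝ) ^ (-(1 / 2 : ℝ)) else 1) := by
        intro r
        split_ifs with h
        · exact relSum_pow_le_of_ne_zero hd hT hpd hmd h
        · push Not at h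
          rw [h, addOrderOf_zero]
          simp only [Nat.cast_one, inv_one, mul_one]
          exact (pow_le_one₀ (relSum_nonneg _ _ _) (relSum_le_one _ _ _)).trans (one_le_pow₀ hd1)
      have h2 : ∏ r, (if b r ≠ 0 then (p : ℝ) ^ (-(1 / 2 : ℝ)) else 1) ≤ P := by
        rw [← prod_filter, prod_const, ← Real.rpow_natCast, ← Real.rpow_mul hp0.le]
        apply Real.rpow_le_rpow_of_exponent_le hp1
        have : (3 : ℝ) ≤ #{r | b r ≠ 0} := by exact_mod_cast hX t
        linarith
      calc ∏ r, relSum d (p ^ m) (b r) ^ T ≤ ∏ r, ((2 * (d : ℝ)) ^ T *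
          ((addOrderOf (b r) : ℝ)⁻¹ * if b r ≠ 0 then (p : ℝ) ^ (-(1 / 2 : ℝ)) else 1)) :=
            prod_le_prod (fun _ _ => pow_nonneg (relSum_nonneg _ _ _) _) fun r _ => h1 r
        _ = ((2 * (d : ℝ)) ^ T) ^ k * ((∏ r, if b r ≠ 0 then (p : ℝ) ^ (-(1 / 2 : ℝ)) else 1) *
            G₂ b) := by
          rw [prod_mul_distrib, prod_mul_distrib, prod_const, card_univ, hG₂]; ring
        _ ≤ ((2 * (d : ℝ)) ^ T) ^ k * (P * G₂ b) := by
          have := hG₂0 b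
          gcongr
        _ = _ := by ring
  have hS₁ : ∀ t, ∑ a, G₁ (a ᵥ* U t) ≤ ((cellsDet n (j t)).natAbs : ℝ) ^ k * ((k : ℝ) ^ 2 * q2) := by
    intro t
    refine (sum_vecMul_le (U t) (hdet t) (det_submatrix_eq _ n (j t)) G₁ hG₁0).trans ?_
    refine mul_le_mul_of_nonneg_left ?_ (by positivity)
    rw [hG₁, ← sum_filter, sum_const, nsmul_eq_mul, mul_one, hq2]
    have := card_le_two_support_le (ι := Eqn n) (R := ZMod (p ^ m))
    rw [ZMod.card] at this
    exact_mod_cast this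
  have hS₂ : ∀ t, ∑ a, G₂ (a ᵥ* U t) ≤ ((cellsDet n (j t)).natAbs : ℝ) ^ k * ((d : ℝ) + 1) ^ k := by
    intro t
    refine (sum_prod_inv_addOrderOf_le m _ (hdet t) (det_submatrix_eq _ n (j t))).trans ?_
    have : (m : ℝ) ≤ d := by exact_mod_cast hmd
    gcongr
  calc ∑ a : Eqn n → ZMod (p ^ m) with ∃ r, IsUnit (a r), F a
      ≤ ∑ a : Eqn n → ZMod (p ^ m) with ∃ r, IsUnit (a r),
        ((∑ t, G₁ (a ᵥ* U t) * (q2⁻¹ * ((2 * (d : ℝ)) ^ n * P))) +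
        ∑ t, ((2 * (d : ℝ)) ^ T) ^ k * P * G₂ (a ᵥ* U t)) :=
        sum_le_sum fun a ha => hpt a (mem_filter.1 ha).2
    _ ≤ ∑ a : Eqn n → ZMod (p ^ m), ((∑ t, G₁ (a ᵥ* U t) * (q2⁻¹ * ((2 * (d : ℝ)) ^ n * P))) +
        ∑ t, ((2 * (d : ℝ)) ^ T) ^ k * P * G₂ (a ᵥ* U t)) :=
        sum_le_sum_of_subset_of_nonneg (subset_univ _) fun a _ _ => add_nonneg
          (sum_nonneg fun t _ => mul_nonneg (hG₁0 _) (by positivity))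
          (sum_nonneg fun t _ => mul_nonneg (by positivity) (hG₂0 _))
    _ = (∑ t, (∑ a, G₁ (a ᵥ* U t)) * (q2⁻¹ * ((2 * (d : ℝ)) ^ n * P))) +
        ∑ t, ((2 * (d : ℝ)) ^ T) ^ k * P * ∑ a, G₂ (a ᵥ* U t) := by
        rw [sum_add_distrib, sum_comm]
        congr 1
        · exact sum_congr rfl fun t _ => by rw [sum_mul]
        · rw [sum_comm]
          exact sum_congr rfl fun t _ => by rw [mul_sum]
    _ ≤ (∑ t, (((cellsDet n (j t)).natAbs : ℝ) ^ k * ((k : ℝ) ^ 2 * q2)) *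
          (q2⁻¹ * ((2 * (d : ℝ)) ^ n * P))) +
        ∑ t, ((2 * (d : ℝ)) ^ T) ^ k * P *
          (((cellsDet n (j t)).natAbs : ℝ) ^ k * ((d : ℝ) + 1) ^ k) := by
        refine add_le_add (sum_le_sum fun t _ => ?_) (sum_le_sum fun t _ => ?_)
        · exact mul_le_mul_of_nonneg_right (hS₁ t) (by positivity)
        · exact mul_le_mul_of_nonneg_left (hS₂ t) (by positivity)
    _ = (C₁ + C₂) * P := by
        rw [add_mul, hC₁, hC₂, sum_mul, sum_mul]
        congr 1
        · exact sum_congr rfl fun t _ => by field_simp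
        · exact sum_congr rfl fun t _ => by ring

end MagicSquare

/-! ### p-adic solutions near the constant square -/

namespace MagicSquare
open Finset

/-- Hence a constant square satisfies all the equations with line sum n times the d-th power of its
entry. -/
lemma sum_magicMatrix (R : Type*) [CommRing R] (n : ℕ) (r : Eqn n) :
    ∑ c, magicMatrix R n r c = (n : R) := by
  rw [Fintype.sum_prod_type]
  rcases r with i | j | k
  · simp only [magicMatrix]
    rw [sum_comm]
    simp
  · have hj : (j : ℕ) < n := by have := j.2; omega
    have : ∀ x : Fin n, (if (x : ℕ) = (j : ℕ) then (1 : R) else 0) =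
        if x = ⟨j, hj⟩ then 1 else 0 := by
      intro x; simp [Fin.ext_iff]
    simp [magicMatrix, this]
  · fin_cases k <;> simp [magicMatrix]

/-- Hensel's lemma for X^d - y at the unit b: the derivative d b^(d-1) has valuation exactly τ, and
agreement modulo p^(2τ+1) is just better than its square. -/
lemma exists_padicInt_pow_eq {p : ℕ} [Fact p.Prime] {d d' τ b : ℕ} (hd : d = p ^ τ * d')
    (hd' : ¬ p ∣ d') (hb : ¬ p ∣ b) {y : ℤ} (hy : (p : ℤ) ^ (2 * τ + 1) ∣ y - (b : ℤ) ^ d) :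
    ∃ x : ℤ_[p], x ^ d = (y : ℤ_[p]) := by
  have hp : p.Prime := Fact.out
  have hp1 : (1 : ℝ) < p := by exact_mod_cast hp.one_lt
  have hp0 : (0 : ℝ) < p := by linarith
  have hunit : ∀ k : ℕ, ¬ p ∣ k → ‖(k : ℤ_[p])‖ = 1 := by
    intro k hk
    refine le_antisymm (PadicInt.norm_le_one _) (not_lt.1 fun h => hk ?_)
    have := (PadicInt.norm_int_lt_one_iff_dvd (p := p) (k : ℤ)).1 (by simpa using h)
    exact_mod_cast this
  set F : Polynomial ℤ_[p] := Polynomial.X ^ d - Polynomial.C (y : ℤ_[p]) with hF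
  have h1 : ‖F.aeval (b : ℤ_[p])‖ ≤ (p : ℝ) ^ (-((2 * τ + 1 : ℕ) : ℤ)) := by
    have : F.aeval (b : ℤ_[p]) = (((b : ℤ) ^ d - y : ℤ) : ℤ_[p]) := by simp [hF]
    rw [this, PadicInt.norm_int_le_pow_iff_dvd]
    rw [← neg_sub, dvd_neg] at hy
    exact_mod_cast hy
  have h2 : ‖F.derivative.aeval (b : ℤ_[p])‖ = (p : ℝ) ^ (-(τ : ℤ)) := by
    have : F.derivative.aeval (b : ℤ_[p]) = (d : ℤ_[p]) * (b : ℤ_[p]) ^ (d - 1) := by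
      simp [hF, Polynomial.derivative_X_pow]
    rw [this, norm_mul, norm_pow, hunit b hb, one_pow, mul_one, hd]
    push_cast
    rw [norm_mul, hunit d' hd', norm_pow, PadicInt.norm_p, mul_one, zpow_neg, zpow_natCast, inv_pow]
  have h3 : ‖F.aeval (b : ℤ_[p])‖ < ‖F.derivative.aeval (b : ℤ_[p])‖ ^ 2 := by
    refine h1.trans_lt ?_
    rw [h2, ← zpow_natCast, ← zpow_mul]
    apply zpow_lt_zpow_right₀ hp1
    push_cast; linarith
  obtain ⟨x, hx, -⟩ := hensels_lemma h3
  refine ⟨x, ?_⟩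
  simpa [hF, sub_eq_zero] using hx

/-- Integer vectors in the kernel of the coefficient matrix with prescribed coordinates, up to the
factor `cellsDet n i`, outside the cells of `i`. -/
lemma exists_kernel_vector (n : ℕ) (i : Eqn n → Fin n × Fin n) (hi : Function.Injective i)
    (z : {c // c ∉ Set.range i} → ℤ) :
    ∃ w : Fin n × Fin n → ℤ, (∀ r, ∑ c, magicMatrix ℤ n r c * w c = 0) ∧
      ∀ c : {c // c ∉ Set.range i}, w c = cellsDet n i * z c := by
  classical
  set B := (magicMatrix ℤ n).submatrix id i with hB
  set g : Eqn n → ℤ := fun r => ∑ c : {c // c ∉ Set.range i}, magicMatrix ℤ n r c * z c with hg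
  -- Cramer's rule: B u = -det(B) g cancels the contribution of the free cells without denominators.
  set u : Eqn n → ℤ := -(B.adjugate *ᵥ g) with hu
  set w : Fin n × Fin n → ℤ := fun c =>
    if h : c ∈ Set.range i then u h.choose else cellsDet n i * z ⟨c, h⟩ with hw
  have hwi : ∀ r, w (i r) = u r := by
    intro r
    have h : i r ∈ Set.range i := ⟨r, rfl⟩
    rw [hw]
    simp only [dif_pos h]
    rw [hi h.choose_spec]
  have hwc : ∀ c : {c // c ∉ Set.range i}, w c = cellsDet n i * z c := by
    intro c
    rw [hw]
    simp only [dif_neg c.2]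
  refine ⟨w, fun r => ?_, hwc⟩
  have h0 : ∑ c, magicMatrix ℤ n r c * w c = ∑ c : {c // c ∈ Set.range i},
      magicMatrix ℤ n r c * w c + ∑ c : {c // c ∉ Set.range i}, magicMatrix ℤ n r c * w c := by
    convert (Fintype.sum_subtype_add_sum_subtype (fun c => c ∈ Set.range i)
      (fun c => magicMatrix ℤ n r c * w c)).symm
  have h1 : ∑ c : {c // c ∈ Set.range i}, magicMatrix ℤ n r c * w c =
      ∑ s, B r s * u s := by
    rw [← (Equiv.ofInjective i hi).sum_comp]
    refine sum_congr rfl fun s _ => ?_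
    rw [Equiv.ofInjective_apply, hwi]; rfl
  have h2 : ∑ c : {c // c ∉ Set.range i}, magicMatrix ℤ n r c * w c = cellsDet n i * g r := by
    rw [hg]; simp only
    rw [mul_sum]
    refine sum_congr rfl fun c _ => ?_
    rw [hwc]; ring
  have h3 : ∑ s, B r s * u s = -(cellsDet n i * g r) := by
    have : B *ᵥ u = -(cellsDet n i • g) := by
      rw [hu, Matrix.mulVec_neg, Matrix.mulVec_mulVec, Matrix.mul_adjugate, Matrix.smul_mulVec,
        Matrix.one_mulVec]; rfl
    have h4 := congrFun this r
    simpa [Matrix.mulVec, dotProduct] using h4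
  rw [h0, h1, h2, h3]; ring

/-- Hensel lifting of the solution with all variables equal to `p₀`. -/
lemma pow_le_solCount {p : ℕ} [Fact p.Prime] {n d d' τ δ' v p₀ m : ℕ} (hd : d = p ^ τ * d')
    (hd' : ¬ p ∣ d') (hp₀ : ¬ p ∣ p₀) (i : Eqn n → Fin n × Fin n) (hi : Function.Injective i)
    (hδ : (cellsDet n i).natAbs = p ^ v * δ') (hδ' : ¬ p ∣ δ') (hm : 2 * τ + 1 + v ≤ m) :
    (p ^ (m - (2 * τ + 1 + v))) ^ Fintype.card {c // c ∉ Set.range i} ≤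
      solCount n d (n * p₀ ^ d) (p ^ m) := by
  classical
  have hp : p.Prime := Fact.out
  set e := 2 * τ + 1 with he
  -- The exponent e is the precision required by Hensel's lemma, and v is the p-part of the minor by
  -- which the free coordinates are scaled. A solution modulo p^m therefore still determines the
  -- free parameters modulo p^(m-e-v).
  set Q := p ^ (m - (e + v)) with hQ
  have : NeZero Q := ⟨pow_ne_zero _ hp.ne_zero⟩
  have hkv := fun z : {c // c ∉ Set.range i} → ZMod Q =>
    exists_kernel_vector n i hi fun c => ((z c).val : ℤ)
  choose w hw0 hw using hkv
  -- In terms of d-th powers the system is linear: the constant solution is perturbed by p^e times a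
  -- kernel vector, and p-adic d-th roots are taken cell by cell.
  have hlift : ∀ z c, ∃ x : ℤ_[p], x ^ d = ((((p₀ : ℤ) ^ d + (p : ℤ) ^ e * w z c : ℤ)) : ℤ_[p]) := by
    intro z c
    refine exists_padicInt_pow_eq hd hd' hp₀ ?_
    rw [add_sub_cancel_left]
    exact dvd_mul_right _ _
  choose x hx using hlift
  have hxz : ∀ z c, (PadicInt.toZModPow m (x z c)) ^ d =
      (((p₀ : ℤ) ^ d + (p : ℤ) ^ e * w z c : ℤ) : ZMod (p ^ m)) := by
    intro z c
    rw [← map_pow, hx, map_intCast]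
  set Φ : ({c // c ∉ Set.range i} → ZMod Q) → Solutions n d (n * p₀ ^ d) (ZMod (p ^ m)) :=
    fun z => ⟨fun c => PadicInt.toZModPow m (x z c), fun r => by
      simp_rw [hxz]
      have h1 : ∑ c, magicMatrix ℤ n r c * ((p₀ : ℤ) ^ d + (p : ℤ) ^ e * w z c) =
          ((n * p₀ ^ d : ℕ) : ℤ) := by
        have h2 : ∀ c, magicMatrix ℤ n r c * ((p₀ : ℤ) ^ d + (p : ℤ) ^ e * w z c) =
            magicMatrix ℤ n r c * (p₀ : ℤ) ^ d +
              (p : ℤ) ^ e * (magicMatrix ℤ n r c * w z c) := fun c => by ring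
        simp_rw [h2]
        rw [sum_add_distrib, ← sum_mul, ← mul_sum, hw0, sum_magicMatrix]
        push_cast; ring
      have h3 := congrArg (Int.castRingHom (ZMod (p ^ m))) h1
      have h4 : ∀ c, ((magicMatrix ℤ n r c : ℤ) : ZMod (p ^ m)) = magicMatrix (ZMod (p ^ m)) n r c :=
        fun c => map_magicMatrix (Int.castRingHom (ZMod (p ^ m))) n r c
      rw [map_sum] at h3
      simpa [h4] using h3⟩ with hΦ
  have hinj : Function.Injective Φ := by
    intro z z' hzz
    funext c
    have h1 : PadicInt.toZModPow m (x z c) = PadicInt.toZModPow m (x z' c) :=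
      congrFun (congrArg Subtype.val hzz) c
    have h2 := hxz z c
    rw [h1, hxz, ZMod.intCast_eq_intCast_iff_dvd_sub, hw, hw] at h2
    have h3 : (p : ℤ) ^ e * cellsDet n i * (((z c).val : ℤ) - (z' c).val) =
        (p₀ : ℤ) ^ d + (p : ℤ) ^ e * (cellsDet n i * (z c).val) -
        ((p₀ : ℤ) ^ d + (p : ℤ) ^ e * (cellsDet n i * (z' c).val)) := by ring
    rw [← h3] at h2
    have h4 : p ^ m ∣ p ^ e * (p ^ v * δ') * (((z c).val : ℤ) - (z' c).val).natAbs := by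
      have := Int.natAbs_dvd_natAbs.2 h2
      rwa [Int.natAbs_mul, Int.natAbs_mul, hδ, Int.natAbs_pow, Int.natAbs_natCast,
        Int.natAbs_natCast] at this
    have h5 : p ^ m = p ^ (e + v) * Q := by rw [hQ, ← pow_add]; congr 1; omega
    have h6 : p ^ e * (p ^ v * δ') * (((z c).val : ℤ) - (z' c).val).natAbs =
        p ^ (e + v) * (δ' * (((z c).val : ℤ) - (z' c).val).natAbs) := by rw [pow_add]; ring
    rw [h5, h6] at h4
    have h7 := Nat.dvd_of_mul_dvd_mul_left (pow_pos hp.pos _) h4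
    have h8 : Q.Coprime δ' := Nat.Coprime.pow_left _ ((Nat.Prime.coprime_iff_not_dvd hp).2 hδ')
    have h9 := h8.dvd_of_dvd_mul_left h7
    have h10 : (Q : ℤ) ∣ ((z c).val : ℤ) - (z' c).val := Int.natCast_dvd.2 h9
    have h11 := (ZMod.intCast_eq_intCast_iff_dvd_sub ((z' c).val : ℤ) (z c).val Q).2 h10
    simpa using h11.symm
  have : Finite (Solutions n d (n * p₀ ^ d) (ZMod (p ^ m))) := by
    unfold Solutions; infer_instance
  have := Nat.card_le_card_of_injective Φ hinj
  rw [Nat.card_fun, Nat.card_zmod, Nat.card_eq_fintype_card] at this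
  exact this

lemma card_cells_eq (n : ℕ) (i : Eqn n → Fin n × Fin n) (hi : Function.Injective i)
    [Fintype {c // c ∉ Set.range i}] :
    n ^ 2 = Fintype.card (Eqn n) + Fintype.card {c // c ∉ Set.range i} := by
  classical
  have h1 := Fintype.card_congr (Equiv.ofInjective i hi)
  have h2 := Fintype.card_subtype_compl (fun c => c ∈ Set.range i)
  have h3 := Fintype.card_subtype_le (fun c => c ∈ Set.range i)
  have h4 : Fintype.card (Fin n × Fin n) = n ^ 2 := by
    rw [Fintype.card_prod, Fintype.card_fin, sq]
  have h5 : Fintype.card ↑(Set.range i) = Fintype.card {c // c ∈ Set.range i} :=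
    Fintype.card_congr (Equiv.refl _)
  rw [Fintype.card_congr (Equiv.refl {c // c ∉ Set.range i})] at *
  omega

/-- The normalised number of solutions modulo `p ^ m`. -/
noncomputable def localCount (n d μ p m : ℕ) : ℝ :=
  (((p : ℝ) ^ m) ^ (n ^ 2))⁻¹ * (((p : ℝ) ^ m) ^ Fintype.card (Eqn n) * solCount n d μ (p ^ m))

lemma sum_range_A_eq_localCount {p : ℕ} (hp : p.Prime) (n d μ m : ℕ) :
    ∑ j ∈ range (m + 1), A n d μ (p ^ j) = (localCount n d μ p m : ℂ) := by
  rw [sum_range_A_prime_pow hp, localCount]; push_cast; rfl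

/-- The lifting loses only a fixed power of p per free cell, so the bound depends neither on p₀ nor
on m. -/
lemma exists_le_localCount {p : ℕ} (hp : p.Prime) {n d : ℕ} (hd : d ≠ 0)
    (i : Eqn n → Fin n × Fin n) (hi : Function.Injective i) (hdet : cellsDet n i ≠ 0) :
    ∃ c : ℝ, 0 < c ∧ ∃ m₀ : ℕ, ∀ p₀ : ℕ, ¬ p ∣ p₀ → ∀ m, m₀ ≤ m →
      c ≤ localCount n d (n * p₀ ^ d) p m := by
  classical
  have : Fact p.Prime := ⟨hp⟩
  have hp0 : (0 : ℝ) < p := by exact_mod_cast hp.pos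
  obtain ⟨τ, d', hd', hdd⟩ := Nat.exists_eq_pow_mul_and_not_dvd hd p hp.one_lt.ne'
  obtain ⟨v, δ', hδ', hδ⟩ := Nat.exists_eq_pow_mul_and_not_dvd (Int.natAbs_ne_zero.2 hdet) p
    hp.one_lt.ne'
  set s := 2 * τ + 1 + v with hs
  set R := Fintype.card {c // c ∉ Set.range i} with hR
  refine ⟨(((p : ℝ) ^ s) ^ R)⁻¹, by positivity, s, fun p₀ hp₀ m hm => ?_⟩
  have h1 := pow_le_solCount hdd hd' hp₀ i hi hδ hδ' hm
  have h2 : (((p : ℝ) ^ (m - s)) ^ R) ≤ solCount n d (n * p₀ ^ d) (p ^ m) := by exact_mod_cast h1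
  rw [localCount, card_cells_eq n i hi, pow_add ((p : ℝ) ^ m)]
  have h3 : (p : ℝ) ^ m = (p : ℝ) ^ s * p ^ (m - s) := by rw [← pow_add]; congr 1; omega
  have h4 : (((p : ℝ) ^ s) ^ R)⁻¹ = (((p : ℝ) ^ m) ^ R)⁻¹ * ((p : ℝ) ^ (m - s)) ^ R := by
    rw [h3, mul_pow]; field_simp
  have h5 : ∀ x y z : ℝ, x ≠ 0 → (x * y)⁻¹ * (x * z) = y⁻¹ * z := by
    intro x y z hx
    rw [mul_inv, mul_mul_mul_comm, inv_mul_cancel₀ hx, one_mul]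
  rw [h5 _ _ _ (by positivity), h4]
  exact mul_le_mul_of_nonneg_left h2 (by positivity)

end MagicSquare

/-! ### Euler product and positivity of the singular series -/

namespace MagicSquare
open Finset Filter Topology

lemma one_sub_sum_le_prod {ι : Type*} (s : Finset ι) (f : ι → ℝ) (h0 : ∀ i ∈ s, 0 ≤ f i)
    (h1 : ∀ i ∈ s, f i ≤ 1) : 1 - ∑ i ∈ s, f i ≤ ∏ i ∈ s, (1 - f i) := by
  classical
  induction s using Finset.induction_on with
  | empty => simp
  | insert a s ha ih =>
    rw [sum_insert ha, prod_insert ha]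
    have h2 := ih (fun i hi => h0 i (mem_insert_of_mem hi)) fun i hi => h1 i (mem_insert_of_mem hi)
    have h3 := h0 a (mem_insert_self a s)
    have h4 := h1 a (mem_insert_self a s)
    have h5 : 0 ≤ ∑ i ∈ s, f i := sum_nonneg fun i hi => h0 i (mem_insert_of_mem hi)
    calc 1 - (f a + ∑ i ∈ s, f i) ≤ (1 - f a) * (1 - ∑ i ∈ s, f i) := by nlinarith
      _ ≤ _ := mul_le_mul_of_nonneg_left h2 (by linarith)

variable {n d T : ℕ}

/-- Merges the two bounds into one that is summable over m and then over p, since the exponent 1 +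
1/d exceeds 1. -/
lemma exists_norm_A_prime_pow_le_geometric [NeZero T] (hd : 2 ≤ d) (hT : d + 1 ≤ T)
    (hn : 2 * d + 3 ≤ n) (j : Fin T → Eqn n → Fin n × Fin n)
    (hj : Function.Injective fun x : Fin T × Eqn n => j x.1 x.2)
    (hdet : ∀ t, cellsDet n (j t) ≠ 0) :
    ∃ C : ℝ, 0 ≤ C ∧ ∀ p : ℕ, p.Prime → ∀ m μ : ℕ, m ≠ 0 →
      ‖A n d μ (p ^ m)‖ ≤ C * (p : ℝ) ^ (-(1 + 1 / d : ℝ)) *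
        (((m : ℝ) + 1) ^ Fintype.card (Eqn n) * ((2 : ℝ) ^ (-(1 / d : ℝ))) ^ m) := by
  obtain ⟨C₁, hC₁, h₁⟩ := exists_norm_A_prime_pow_le hd hT j hj hdet
  obtain ⟨C₂, hC₂, h₂⟩ := exists_norm_A_prime_pow_le_of_le hd hT hn j hj hdet
  set k := Fintype.card (Eqn n) with hk
  set P : ℕ := d + ∑ t, (cellsDet n (j t)).natAbs with hP
  set s : ℝ := 1 + 1 / d with hs
  set ρ : ℝ := (2 : ℝ) ^ (-(1 / d : ℝ)) with hρ
  have hd0 : (0 : ℝ) < d := by positivity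
  have hdR : (2 : ℝ) ≤ d := by exact_mod_cast hd
  have hρ0 : 0 < ρ := by positivity
  have hρm : ∀ m : ℕ, ρ ^ m = (2 : ℝ) ^ (-((m : ℝ) / d)) := by
    intro m
    rw [hρ, ← Real.rpow_natCast, ← Real.rpow_mul (by norm_num)]; congr 1; ring
  -- The three parts serve good primes with m ≤ d, where ρ^m ≥ 1/2; good primes with m > d, where
  -- 2^s ≤ 4 and p^(-m/d) contains p^(-s); and the bad primes, which divide d or a minor and are at
  -- most P.
  refine ⟨2 * C₂ + 4 * C₁ + C₁ * (P : ℝ) ^ s, by positivity, ?_⟩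
  intro p hp m μ hm
  have hp0 : (0 : ℝ) < p := by exact_mod_cast hp.pos
  have hp2 : (2 : ℝ) ≤ p := by exact_mod_cast hp.two_le
  have hp1 : (1 : ℝ) ≤ p := by linarith
  set Y : ℝ := ((m : ℝ) + 1) ^ k with hY
  have hY1 : 1 ≤ Y := one_le_pow₀ (by linarith [(Nat.cast_nonneg m : (0 : ℝ) ≤ m)])
  have hX0 : 0 < (p : ℝ) ^ (-s) := by positivity
  have hfin : ∀ K : ℝ, K ≤ 2 * C₂ + 4 * C₁ + C₁ * (P : ℝ) ^ s →
      ‖A n d μ (p ^ m)‖ ≤ K * (p : ℝ) ^ (-s) * (Y * ρ ^ m) →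
      ‖A n d μ (p ^ m)‖ ≤ (2 * C₂ + 4 * C₁ + C₁ * (P : ℝ) ^ s) * (p : ℝ) ^ (-s) * (Y * ρ ^ m) := by
    intro K hK h
    refine h.trans ?_
    gcongr
  have hPs : 0 ≤ (P : ℝ) ^ s := by positivity
  by_cases hgood : ¬ p ∣ d ∧ ∀ t, ¬ (p : ℤ) ∣ cellsDet n (j t)
  · rcases Nat.lt_or_ge d m with hdm | hdm
    · refine hfin (4 * C₁) (by nlinarith [mul_nonneg hC₁ hPs]) ((h₁ p hp m μ hm).trans ?_)
      have h3 : (p : ℝ) ^ (-((m : ℝ) / d)) ≤ (p : ℝ) ^ (-s) * (4 * ρ ^ m) := by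
        have h4 : (p : ℝ) ^ (-((m : ℝ) / d)) =
            (p : ℝ) ^ (-s) * (p : ℝ) ^ (-(((m : ℝ) - d - 1) / d)) := by
          rw [← Real.rpow_add hp0, hs]; congr 1; field_simp; ring
        have h5 : (p : ℝ) ^ (-(((m : ℝ) - d - 1) / d)) ≤ (2 : ℝ) ^ (-(((m : ℝ) - d - 1) / d)) := by
          apply Real.rpow_le_rpow_of_nonpos (by norm_num) hp2
          have : (d : ℝ) + 1 ≤ m := by exact_mod_cast hdm
          rw [neg_nonpos]
          exact div_nonneg (by linarith) hd0.le
        have h6 : (2 : ℝ) ^ (-(((m : ℝ) - d - 1) / d)) = (2 : ℝ) ^ s * ρ ^ m := by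
          rw [hρm, ← Real.rpow_add (by norm_num), hs]; congr 1; field_simp; ring
        have h7 : (2 : ℝ) ^ s ≤ 4 := by
          have : (2 : ℝ) ^ s ≤ (2 : ℝ) ^ (2 : ℝ) := by
            apply Real.rpow_le_rpow_of_exponent_le (by norm_num)
            have : 1 / (d : ℝ) ≤ 1 := by rw [div_le_one hd0]; linarith
            rw [hs]; linarith
          norm_num at this; exact this
        rw [h4]
        refine mul_le_mul_of_nonneg_left (h5.trans ?_) hX0.le
        rw [h6]
        exact mul_le_mul_of_nonneg_right h7 (by positivity)
      calc C₁ * Y * (p : ℝ) ^ (-((m : ℝ) / d)) ≤ C₁ * Y * ((p : ℝ) ^ (-s) * (4 * ρ ^ m)) := by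
            gcongr
        _ = _ := by ring
    · refine hfin (2 * C₂) (by nlinarith [mul_nonneg hC₁ hPs])
        ((h₂ p hp hgood.1 hgood.2 m μ hm hdm).trans ?_)
      have h3 : (p : ℝ) ^ (-(3 / 2 : ℝ)) ≤ (p : ℝ) ^ (-s) := by
        apply Real.rpow_le_rpow_of_exponent_le hp1
        have : 1 / (d : ℝ) ≤ 1 / 2 := one_div_le_one_div_of_le (by norm_num) hdR
        rw [hs]; linarith
      have h4 : 1 / 2 ≤ ρ ^ m := by
        rw [hρm]
        have : (2 : ℝ) ^ (-1 : ℝ) ≤ (2 : ℝ) ^ (-((m : ℝ) / d)) := by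
          apply Real.rpow_le_rpow_of_exponent_le (by norm_num)
          have : (m : ℝ) / d ≤ 1 := by rw [div_le_one hd0]; exact_mod_cast hdm
          linarith
        rw [Real.rpow_neg_one] at this
        linarith
      have h5 : 1 ≤ 2 * (Y * ρ ^ m) := by nlinarith
      calc C₂ * (p : ℝ) ^ (-(3 / 2 : ℝ)) ≤ C₂ * (p : ℝ) ^ (-s) * 1 := by
            rw [mul_one]; gcongr
        _ ≤ C₂ * (p : ℝ) ^ (-s) * (2 * (Y * ρ ^ m)) := by gcongr
        _ = _ := by ring
  · refine hfin (C₁ * (P : ℝ) ^ s) (by linarith) ((h₁ p hp m μ hm).trans ?_)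
    have hpP : (p : ℝ) ≤ P := by
      have : p ≤ P := by
        rw [not_and_or] at hgood
        push Not at hgood
        rcases hgood with h | ⟨t, ht⟩
        · exact (Nat.le_of_dvd (by omega) h).trans (Nat.le_add_right _ _)
        · have h3 := Nat.le_of_dvd (Int.natAbs_pos.2 (hdet t)) (Int.natCast_dvd.1 ht)
          have h4 := single_le_sum (f := fun t => (cellsDet n (j t)).natAbs)
            (fun t _ => Nat.zero_le _) (mem_univ t)
          exact (h3.trans h4).trans (Nat.le_add_left _ _)
      exact_mod_cast this
    have h3 : (p : ℝ) ^ (-((m : ℝ) / d)) ≤ ρ ^ m := by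
      rw [hρm]
      apply Real.rpow_le_rpow_of_nonpos (by norm_num) hp2
      rw [neg_nonpos]; positivity
    have h4 : 1 ≤ (P : ℝ) ^ s * (p : ℝ) ^ (-s) := by
      rw [Real.rpow_neg hp0.le, ← div_eq_mul_inv, one_le_div (by positivity)]
      exact Real.rpow_le_rpow hp0.le hpP (by rw [hs]; positivity)
    calc C₁ * Y * (p : ℝ) ^ (-((m : ℝ) / d)) ≤ C₁ * Y * (1 * ρ ^ m) := by rw [one_mul]; gcongr
      _ ≤ C₁ * Y * (((P : ℝ) ^ s * (p : ℝ) ^ (-s)) * ρ ^ m) := by gcongr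
      _ = _ := by ring

lemma exists_tsum_norm_A_prime_pow_le [NeZero T] (hd : 2 ≤ d) (hT : d + 1 ≤ T)
    (hn : 2 * d + 3 ≤ n) (j : Fin T → Eqn n → Fin n × Fin n)
    (hj : Function.Injective fun x : Fin T × Eqn n => j x.1 x.2)
    (hdet : ∀ t, cellsDet n (j t) ≠ 0) :
    ∃ C : ℝ, 0 ≤ C ∧ ∀ p : ℕ, p.Prime → ∀ μ : ℕ, Summable (fun m => ‖A n d μ (p ^ m)‖) ∧
      ∑' m, ‖A n d μ (p ^ (m + 1))‖ ≤ C * (p : ℝ) ^ (-(1 + 1 / d : ℝ)) := by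
  obtain ⟨C, hC, h⟩ := exists_norm_A_prime_pow_le_geometric hd hT hn j hj hdet
  set k := Fintype.card (Eqn n) with hk
  set ρ : ℝ := (2 : ℝ) ^ (-(1 / d : ℝ)) with hρ
  have hρ0 : 0 < ρ := by positivity
  have hρ1 : ρ < 1 := by
    apply Real.rpow_lt_one_of_one_lt_of_neg (by norm_num)
    have : (0 : ℝ) < d := by positivity
    simp only [one_div, Left.neg_neg_iff, inv_pos]; exact this
  have hsum : Summable fun m : ℕ => (((m : ℝ) + 1) ^ k * ρ ^ m) := by
    have h1 := summable_pow_mul_geometric_of_norm_lt_one k (r := ρ)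
      (by rwa [Real.norm_of_nonneg hρ0.le])
    have h2 := ((summable_nat_add_iff 1).2 h1).mul_right ρ⁻¹
    refine h2.congr fun m => ?_
    push_cast
    rw [pow_succ]; field_simp
  have hsum1 : Summable fun m : ℕ => ((((m + 1 : ℕ) : ℝ) + 1) ^ k * ρ ^ (m + 1)) :=
    (summable_nat_add_iff 1).2 hsum
  refine ⟨C * ∑' m : ℕ, ((((m + 1 : ℕ) : ℝ) + 1) ^ k * ρ ^ (m + 1)),
    mul_nonneg hC (tsum_nonneg fun m => by positivity), ?_⟩
  intro p hp μ
  have hb : ∀ m, ‖A n d μ (p ^ (m + 1))‖ ≤ C * (p : ℝ) ^ (-(1 + 1 / d : ℝ)) *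
      ((((m + 1 : ℕ) : ℝ) + 1) ^ k * ρ ^ (m + 1)) := fun m => h p hp (m + 1) μ (by omega)
  have hs1 : Summable fun m => ‖A n d μ (p ^ (m + 1))‖ :=
    Summable.of_nonneg_of_le (fun _ => norm_nonneg _) hb (hsum1.mul_left _)
  refine ⟨(summable_nat_add_iff 1).1 hs1, ?_⟩
  refine (hs1.tsum_le_tsum hb (hsum1.mul_left _)).trans (le_of_eq ?_)
  rw [tsum_mul_left]; ring

/-- The singular series converges absolutely. -/
lemma summable_norm_A {μ : ℕ} {C s : ℝ} (hC : 0 ≤ C) (hs : 1 < s)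
    (h : ∀ p : ℕ, p.Prime → Summable (fun m => ‖A n d μ (p ^ m)‖) ∧
      ∑' m, ‖A n d μ (p ^ (m + 1))‖ ≤ C * (p : ℝ) ^ (-s)) :
    Summable fun q => ‖A n d μ q‖ := by
  have hf₁ : ‖A n d μ 1‖ = 1 := by rw [A_one, norm_one]
  have hmul : ∀ {a b : ℕ}, a.Coprime b → ‖A n d μ (a * b)‖ = ‖A n d μ a‖ * ‖A n d μ b‖ := by
    intro a b hab
    rw [A_mul n d μ hab, norm_mul]
  have hZ : Summable fun p : ℕ => C * (p : ℝ) ^ (-s) :=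
    (Real.summable_nat_rpow.2 (by linarith)).mul_left C
  have hZ0 : ∀ p : ℕ, 0 ≤ C * (p : ℝ) ^ (-s) := fun p => by positivity
  -- A finite sum is at most the sum over N-smooth numbers, a finite Euler product whose factors are
  -- at most 1 + C p^(-s) ≤ exp(C p^(-s)).
  refine summable_of_sum_le (c := Real.exp (∑' p : ℕ, C * (p : ℝ) ^ (-s)))
    (fun q => norm_nonneg _) fun u => ?_
  set N := u.sup id + 1 with hN
  obtain ⟨-, h2⟩ := EulerProduct.summable_and_hasSum_smoothNumbers_prod_primesBelow_tsum
    (f := fun q => ‖A n d μ q‖) hf₁ hmul (fun hp => by simpa using (h _ hp).1) N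
  have h3 : ∏ p ∈ N.primesBelow, ∑' m, ‖A n d μ (p ^ m)‖ ≤
      Real.exp (∑' p : ℕ, C * (p : ℝ) ^ (-s)) := by
    calc ∏ p ∈ N.primesBelow, ∑' m, ‖A n d μ (p ^ m)‖
        ≤ ∏ p ∈ N.primesBelow, Real.exp (C * (p : ℝ) ^ (-s)) := by
          refine prod_le_prod (fun p _ => tsum_nonneg fun _ => norm_nonneg _) fun p hp => ?_
          have hp' := h p (Nat.prime_of_mem_primesBelow hp)
          rw [hp'.1.tsum_eq_zero_add, pow_zero, hf₁]
          have := Real.add_one_le_exp (C * (p : ℝ) ^ (-s))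
          linarith [hp'.2]
      _ = Real.exp (∑ p ∈ N.primesBelow, C * (p : ℝ) ^ (-s)) := (Real.exp_sum _ _).symm
      _ ≤ _ := Real.exp_le_exp.2 (hZ.sum_le_tsum _ fun p _ => hZ0 p)
  refine le_trans ?_ h3
  rw [← h2.tsum_eq]
  have h4 : ∑ q ∈ u, ‖A n d μ q‖ = ∑ q ∈ u.filter (· ≠ 0), ‖A n d μ q‖ := by
    rw [sum_filter]
    refine sum_congr rfl fun q _ => ?_
    split_ifs with hq
    · rfl
    · push Not at hq; rw [hq, A_zero, norm_zero]
  have h5 : ∀ q ∈ u.filter (· ≠ 0), q ∈ N.smoothNumbers := by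
    intro q hq
    rw [mem_filter] at hq
    refine Nat.mem_smoothNumbers_of_lt (Nat.pos_of_ne_zero hq.2) ?_
    have := le_sup (f := id) hq.1
    simp only [id] at this
    omega
  rw [h4, ← sum_subtype_of_mem (p := (· ∈ N.smoothNumbers)) (fun q => ‖A n d μ q‖) h5]
  exact h2.summable.sum_le_tsum _ fun q _ => norm_nonneg _

/-- The singular series is real and bounded below by a positive constant for `μ = n * p₀ ^ d` with
`p₀` a large prime. -/
theorem exists_le_singularSeries [NeZero T] (hd : 2 ≤ d) (hT : d + 1 ≤ T)
    (hn : 2 * d + 3 ≤ n) (j : Fin T → Eqn n → Fin n × Fin n)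
    (hj : Function.Injective fun x : Fin T × Eqn n => j x.1 x.2)
    (hdet : ∀ t, cellsDet n (j t) ≠ 0) :
    ∃ c : ℝ, 0 < c ∧ ∃ P : ℕ, ∀ p₀ : ℕ, p₀.Prime → P ≤ p₀ →
      Summable (fun q : ℕ+ => A n d (n * p₀ ^ d) q) ∧
      ∃ x : ℝ, c ≤ x ∧ singularSeries n d (n * p₀ ^ d) = x := by
  obtain ⟨C, hC, h⟩ := exists_tsum_norm_A_prime_pow_le hd hT hn j hj hdet
  have hd0 : (0 : ℝ) < d := by positivity
  set s : ℝ := 1 + 1 / d with hs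
  have hs1 : 1 < s := by rw [hs]; linarith [one_div_pos.2 hd0]
  set g : ℕ → ℝ := fun p => C * (p : ℝ) ^ (-s) with hg
  have hg0 : ∀ p, 0 ≤ g p := fun p => by rw [hg]; positivity
  have hgs : Summable g := (Real.summable_nat_rpow.2 (by linarith)).mul_left C
  -- Primes from P on contribute a factor at least 1 - 1/2 in total. As p₀ ≥ P, no prime below P
  -- divides p₀, so the Hensel bound is available at all of them.
  obtain ⟨P, hP⟩ : ∃ P : ℕ, ∑' p, g (p + P) < 1 / 2 :=
    ((tendsto_sum_nat_add g).eventually (gt_mem_nhds (by norm_num))).exists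
  have hi : ∀ t, Function.Injective (j t) := fun t a b hab =>
    (Prod.mk.inj (hj (a₁ := (t, a)) (a₂ := (t, b)) hab)).2
  set t₀ : Fin T := 0 with ht₀
  have hloc : ∀ p : ℕ, ∃ c : ℝ, 0 < c ∧ (p.Prime → ∃ m₀ : ℕ, ∀ p₀ : ℕ, ¬ p ∣ p₀ →
      ∀ m, m₀ ≤ m → c ≤ localCount n d (n * p₀ ^ d) p m) := by
    intro p
    by_cases hp : p.Prime
    · obtain ⟨c, hc, m₀, h0⟩ := exists_le_localCount hp (d := d) (by omega) (j t₀) (hi t₀) (hdet t₀)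
      exact ⟨c, hc, fun _ => ⟨m₀, h0⟩⟩
    · exact ⟨1, one_pos, fun h => absurd h hp⟩
  choose c hc0 hc using hloc
  -- The minimum with 1 allows the product over all of `range P` to bound from below any product
  -- over a subset of it.
  refine ⟨(∏ p ∈ range P, min (c p) 1) * (1 / 2),
    mul_pos (prod_pos fun p _ => lt_min (hc0 p) one_pos) (by norm_num), P, ?_⟩
  intro p₀ hp₀ hPp₀
  set μ := n * p₀ ^ d with hμ
  have hsumA : Summable fun q => ‖A n d μ q‖ := summable_norm_A hC hs1 fun p hp => h p hp μ
  refine ⟨(hsumA.of_norm).comp_injective PNat.coe_injective, ?_⟩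
  have htend : ∀ p, p.Prime → Tendsto (fun m => (localCount n d μ p m : ℂ)) atTop
      (𝓝 (∑' m, A n d μ (p ^ m))) := by
    intro p hp
    have h1 := ((h p hp μ).1.of_norm).hasSum.tendsto_sum_nat
    have h2 := h1.comp (tendsto_add_atTop_nat 1)
    refine h2.congr fun m => ?_
    exact sum_range_A_eq_localCount hp n d μ m
  have hσ : ∀ p, p.Prime → ∃ x : ℝ, ∑' m, A n d μ (p ^ m) = x ∧
      Tendsto (localCount n d μ p) atTop (𝓝 x) := by
    intro p hp
    have h1 := (Complex.continuous_re.tendsto _).comp (htend p hp)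
    have h2 := (Complex.continuous_ofReal.tendsto _).comp h1
    refine ⟨_, tendsto_nhds_unique (htend p hp) ?_, h1⟩
    exact h2.congr fun m => by simp
  have hσ' : ∀ p, ∃ x : ℝ, p.Prime → ∑' m, A n d μ (p ^ m) = x ∧
      Tendsto (localCount n d μ p) atTop (𝓝 x) := by
    intro p
    by_cases hp : p.Prime
    · obtain ⟨x, hx⟩ := hσ p hp; exact ⟨x, fun _ => hx⟩
    · exact ⟨0, fun h => absurd h hp⟩
  choose σ hσ using hσ'
  have hsmall : ∀ p, p.Prime → p < P → min (c p) 1 ≤ σ p := by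
    intro p hp hpP
    obtain ⟨m₀, hm₀⟩ := hc p hp
    refine (min_le_left _ _).trans (ge_of_tendsto (hσ p hp).2 ?_)
    filter_upwards [eventually_ge_atTop m₀] with m hm
    refine hm₀ p₀ (fun hdvd => ?_) m hm
    rw [Nat.prime_dvd_prime_iff_eq hp hp₀] at hdvd
    omega
  -- The absolute bound needs no condition on p₀, so it also covers p = p₀.
  have hlarge : ∀ p, p.Prime → 1 - g p ≤ σ p := by
    intro p hp
    have h1 := (hσ p hp).1
    rw [((h p hp μ).1.of_norm).tsum_eq_zero_add, pow_zero, A_one] at h1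
    have h2 : Summable fun m => ‖A n d μ (p ^ (m + 1))‖ := (summable_nat_add_iff 1).2 (h p hp μ).1
    have h3 := (norm_tsum_le_tsum_norm h2).trans (h p hp μ).2
    have h4 : ∑' m, A n d μ (p ^ (m + 1)) = ((σ p - 1 : ℝ) : ℂ) := by
      push_cast; rw [← h1]; ring
    rw [h4, Complex.norm_real, Real.norm_eq_abs] at h3
    have := (abs_le.1 h3).1
    have h5 : g p = C * (p : ℝ) ^ (-s) := rfl
    linarith
  have htail : ∀ F : Finset ℕ, (∀ p ∈ F, P ≤ p) → ∑ p ∈ F, g p ≤ 1 / 2 := by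
    intro F hF
    have h1 : ∑ p ∈ F, g p = ∑ p ∈ F.image (· - P), g (p + P) := by
      rw [sum_image]
      · exact sum_congr rfl fun p hp => by rw [Nat.sub_add_cancel (hF p hp)]
      · intro a ha b hb hab
        have := hF a ha
        have := hF b hb
        simp only at hab
        omega
    rw [h1]
    exact ((((summable_nat_add_iff P).2 hgs).sum_le_tsum _ fun p _ => hg0 _).trans hP.le)
  have hpart : ∀ N : ℕ, (∏ p ∈ range P, min (c p) 1) * (1 / 2) ≤ ∏ p ∈ N.primesBelow, σ p := by
    intro N
    rw [← prod_filter_mul_prod_filter_not N.primesBelow (· < P)]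
    have hA : ∏ p ∈ range P, min (c p) 1 ≤ ∏ p ∈ N.primesBelow with p < P, σ p := by
      have hsub : N.primesBelow.filter (· < P) ⊆ range P := fun p hp =>
        mem_range.2 (mem_filter.1 hp).2
      refine le_trans ?_ (prod_le_prod (fun p _ => (lt_min (hc0 p) one_pos).le)
        fun p hp => hsmall p (Nat.prime_of_mem_primesBelow (mem_filter.1 hp).1) (mem_filter.1 hp).2)
      rw [← prod_sdiff hsub]
      exact mul_le_of_le_one_left (prod_nonneg fun p _ => (lt_min (hc0 p) one_pos).le)
        (prod_le_one (fun p _ => (lt_min (hc0 p) one_pos).le) fun p _ => min_le_right _ _)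
    have hB : 1 / 2 ≤ ∏ p ∈ N.primesBelow with ¬ p < P, σ p := by
      have hge : ∀ p ∈ N.primesBelow.filter (¬ · < P), P ≤ p := fun p hp =>
        not_lt.1 (mem_filter.1 hp).2
      have h1 := htail _ hge
      have h2 : ∀ p ∈ N.primesBelow.filter (¬ · < P), g p ≤ 1 := fun p hp =>
        (single_le_sum (fun p _ => hg0 p) hp).trans (h1.trans (by norm_num))
      calc (1 : ℝ) / 2 ≤ 1 - ∑ p ∈ N.primesBelow.filter (¬ · < P), g p := by linarith
        _ ≤ ∏ p ∈ N.primesBelow.filter (¬ · < P), (1 - g p) :=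
          one_sub_sum_le_prod _ _ (fun p _ => hg0 p) h2
        _ ≤ _ := prod_le_prod (fun p hp => by linarith [h2 p hp]) fun p hp =>
          hlarge p (Nat.prime_of_mem_primesBelow (mem_filter.1 hp).1)
    exact mul_le_mul hA hB (by norm_num)
      (le_trans (prod_nonneg fun p _ => (lt_min (hc0 p) one_pos).le) hA)
  have hE := EulerProduct.eulerProduct (f := A n d μ) (A_one n d μ) (A_mul n d μ) hsumA
    (A_zero n d μ)
  have hE' : Tendsto (fun N : ℕ => ((∏ p ∈ N.primesBelow, σ p : ℝ) : ℂ)) atTop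
      (𝓝 (∑' q, A n d μ q)) := by
    refine hE.congr fun N => ?_
    push_cast
    exact prod_congr rfl fun p hp => (hσ p (Nat.prime_of_mem_primesBelow hp)).1
  have hR := (Complex.continuous_re.tendsto _).comp hE'
  have hRR := (Complex.continuous_ofReal.tendsto _).comp hR
  have hser : singularSeries n d μ = ∑' q, A n d μ q := by
    rw [singularSeries]
    exact tsum_pnat_eq_tsum_of_eq_zero (A_zero n d μ)
  refine ⟨(∑' q, A n d μ q).re, ?_, ?_⟩
  · refine ge_of_tendsto hR (Eventually.of_forall fun N => ?_)
    exact hpart N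
  · rw [hser]
    refine tendsto_nhds_unique hE' (hRR.congr fun N => ?_)
    rfl

end MagicSquare

/-! ### Decay of I and absolute convergence of the singular integral -/

namespace MagicSquare
open Finset MeasureTheory

lemma hasDerivAt_e_comp_pow (d : ℕ) (β ξ : ℝ) :
    HasDerivAt (fun ξ : ℝ => e (β * ξ ^ d))
      (e (β * ξ ^ d) * (2 * Real.pi * Complex.I * β * (d * (ξ : ℂ) ^ (d - 1)))) ξ := by
  unfold e
  have h1 : HasDerivAt (fun ξ : ℝ => ((β * ξ ^ d : ℝ) : ℂ)) ((β * (d * ξ ^ (d - 1)) : ℝ) : ℂ) ξ :=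
    ((hasDerivAt_pow d ξ).const_mul β).ofReal_comp
  convert ((h1.const_mul (2 * Real.pi * Complex.I)).cexp) using 1
  push_cast; ring

lemma continuous_I (d : ℕ) : Continuous (I d) := by
  unfold I
  refine intervalIntegral.continuous_parametric_intervalIntegral_of_continuous' ?_ 0 1
  have := continuous_e
  unfold Function.uncurry
  fun_prop

lemma norm_I_le_one (d : ℕ) (β : ℝ) : ‖I d β‖ ≤ 1 := by
  have := intervalIntegral.norm_integral_le_of_norm_le_const (a := 0) (b := 1) (C := 1)
    (f := fun ξ : ℝ => e (β * ξ ^ d)) fun x _ => (norm_e _).le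
  simpa [I] using this

lemma hasDerivAt_inv_pow_pred {d : ℕ} (hd : 2 ≤ d) {ξ : ℝ} (h0 : ξ ≠ 0) :
    HasDerivAt (fun ξ : ℝ => (ξ ^ (d - 1))⁻¹) (-(((d : ℝ) - 1) * (ξ ^ d)⁻¹)) ξ := by
  obtain ⟨D, rfl⟩ : ∃ D, d = D + 2 := ⟨d - 2, by omega⟩
  refine ((hasDerivAt_pow (D + 2 - 1) ξ).fun_inv (pow_ne_zero _ h0)).congr_deriv ?_
  have e1 : D + 2 - 1 = D + 1 := by omega
  have e2 : D + 1 - 1 = D := by omega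
  rw [e1, e2]
  push_cast
  field_simp
  ring

/-- The first derivative test for the oscillatory integral away from the origin. -/
lemma norm_integral_e_le {d : ℕ} (hd : 2 ≤ d) {β η : ℝ} (hβ : β ≠ 0) (hη : 0 < η) (hη1 : η ≤ 1) :
    ‖∫ ξ in η..1, e (β * ξ ^ d)‖ ≤ 1 / (|β| * η ^ (d - 1)) := by
  have hd0 : (0 : ℝ) < d := by positivity
  set w : ℂ := 2 * Real.pi * Complex.I * β * d with hw
  have hw0 : w ≠ 0 := by
    rw [hw]
    have : (β : ℂ) ≠ 0 := by exact_mod_cast hβ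
    have : (d : ℂ) ≠ 0 := by exact_mod_cast (by omega : d ≠ 0)
    have := Complex.two_pi_I_ne_zero
    positivity
  have hwn : ‖w‖ = 2 * Real.pi * |β| * d := by
    rw [hw]
    simp [abs_of_pos Real.pi_pos]
  have hpos : ∀ ξ ∈ Set.uIcc η 1, 0 < ξ := by
    intro ξ hξ
    rw [Set.uIcc_of_le hη1] at hξ
    exact hη.trans_le hξ.1
  -- The reciprocal of the derivative of the phase, for integration by parts.
  set h : ℝ → ℂ := fun ξ => w⁻¹ * (((ξ ^ (d - 1))⁻¹ : ℝ) : ℂ) with hh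
  set h' : ℝ → ℂ := fun ξ => -(w⁻¹ * ((((d : ℝ) - 1) * (ξ ^ d)⁻¹ : ℝ) : ℂ)) with hh'
  have hderiv : ∀ ξ ∈ Set.uIcc η 1, HasDerivAt h (h' ξ) ξ := by
    intro ξ hξ
    have h0 := (hpos ξ hξ).ne'
    have h2 := ((hasDerivAt_inv_pow_pred hd h0).ofReal_comp).const_mul w⁻¹
    exact h2.congr_deriv (by simp [hh'])
  have hcont : ContinuousOn h' (Set.uIcc η 1) := by
    rw [hh']
    refine (continuousOn_const.mul (Complex.continuous_ofReal.comp_continuousOn ?_)).neg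
    refine continuousOn_const.mul (ContinuousOn.inv₀ (by fun_prop) fun ξ hξ => ?_)
    exact pow_ne_zero _ (hpos ξ hξ).ne'
  have hE : ∀ ξ : ℝ, HasDerivAt (fun ξ : ℝ => e (β * ξ ^ d))
      (e (β * ξ ^ d) * (2 * Real.pi * Complex.I * β * (d * (ξ : ℂ) ^ (d - 1)))) ξ :=
    fun ξ => hasDerivAt_e_comp_pow d β ξ
  have hce := continuous_e
  have hparts := intervalIntegral.integral_mul_deriv_eq_deriv_mul (a := η) (b := 1)
    (u := h) (v := fun ξ : ℝ => e (β * ξ ^ d)) (u' := h')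
    (v' := fun ξ => e (β * ξ ^ d) * (2 * Real.pi * Complex.I * β * (d * (ξ : ℂ) ^ (d - 1))))
    hderiv (fun ξ _ => hE ξ) hcont.intervalIntegrable
    (by apply Continuous.intervalIntegrable; fun_prop)
  have hleft : ∫ ξ in η..1, h ξ *
      (e (β * ξ ^ d) * (2 * Real.pi * Complex.I * β * (d * (ξ : ℂ) ^ (d - 1)))) =
      ∫ ξ in η..1, e (β * ξ ^ d) := by
    refine intervalIntegral.integral_congr fun ξ hξ => ?_
    have h0 : (ξ : ℂ) ≠ 0 := by exact_mod_cast (hpos ξ hξ).ne'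
    have h1 : (2 * Real.pi * Complex.I * β * (d * (ξ : ℂ) ^ (d - 1))) = w * (ξ : ℂ) ^ (d - 1) := by
      rw [hw]; ring
    simp only [hh]
    rw [h1]; push_cast; field_simp
  rw [hleft] at hparts
  have hnorm : ∀ ξ : ℝ, 0 < ξ → ‖h ξ‖ = ‖w‖⁻¹ * (ξ ^ (d - 1))⁻¹ := by
    intro ξ hξ
    simp only [hh]
    rw [norm_mul, norm_inv, Complex.norm_real, Real.norm_of_nonneg (by positivity)]
  have hd1 : (0 : ℝ) ≤ (d : ℝ) - 1 := by
    have : (2 : ℝ) ≤ d := by exact_mod_cast hd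
    linarith
  have hint : ‖∫ ξ in η..1, h' ξ * e (β * ξ ^ d)‖ ≤ ‖w‖⁻¹ * ((η ^ (d - 1))⁻¹ - 1) := by
    have h1 : ∫ ξ in η..1, ‖w‖⁻¹ * (((d : ℝ) - 1) * (ξ ^ d)⁻¹) =
        ‖w‖⁻¹ * ((η ^ (d - 1))⁻¹ - 1) := by
      have h2 : ∀ ξ ∈ Set.uIcc η 1, HasDerivAt (fun ξ : ℝ => -(‖w‖⁻¹ * (ξ ^ (d - 1))⁻¹))
          (‖w‖⁻¹ * (((d : ℝ) - 1) * (ξ ^ d)⁻¹)) ξ := by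
        intro ξ hξ
        have h0 := (hpos ξ hξ).ne'
        exact (((hasDerivAt_inv_pow_pred hd h0).const_mul ‖w‖⁻¹).neg).congr_deriv (by ring)
      rw [intervalIntegral.integral_eq_sub_of_hasDerivAt h2]
      · simp; ring
      · apply ContinuousOn.intervalIntegrable
        refine continuousOn_const.mul (continuousOn_const.mul
          (ContinuousOn.inv₀ (by fun_prop) fun ξ hξ => ?_))
        exact pow_ne_zero _ (hpos ξ hξ).ne'
    rw [← h1]
    refine intervalIntegral.norm_integral_le_of_norm_le hη1 ?_ ?_
    · filter_upwards with ξ hξ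
      have hξ0 : 0 < ξ := hη.trans hξ.1
      rw [norm_mul, norm_e, mul_one]
      simp only [hh']
      rw [norm_neg, norm_mul, norm_inv, Complex.norm_real, Real.norm_of_nonneg (by positivity)]
    · apply ContinuousOn.intervalIntegrable
      refine continuousOn_const.mul (continuousOn_const.mul
        (ContinuousOn.inv₀ (by fun_prop) fun ξ hξ => ?_))
      exact pow_ne_zero _ (hpos ξ hξ).ne'
  rw [hparts]
  have h1 := hnorm 1 one_pos
  have h2 := hnorm η hη
  rw [one_pow, inv_one, mul_one] at h1
  calc ‖h 1 * e (β * 1 ^ d) - h η * e (β * η ^ d) - ∫ ξ in η..1, h' ξ * e (β * ξ ^ d)‖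
      ≤ ‖h 1 * e (β * 1 ^ d)‖ + ‖h η * e (β * η ^ d)‖ + ‖∫ ξ in η..1, h' ξ * e (β * ξ ^ d)‖ :=
        (norm_sub_le _ _).trans (add_le_add_left (norm_sub_le _ _) _)
    _ ≤ ‖w‖⁻¹ + ‖w‖⁻¹ * (η ^ (d - 1))⁻¹ + ‖w‖⁻¹ * ((η ^ (d - 1))⁻¹ - 1) := by
        rw [norm_mul (h 1), norm_mul (h η), norm_e, norm_e, mul_one, mul_one, h1, h2]
        gcongr
    _ = 1 / (|β| * η ^ (d - 1)) * (2 / (2 * Real.pi * d)) := by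
        have : |β| ≠ 0 := abs_ne_zero.2 hβ
        rw [hwn]; field_simp; ring
    _ ≤ _ := by
        refine mul_le_of_le_one_right (by positivity) ?_
        rw [div_le_one (by positivity)]
        have : (2 : ℝ) ≤ d := by exact_mod_cast hd
        nlinarith [Real.pi_gt_three]

/-- For |β| > 1 the integral is split at η = |β|^(-1/d), where the trivial bound η and the first
derivative bound 1/(|β| η^(d-1)) coincide. -/
lemma norm_I_le {d : ℕ} (hd : 2 ≤ d) (β : ℝ) : ‖I d β‖ ≤ 4 * (1 + ‖β‖) ^ (-(1 / d : ℝ)) := by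
  have hd0 : (0 : ℝ) < d := by positivity
  have hdinv : (1 : ℝ) / d ≤ 1 := by
    rw [div_le_one hd0]; exact_mod_cast (by omega : 1 ≤ d)
  have hdinv0 : (0 : ℝ) < 1 / d := by positivity
  have h2 : (2 : ℝ)⁻¹ ≤ (2 : ℝ) ^ (-(1 / d : ℝ)) := by
    rw [← Real.rpow_neg_one]
    exact Real.rpow_le_rpow_of_exponent_le (by norm_num) (by linarith)
  rw [Real.norm_eq_abs β]
  rcases le_or_gt |β| 1 with hβ | hβ
  · have h1 : (2 : ℝ) ^ (-(1 / d : ℝ)) ≤ (1 + |β|) ^ (-(1 / d : ℝ)) :=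
      Real.rpow_le_rpow_of_nonpos (by positivity) (by linarith) (by linarith)
    have := norm_I_le_one d β
    linarith
  · have hβ0 : 0 < |β| := by linarith
    set η : ℝ := |β| ^ (-(1 / d : ℝ)) with hη
    have hη0 : 0 < η := by positivity
    have hη1 : η ≤ 1 := Real.rpow_le_one_of_one_le_of_nonpos hβ.le (by linarith)
    have hηd : η ^ d = |β|⁻¹ := by
      rw [hη, ← Real.rpow_natCast, ← Real.rpow_mul hβ0.le, ← Real.rpow_neg_one]
      congr 1; field_simp
    have hce := continuous_e
    have hii : ∀ a b : ℝ, IntervalIntegrable (fun ξ : ℝ => e (β * ξ ^ d)) volume a b :=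
      fun a b => by apply Continuous.intervalIntegrable; fun_prop
    have hsplit : I d β = (∫ ξ in (0 : ℝ)..η, e (β * ξ ^ d)) + ∫ ξ in η..1, e (β * ξ ^ d) :=
      (intervalIntegral.integral_add_adjacent_intervals (hii _ _) (hii _ _)).symm
    have hA : ‖∫ ξ in (0 : ℝ)..η, e (β * ξ ^ d)‖ ≤ η := by
      have := intervalIntegral.norm_integral_le_of_norm_le_const (a := 0) (b := η) (C := 1)
        (f := fun ξ : ℝ => e (β * ξ ^ d)) fun x _ => (norm_e _).le
      simpa [abs_of_pos hη0] using this
    have hB := norm_integral_e_le hd (β := β) (abs_pos.1 hβ0) hη0 hη1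
    have hB' : 1 / (|β| * η ^ (d - 1)) = η := by
      have h3 : η ^ d = η ^ (d - 1) * η := by rw [← pow_succ]; congr 1; omega
      rw [div_eq_iff (by positivity)]
      have h4 : η * (|β| * η ^ (d - 1)) = |β| * η ^ d := by rw [h3]; ring
      rw [h4, hηd, mul_inv_cancel₀ hβ0.ne']
    rw [hB'] at hB
    have hη2 : η ≤ 2 * (1 + |β|) ^ (-(1 / d : ℝ)) := by
      have h3 : (2 * |β|) ^ (-(1 / d : ℝ)) ≤ (1 + |β|) ^ (-(1 / d : ℝ)) :=
        Real.rpow_le_rpow_of_nonpos (by positivity) (by linarith) (by linarith)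
      rw [Real.mul_rpow (by norm_num) hβ0.le] at h3
      have h4 : (2 : ℝ)⁻¹ * η ≤ 2 ^ (-(1 / d : ℝ)) * η := by gcongr
      linarith
    rw [hsplit]
    linarith [norm_add_le (∫ ξ in (0 : ℝ)..η, e (β * ξ ^ d)) (∫ ξ in η..1, e (β * ξ ^ d))]

lemma integrable_norm_I_pow {d T : ℕ} (hd : 2 ≤ d) (hT : d + 1 ≤ T) :
    Integrable fun β => ‖I d β‖ ^ T := by
  have hd0 : (0 : ℝ) < d := by positivity
  have hr : (Module.finrank ℝ ℝ : ℝ) < (T : ℝ) / d := by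
    rw [Module.finrank_self, Nat.cast_one, lt_div_iff₀ hd0, one_mul]
    exact_mod_cast (by omega : d < T)
  refine ((integrable_one_add_norm (μ := (volume : Measure ℝ)) hr).const_mul (4 ^ T)).mono'
    (((continuous_I d).norm.pow T).aestronglyMeasurable) ?_
  filter_upwards with β
  rw [norm_pow, norm_norm]
  refine (pow_le_pow_left₀ (norm_nonneg _) (norm_I_le hd β) T).trans (le_of_eq ?_)
  rw [mul_pow, ← Real.rpow_natCast ((1 + ‖β‖) ^ _), ← Real.rpow_mul (by positivity)]
  congr 2; ring

lemma integrable_comp_vecMul {ι : Type*} [Fintype ι] [DecidableEq ι] {B : Matrix ι ι ℝ}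
    (hB : B.det ≠ 0) {g : (ι → ℝ) → ℝ} (hg : Integrable g) :
    Integrable fun γ => g (γ ᵥ* B) := by
  have hdet : Bᵀ.det ≠ 0 := by rwa [Matrix.det_transpose]
  have hmap := Real.map_matrix_volume_pi_eq_smul_volume_pi hdet
  have h1 : Integrable g (Measure.map (Matrix.toLin' Bᵀ) volume) := by
    rw [hmap]
    exact hg.smul_measure ENNReal.ofReal_ne_top
  have hcont : Continuous (Matrix.toLin' Bᵀ) := LinearMap.continuous_of_finiteDimensional _
  have h2 := h1.comp_aemeasurable hcont.aemeasurable
  refine h2.congr ?_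
  filter_upwards with γ
  simp [Matrix.toLin'_apply, Matrix.mulVec_transpose]

variable {n d T : ℕ}

lemma continuous_singularIntegrand (n d μ : ℕ) (X : ℝ) :
    Continuous (singularIntegrand n d μ X) := by
  have h1 := continuous_I d
  have h2 := continuous_e
  unfold singularIntegrand dotProduct
  fun_prop

/-- The singular integral converges absolutely. -/
theorem integrable_singularIntegrand [NeZero T] (hd : 2 ≤ d) (hT : d + 1 ≤ T)
    (j : Fin T → Eqn n → Fin n × Fin n)
    (hj : Function.Injective fun x : Fin T × Eqn n => j x.1 x.2)
    (hdet : ∀ t, cellsDet n (j t) ≠ 0) (μ : ℕ) (X : ℝ) :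
    Integrable (singularIntegrand n d μ X) := by
  have hg : Integrable fun b : Eqn n → ℝ => ∏ r, ‖I d (b r)‖ ^ T :=
    Integrable.fintype_prod (f := fun _ β => ‖I d β‖ ^ T) fun _ => integrable_norm_I_pow hd hT
  -- The dominating function: in each block the linear forms are new variables, and the T-th powers
  -- of |I| are integrable as T/d > 1.
  have hsum : Integrable fun γ : Eqn n → ℝ =>
      ∑ t, ∏ r, ‖I d ((γ ᵥ* (magicMatrix ℝ n).submatrix id (j t)) r)‖ ^ T := by
    refine integrable_finsetSum _ fun t _ => ?_
    refine integrable_comp_vecMul ?_ hg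
    rw [det_submatrix_eq]
    exact_mod_cast hdet t
  refine hsum.mono' (continuous_singularIntegrand n d μ X).aestronglyMeasurable ?_
  filter_upwards with γ
  rw [singularIntegrand, norm_mul, norm_e, mul_one, norm_prod]
  have := prod_le_sum_pow j hj (fun c => ‖I d (γ ⬝ᵥ (magicMatrix ℝ n).col c)‖)
    (fun _ => norm_nonneg _) fun _ => norm_I_le_one _ _
  rw [Fintype.card_fin] at this
  exact this

end MagicSquare

/-! ### Positivity of the singular integral -/

namespace MagicSquare
open Finset MeasureTheory Filter Topology

variable {n d T : ℕ}

/-- The linear map that replaces the coordinates at the cells of `i` by the values of the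
equations. -/
noncomputable def cellsMap (n : ℕ) (i : Eqn n → Fin n × Fin n) (hi : Function.Injective i) :
    (Fin n × Fin n → ℝ) →ₗ[ℝ] (Fin n × Fin n → ℝ) where
  toFun y := Function.extend i (magicMatrix ℝ n *ᵥ y) y
  map_add' y z := by
    funext c
    by_cases h : ∃ r, i r = c
    · obtain ⟨r, rfl⟩ := h
      simp [hi.extend_apply, Matrix.mulVec_add]
    · simp [Function.extend_apply' _ _ _ h]
  map_smul' a y := by
    funext c
    by_cases h : ∃ r, i r = c
    · obtain ⟨r, rfl⟩ := h
      simp [hi.extend_apply, Matrix.mulVec_smul]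
    · simp [Function.extend_apply' _ _ _ h]

lemma cellsMap_apply_cell (i : Eqn n → Fin n × Fin n) (hi : Function.Injective i)
    (y : Fin n × Fin n → ℝ) (r : Eqn n) :
    cellsMap n i hi y (i r) = ∑ c, magicMatrix ℝ n r c * y c :=
  hi.extend_apply _ _ r

/-- A vector in the kernel vanishes outside the block, and the block minor is invertible. -/
lemma cellsMap_injective (i : Eqn n → Fin n × Fin n) (hi : Function.Injective i)
    (hdet : cellsDet n i ≠ 0) : Function.Injective (cellsMap n i hi) := by
  classical
  rw [injective_iff_map_eq_zero]
  intro y hy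
  have hoff : ∀ c, (¬ ∃ r, i r = c) → y c = 0 := by
    intro c hc
    have := congrFun hy c
    rwa [cellsMap, LinearMap.coe_mk, AddHom.coe_mk, Function.extend_apply' _ _ _ hc] at this
  have hz : (magicMatrix ℝ n).submatrix id i *ᵥ (fun r => y (i r)) = 0 := by
    funext r
    have h1 := congrFun hy (i r)
    rw [cellsMap_apply_cell] at h1
    rw [Pi.zero_apply] at h1 ⊢
    rw [← h1, Matrix.mulVec, dotProduct]
    rw [← sum_subset (subset_univ (univ.image i)), sum_image fun a _ b _ h => hi h]
    · rfl
    · intro c _ hc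
      rw [hoff c (by simpa using hc), mul_zero]
  have hdet' : ((magicMatrix ℝ n).submatrix id i).det ≠ 0 := by
    rw [det_submatrix_eq]; exact_mod_cast hdet
  have hcell := Matrix.eq_zero_of_mulVec_eq_zero hdet' hz
  funext c
  by_cases hc : ∃ r, i r = c
  · obtain ⟨r, rfl⟩ := hc
    exact congrFun hcell r
  · exact hoff c hc

/-- The part of the unit cube where the equations with line sum `n * y₀` hold up to `η`. -/
def nearSolutions (n d : ℕ) (y₀ η : ℝ) : Set (Fin n × Fin n → ℝ) :=
  {ξ | (∀ c, ξ c ∈ Set.Ioc (0 : ℝ) 1) ∧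
    ∀ r, |∑ c, magicMatrix ℝ n r c * ξ c ^ d - n * y₀| ≤ η}

lemma volume_nearSolutions_lt_top (y₀ η : ℝ) : volume (nearSolutions n d y₀ η) < ⊤ := by
  refine (measure_mono (t := Set.Icc (0 : Fin n × Fin n → ℝ) 1) fun ξ hξ => ?_).trans_lt
    isCompact_Icc.measure_lt_top
  exact ⟨fun c => (hξ.1 c).1.le, fun c => (hξ.1 c).2⟩

/-- In the coordinates `cellsMap` applied to d-th powers, the near-solutions cover a box of side 2η
in the block directions and of fixed side in the others. Since the change of coordinates is
Lipschitz, its source cannot have much smaller volume than the box. -/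
lemma exists_le_volume_nearSolutions (hd : d ≠ 0) (i : Eqn n → Fin n × Fin n)
    (hi : Function.Injective i) (hdet : cellsDet n i ≠ 0) {κ : ℝ} (hκ : 0 < κ) :
    ∃ c : ℝ, 0 < c ∧ ∃ η₀ : ℝ, 0 < η₀ ∧ ∀ y₀, κ ≤ y₀ → y₀ ≤ 1 - κ → ∀ η, 0 < η → η ≤ η₀ →
      c * η ^ Fintype.card (Eqn n) ≤ volume.real (nearSolutions n d y₀ η) := by
  classical
  set H := cellsMap n i hi with hH
  set E := LinearEquiv.ofInjectiveEndo H (cellsMap_injective i hi hdet) with hE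
  have hEH : ∀ y, E y = H y := fun y => rfl
  set Hc := LinearMap.toContinuousLinearMap H with hHc
  set Ec := LinearMap.toContinuousLinearMap E.symm.toLinearMap with hEc
  set K : ℝ := ‖Ec‖ + 1 with hK
  have hK0 : 0 < K := by positivity
  have hEb : ∀ z, ‖E.symm z‖ ≤ K * ‖z‖ := fun z =>
    (Ec.le_opNorm z).trans (by gcongr; rw [hK]; linarith)
  -- K bounds the inverse linear map, so points within θ of the centre pull back to within κ/2 of
  -- the constant y₀, hence into (0, 1), where d-th roots exist.
  set θ : ℝ := κ / (2 * K) with hθ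
  have hθ0 : 0 < θ := by positivity
  set L : NNReal := (‖Hc‖₊ + 1) * d with hL
  have hL0 : 0 < (L : ℝ) := by
    rw [hL]; push_cast; positivity
  set k := Fintype.card (Eqn n) with hk
  set N := Fintype.card (Fin n × Fin n) with hN
  set S : Finset (Fin n × Fin n) := univ.image i with hS
  have hSk : #S = k := by rw [hS, card_image_of_injective _ hi, card_univ]
  refine ⟨(∏ _c ∈ S, (2 : ℝ)) * (∏ _c ∈ Sᶜ, (2 * θ)) / (L : ℝ) ^ N, by positivity, θ, hθ0, ?_⟩
  intro y₀ hy₀ hy₀' η hη hηθ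
  set a := H (fun _ => y₀) with ha
  set w : Fin n × Fin n → ℝ := fun c => if c ∈ S then η else θ with hw
  have hw0 : ∀ c, 0 ≤ w c := fun c => by simp only [hw]; split_ifs <;> linarith
  have hwθ : ∀ c, w c ≤ θ := fun c => by simp only [hw]; split_ifs <;> linarith
  set G : (Fin n × Fin n → ℝ) → (Fin n × Fin n → ℝ) := fun ξ => H (fun c => ξ c ^ d) with hG
  have hsub : Set.Icc (a - w) (a + w) ⊆ G '' nearSolutions n d y₀ η := by
    intro z hz
    have hza : ∀ c, |z c - a c| ≤ w c := fun c => abs_le.2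
      ⟨by have := hz.1 c; simp only [Pi.sub_apply] at this; linarith,
        by have := hz.2 c; simp only [Pi.add_apply] at this; linarith⟩
    set y := E.symm z with hy
    have hHy : H y = z := by rw [← hEH, hy, E.apply_symm_apply]
    have hnear : ∀ c, |y c - y₀| < κ := by
      intro c
      have h1 : y - (fun _ => y₀) = E.symm (z - a) := by
        rw [map_sub, ← hy, ha, ← hEH, E.symm_apply_apply]
      have h2 : ‖y - (fun _ => y₀)‖ ≤ K * θ := by
        rw [h1]
        refine (hEb _).trans ?_
        gcongr
        rw [pi_norm_le_iff_of_nonneg hθ0.le]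
        exact fun c => (hza c).trans (hwθ c)
      have h3 := norm_le_pi_norm (y - (fun _ => y₀)) c
      have h4 : K * θ = κ / 2 := by rw [hθ]; field_simp
      rw [Pi.sub_apply, Real.norm_eq_abs] at h3
      linarith
    have hy0 : ∀ c, 0 < y c := fun c => by have := (abs_lt.1 (hnear c)).1; linarith
    have hy1 : ∀ c, y c < 1 := fun c => by have := (abs_lt.1 (hnear c)).2; linarith
    have hroot : ∀ c, (y c ^ ((d : ℝ)⁻¹)) ^ d = y c := fun c =>
      Real.rpow_inv_natCast_pow (hy0 c).le hd
    refine ⟨fun c => y c ^ ((d : ℝ)⁻¹), ⟨fun c => ⟨Real.rpow_pos_of_pos (hy0 c) _,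
      Real.rpow_le_one (hy0 c).le (hy1 c).le (by positivity)⟩, fun r => ?_⟩, ?_⟩
    · simp_rw [hroot]
      have h1 := hza (i r)
      rw [← hHy, hH, cellsMap_apply_cell, ha, cellsMap_apply_cell, ← sum_mul, sum_magicMatrix] at h1
      refine h1.trans (le_of_eq ?_)
      exact if_pos (hS ▸ mem_image_of_mem i (mem_univ r))
    · simp only [hG]
      simp_rw [hroot]
      exact hHy
  have hLip : LipschitzOnWith L G (nearSolutions n d y₀ η) := by
    refine LipschitzOnWith.of_dist_le_mul fun ξ hξ ξ' hξ' => ?_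
    rw [dist_eq_norm, dist_eq_norm]
    simp only [hG]
    rw [← map_sub]
    have h1 : ‖(fun c => ξ c ^ d) - fun c => ξ' c ^ d‖ ≤ d * ‖ξ - ξ'‖ := by
      rw [pi_norm_le_iff_of_nonneg (by positivity)]
      intro c
      rw [Pi.sub_apply, Real.norm_eq_abs]
      have h2 := abs_pow_sub_pow_le (ξ c) (ξ' c) d
      have h3 : max |ξ c| |ξ' c| ^ (d - 1) ≤ 1 := by
        refine pow_le_one₀ (by positivity) (max_le ?_ ?_)
        · rw [abs_of_pos (hξ.1 c).1]; exact (hξ.1 c).2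
        · rw [abs_of_pos (hξ'.1 c).1]; exact (hξ'.1 c).2
      have h4 := norm_le_pi_norm (ξ - ξ') c
      rw [Pi.sub_apply, Real.norm_eq_abs] at h4
      calc |ξ c ^ d - ξ' c ^ d| ≤ |ξ c - ξ' c| * d * max |ξ c| |ξ' c| ^ (d - 1) := h2
        _ ≤ |ξ c - ξ' c| * d * 1 := by gcongr
        _ ≤ d * ‖ξ - ξ'‖ := by rw [mul_one, mul_comm]; gcongr
    calc ‖H ((fun c => ξ c ^ d) - fun c => ξ' c ^ d)‖
        ≤ ‖Hc‖ * ‖(fun c => ξ c ^ d) - fun c => ξ' c ^ d‖ := Hc.le_opNorm _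
      _ ≤ (‖Hc‖ + 1) * (d * ‖ξ - ξ'‖) := by gcongr; linarith
      _ = _ := by rw [hL]; push_cast; ring
  -- Lebesgue measure is the Hausdorff measure of full dimension N, which an L-Lipschitz map
  -- multiplies by at most L^N; no Jacobian is needed.
  have hvol : volume (Set.Icc (a - w) (a + w)) ≤
      (L : ENNReal) ^ N * volume (nearSolutions n d y₀ η) := by
    refine (measure_mono hsub).trans ?_
    have h1 := hLip.hausdorffMeasure_image_le (d := (Fintype.card (Fin n × Fin n) : ℝ))
      (by positivity)
    rw [hausdorffMeasure_pi_real, ENNReal.rpow_natCast] at h1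
    exact h1
  have hvol' := ENNReal.toReal_mono (ENNReal.mul_ne_top (by finiteness)
    (volume_nearSolutions_lt_top y₀ η).ne) hvol
  rw [ENNReal.toReal_mul, ENNReal.toReal_pow, ENNReal.coe_toReal,
    Real.volume_Icc_pi_toReal (by intro c; simp only [Pi.sub_apply, Pi.add_apply]; linarith [hw0 c])] at hvol'
  have hprod : ∏ c, ((a + w) c - (a - w) c) = (∏ _c ∈ S, (2 : ℝ)) * η ^ k * ∏ _c ∈ Sᶜ, (2 * θ) := by
    rw [← prod_mul_prod_compl S]
    congr 1
    · rw [← hSk, ← prod_const, ← prod_mul_distrib]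
      refine prod_congr rfl fun c hc => ?_
      simp only [Pi.add_apply, Pi.sub_apply, hw, if_pos hc]; ring
    · refine prod_congr rfl fun c hc => ?_
      rw [mem_compl] at hc
      simp only [Pi.add_apply, Pi.sub_apply, hw, if_neg hc]; ring
  rw [hprod] at hvol'
  rw [div_mul_eq_mul_div, div_le_iff₀ (by positivity), measureReal_def]
  calc _ = (∏ _c ∈ S, (2 : ℝ)) * η ^ k * ∏ _c ∈ Sᶜ, (2 * θ) := by ring
    _ ≤ _ := hvol'
    _ = _ := by ring

/-- The uniform measure on the unit cube of cells. -/
noncomputable def cubeMeasure (n : ℕ) : Measure (Fin n × Fin n → ℝ) :=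
  Measure.pi fun _ => (volume : Measure ℝ).restrict (Set.Ioc 0 1)

instance (n : ℕ) : IsProbabilityMeasure (cubeMeasure n) := by
  have : IsProbabilityMeasure ((volume : Measure ℝ).restrict (Set.Ioc 0 1)) := ⟨by simp⟩
  unfold cubeMeasure; infer_instance

/-- The defect of the equations at a point of the unit cube. -/
noncomputable def defect (n d : ℕ) (ρ : ℝ) (ξ : Fin n × Fin n → ℝ) (r : Eqn n) : ℝ :=
  ∑ c, magicMatrix ℝ n r c * ξ c ^ d - ρ

lemma continuous_defect (n d : ℕ) (ρ : ℝ) (r : Eqn n) :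
    Continuous fun ξ : Fin n × Fin n → ℝ => defect n d ρ ξ r := by
  unfold defect; fun_prop

/-- By Fubini, the integrand is the characteristic function of the vector of defects at a uniform
random point of the cube. -/
lemma singularIntegrand_eq_integral (n d μ : ℕ) (X : ℝ) (γ : Eqn n → ℝ) :
    singularIntegrand n d μ X γ =
      ∫ ξ, e (∑ r, γ r * defect n d (μ / X ^ d) ξ r) ∂cubeMeasure n := by
  have h1 : ∀ β, I d β = ∫ ξ, e (β * ξ ^ d) ∂((volume : Measure ℝ).restrict (Set.Ioc 0 1)) :=
    fun β => intervalIntegral.integral_of_le zero_le_one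
  rw [singularIntegrand]
  simp_rw [h1]
  rw [← integral_fintype_prod_eq_prod (𝕜 := ℂ)
    (f := fun c ξ => e (γ ⬝ᵥ (magicMatrix ℝ n).col c * ξ ^ d)), ← integral_mul_const]
  refine integral_congr_ae (Eventually.of_forall fun ξ => ?_)
  simp only
  rw [← e_sum, ← e_add]
  congr 1
  simp only [defect, mul_sub, sum_sub_distrib, mul_sum, dotProduct, Matrix.col, sum_mul]
  rw [sum_comm, sub_eq_add_neg]
  congr 1
  · exact sum_congr rfl fun r _ => sum_congr rfl fun c _ => by rw [Matrix.transpose_apply]; ring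
  · rw [neg_inj]
    exact sum_congr rfl fun r _ => mul_comm _ _

lemma integral_e_mul_gaussian (L : ℝ) {η : ℝ} (hη : 0 < η) :
    ∫ t : ℝ, e (t * L) * (Real.exp (-(Real.pi * η ^ 2) * t ^ 2) : ℂ) =
      ((η⁻¹ * Real.exp (-(Real.pi * L ^ 2 / η ^ 2)) : ℝ) : ℂ) := by
  have hb : 0 < (((Real.pi * η ^ 2 : ℝ) : ℂ)).re := by
    rw [Complex.ofReal_re]; positivity
  have h := fourierIntegral_gaussian hb (2 * Real.pi * L)
  have h1 : ∀ t : ℝ, e (t * L) * (Real.exp (-(Real.pi * η ^ 2) * t ^ 2) : ℂ) =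
      Complex.exp (Complex.I * (2 * Real.pi * L) * t) *
        Complex.exp (-((Real.pi * η ^ 2 : ℝ) : ℂ) * t ^ 2) := by
    intro t
    rw [e]
    push_cast
    congr 2; ring
  simp_rw [h1]
  rw [h]
  have hπ := Real.pi_ne_zero
  have h2 : (Real.pi / ((Real.pi * η ^ 2 : ℝ) : ℂ)) ^ (1 / 2 : ℂ) = ((η⁻¹ : ℝ) : ℂ) := by
    have h3 : (Real.pi / ((Real.pi * η ^ 2 : ℝ) : ℂ)) = (((η⁻¹) ^ 2 : ℝ) : ℂ) := by
      have : (Real.pi : ℂ) ≠ 0 := by exact_mod_cast hπ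
      have : (η : ℂ) ≠ 0 := by exact_mod_cast hη.ne'
      push_cast; field_simp
    rw [h3]
    have h4 : (1 / 2 : ℂ) = ((1 / 2 : ℝ) : ℂ) := by push_cast; rfl
    rw [h4, ← Complex.ofReal_cpow (by positivity), ← Real.sqrt_eq_rpow,
      Real.sqrt_sq (by positivity)]
  rw [h2]
  push_cast
  congr 2
  have : (Real.pi : ℂ) ≠ 0 := by exact_mod_cast hπ
  have : (η : ℂ) ≠ 0 := by exact_mod_cast hη.ne'
  field_simp
  ring

/-- The Gaussian kernel of width `η` in the defects. -/
noncomputable def gaussKernel (n d : ℕ) (ρ η : ℝ) (ξ : Fin n × Fin n → ℝ) : ℝ :=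
  ∏ r, (η⁻¹ * Real.exp (-(Real.pi * defect n d ρ ξ r ^ 2 / η ^ 2)))

/-- The Gaussian damping factor. -/
noncomputable def gaussDamp (n : ℕ) (η : ℝ) (γ : Eqn n → ℝ) : ℝ :=
  ∏ r, Real.exp (-(Real.pi * η ^ 2) * γ r ^ 2)

lemma gaussDamp_nonneg (η : ℝ) (γ : Eqn n → ℝ) : 0 ≤ gaussDamp n η γ :=
  prod_nonneg fun _ _ => (Real.exp_pos _).le

lemma gaussDamp_le_one (η : ℝ) (γ : Eqn n → ℝ) : gaussDamp n η γ ≤ 1 := by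
  refine prod_le_one (fun _ _ => (Real.exp_pos _).le) fun r _ => ?_
  rw [Real.exp_le_one_iff]
  have := Real.pi_pos
  have : 0 ≤ Real.pi * η ^ 2 * γ r ^ 2 := by positivity
  linarith

lemma continuous_gaussDamp (n : ℕ) (η : ℝ) : Continuous (gaussDamp n η) := by
  unfold gaussDamp; fun_prop

lemma integrable_gaussDamp {η : ℝ} (hη : 0 < η) : Integrable (gaussDamp n η) := by
  have : 0 < Real.pi * η ^ 2 := by have := Real.pi_pos; positivity
  exact Integrable.fintype_prod (f := fun _ t => Real.exp (-(Real.pi * η ^ 2) * t ^ 2))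
    fun _ => integrable_exp_neg_mul_sq this

/-- The damping makes the double integral absolutely convergent, so the order can be exchanged; the
inner integral is then a Fourier transform of a Gaussian, which is positive. -/
lemma integral_singularIntegrand_mul_gaussDamp (n d μ : ℕ) (X : ℝ) {η : ℝ} (hη : 0 < η) :
    ∫ γ, singularIntegrand n d μ X γ * (gaussDamp n η γ : ℂ) =
      ((∫ ξ, gaussKernel n d (μ / X ^ d) η ξ ∂cubeMeasure n : ℝ) : ℂ) := by
  set ρ := (μ : ℝ) / X ^ d with hρ
  have hcd := continuous_defect n d ρ
  have hce := continuous_e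
  have hcg := continuous_gaussDamp n η
  simp_rw [singularIntegrand_eq_integral, ← integral_mul_const]
  rw [integral_integral_swap, ← integral_complex_ofReal]
  · refine integral_congr_ae (Eventually.of_forall fun ξ => ?_)
    simp only
    rw [gaussKernel]
    push_cast
    have h1 := fun r => integral_e_mul_gaussian (defect n d ρ ξ r) hη
    push_cast at h1
    simp_rw [← h1]
    rw [← integral_fintype_prod_volume_eq_prod (𝕜 := ℂ) (f := fun r t => e (t * defect n d ρ ξ r) *
      Complex.exp (-(Real.pi * η ^ 2) * t ^ 2))]
    refine integral_congr_ae (Eventually.of_forall fun γ => ?_)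
    simp only [gaussDamp]
    rw [e_sum, prod_mul_distrib]
    push_cast
    rfl
  · have hint : Integrable (fun x : (Eqn n → ℝ) × (Fin n × Fin n → ℝ) => gaussDamp n η x.1)
        (volume.prod (cubeMeasure n)) := (integrable_gaussDamp hη).comp_fst (cubeMeasure n)
    refine hint.mono' ?_ ?_
    · apply Continuous.aestronglyMeasurable
      unfold Function.uncurry
      refine Continuous.mul (hce.comp ?_) (Complex.continuous_ofReal.comp (hcg.comp continuous_fst))
      exact continuous_finsetSum _ fun r _ => ((continuous_apply r).comp continuous_fst).mul
        ((hcd r).comp continuous_snd)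
    · filter_upwards with x
      simp only [Function.uncurry]
      rw [norm_mul, norm_e, one_mul, Complex.norm_real, Real.norm_of_nonneg (gaussDamp_nonneg _ _)]

/-- On the near-solutions of tolerance η the kernel is at least (e^(-π)/η)^(2n+1). By Markov's
inequality the powers of η cancel against the volume, and the bound is uniform in η. -/
lemma le_integral_gaussKernel {y₀ η c : ℝ} (hη : 0 < η)
    (h : c * η ^ Fintype.card (Eqn n) ≤ volume.real (nearSolutions n d y₀ η)) :
    c * Real.exp (-Real.pi) ^ Fintype.card (Eqn n) ≤
      ∫ ξ, gaussKernel n d (n * y₀) η ξ ∂cubeMeasure n := by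
  set k := Fintype.card (Eqn n) with hk
  set ε : ℝ := (η⁻¹ * Real.exp (-Real.pi)) ^ k with hε
  have hcd := continuous_defect n d (n * y₀)
  have hnn : ∀ ξ, 0 ≤ gaussKernel n d (n * y₀) η ξ := fun ξ => prod_nonneg fun r _ => by positivity
  have hcont : Continuous (gaussKernel n d (n * y₀) η) := by
    unfold gaussKernel; fun_prop
  have hint : Integrable (gaussKernel n d (n * y₀) η) (cubeMeasure n) := by
    refine (integrable_const ((η⁻¹) ^ k)).mono' hcont.aestronglyMeasurable ?_
    filter_upwards with ξ
    rw [Real.norm_of_nonneg (hnn ξ), gaussKernel, hk, ← card_univ, ← prod_const]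
    refine prod_le_prod (fun r _ => by positivity) fun r _ => ?_
    refine mul_le_of_le_one_right (by positivity) ?_
    rw [Real.exp_le_one_iff, neg_nonpos]
    have := Real.pi_pos
    positivity
  have hsub : nearSolutions n d y₀ η ⊆
      {ξ | ε ≤ gaussKernel n d (n * y₀) η ξ} ∩ Set.univ.pi fun _ => Set.Ioc 0 1 := by
    intro ξ hξ
    refine ⟨?_, fun c _ => hξ.1 c⟩
    simp only [Set.mem_ofPred_eq]
    rw [gaussKernel, hε, hk, ← card_univ, ← prod_const]
    refine prod_le_prod (fun r _ => by positivity) fun r _ => ?_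
    refine mul_le_mul_of_nonneg_left (Real.exp_le_exp.2 ?_) (by positivity)
    have h1 : defect n d (n * y₀) ξ r ^ 2 ≤ η ^ 2 := by
      rw [← sq_abs]
      exact pow_le_pow_left₀ (abs_nonneg _) (hξ.2 r) 2
    rw [neg_le_neg_iff, div_le_iff₀ (by positivity)]
    exact mul_le_mul_of_nonneg_left h1 Real.pi_pos.le
  have hmeas : volume.real (nearSolutions n d y₀ η) ≤
      (cubeMeasure n).real {ξ | ε ≤ gaussKernel n d (n * y₀) η ξ} := by
    have hcube : cubeMeasure n = volume.restrict (Set.univ.pi fun _ => Set.Ioc (0 : ℝ) 1) := by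
      rw [cubeMeasure, volume_pi, Measure.restrict_pi_pi]
    refine ENNReal.toReal_mono (measure_ne_top _ _) ?_
    have hm : MeasurableSet {ξ | ε ≤ gaussKernel n d (n * y₀) η ξ} :=
      measurableSet_le measurable_const hcont.measurable
    rw [hcube, Measure.restrict_apply hm]
    exact measure_mono hsub
  have hmarkov := mul_meas_ge_le_integral_of_nonneg
    (Eventually.of_forall hnn) hint ε
  refine le_trans ?_ hmarkov
  have hε0 : 0 ≤ ε := by positivity
  refine le_trans ?_ (mul_le_mul_of_nonneg_left (h.trans hmeas) hε0)
  rw [hε, mul_pow, inv_pow]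
  refine le_of_eq ?_
  field_simp

/-- The singular integral is real and bounded below by a positive constant. -/
theorem exists_le_singularIntegral [NeZero T] (hd : 2 ≤ d) (hT : d + 1 ≤ T)
    (j : Fin T → Eqn n → Fin n × Fin n)
    (hj : Function.Injective fun x : Fin T × Eqn n => j x.1 x.2)
    (hdet : ∀ t, cellsDet n (j t) ≠ 0) {κ : ℝ} (hκ : 0 < κ) :
    ∃ c : ℝ, 0 < c ∧ ∀ (μ : ℕ) (X y₀ : ℝ), κ ≤ y₀ → y₀ ≤ 1 - κ → (μ : ℝ) / X ^ d = n * y₀ →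
      ∃ x : ℝ, c ≤ x ∧ singularIntegral n d μ X = x := by
  have hi : Function.Injective (j 0) := fun a b hab =>
    (Prod.mk.inj (hj (a₁ := (0, a)) (a₂ := (0, b)) hab)).2
  obtain ⟨c, hc, η₀, hη₀, hvol⟩ := exists_le_volume_nearSolutions (d := d) (by omega) (j 0) hi
    (hdet 0) hκ
  refine ⟨c * Real.exp (-Real.pi) ^ Fintype.card (Eqn n), by positivity, ?_⟩
  intro μ X y₀ hy₀ hy₀' hρ
  have hF := integrable_singularIntegrand hd hT j hj hdet μ X
  set η : ℕ → ℝ := fun m => η₀ * (1 / ((m : ℝ) + 1)) with hη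
  have hηpos : ∀ m, 0 < η m := fun m => by simp only [hη]; positivity
  have hηle : ∀ m, η m ≤ η₀ := fun m => by
    simp only [hη]
    refine mul_le_of_le_one_right hη₀.le ?_
    rw [div_le_one (by positivity)]
    linarith [(Nat.cast_nonneg m : (0 : ℝ) ≤ m)]
  have hη0 : Tendsto η atTop (𝓝 0) := by
    rw [hη, ← mul_zero η₀]
    exact tendsto_one_div_add_atTop_nhds_zero_nat.const_mul η₀
  -- The damping is removed by dominated convergence, so 𝔍 is a limit of real numbers that are
  -- uniformly bounded below.
  have hlim : Tendsto (fun m => ∫ γ, singularIntegrand n d μ X γ * (gaussDamp n (η m) γ : ℂ))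
      atTop (𝓝 (∫ γ, singularIntegrand n d μ X γ)) := by
    refine tendsto_integral_of_dominated_convergence (fun γ => ‖singularIntegrand n d μ X γ‖)
      (fun m => ?_) hF.norm (fun m => ?_) ?_
    · exact ((continuous_singularIntegrand n d μ X).mul
        (Complex.continuous_ofReal.comp (continuous_gaussDamp n (η m)))).aestronglyMeasurable
    · filter_upwards with γ
      rw [norm_mul, Complex.norm_real, Real.norm_of_nonneg (gaussDamp_nonneg _ _)]
      exact mul_le_of_le_one_right (norm_nonneg _) (gaussDamp_le_one _ _)
    · filter_upwards with γ
      have h1 : Tendsto (fun m => gaussDamp n (η m) γ) atTop (𝓝 1) := by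
        have hcont : Continuous fun x : ℝ => gaussDamp n x γ := by unfold gaussDamp; fun_prop
        have := (hcont.tendsto 0).comp hη0
        have h0 : gaussDamp n 0 γ = 1 := by simp [gaussDamp]
        rwa [h0] at this
      have h2 := ((Complex.continuous_ofReal.tendsto _).comp h1).const_mul
        (singularIntegrand n d μ X γ)
      simpa using h2
  simp_rw [integral_singularIntegrand_mul_gaussDamp n d μ X (hηpos _), hρ] at hlim
  have hre := (Complex.continuous_re.tendsto _).comp hlim
  have hrr := (Complex.continuous_ofReal.tendsto _).comp hre
  refine ⟨(∫ γ, singularIntegrand n d μ X γ).re, ?_, tendsto_nhds_unique hlim hrr⟩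
  refine ge_of_tendsto hre (Eventually.of_forall fun m => ?_)
  exact le_integral_gaussKernel (hηpos m) (hvol y₀ hy₀ hy₀' (η m) (hηpos m) (hηle m))

end MagicSquare

/-! ### Disjoint bases, choice of the prime, conclusion -/

namespace MagicSquare
open Finset

lemma card_eqn {n : ℕ} (hn : n ≠ 0) : Fintype.card (Eqn n) = 2 * n + 1 := by
  simp only [Eqn, Fintype.card_sum, Fintype.card_fin]
  omega

lemma hasDisjointBases_psi (n : ℕ) : HasDisjointBases n (Psi n) :=
  Nat.sSup_mem (s := {T | HasDisjointBases n T})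
    ⟨0, fun t => t.elim0, fun t => t.elim0, fun t => t.elim0⟩ (bddAbove_hasDisjointBases n)

/-- A square of side `n` with `T` disjoint bases of columns satisfies `T * (2 * n + 1) ≤ n ^ 2`. -/
lemma HasDisjointBases.mul_le {n T : ℕ} (h : HasDisjointBases n T) :
    T * (2 * n + 1) ≤ n * n := by
  obtain ⟨D, hD, hdis⟩ := h
  have h1 : (univ.biUnion D).card = ∑ t, (D t).card :=
    card_biUnion fun s _ t _ hst => hdis s t hst
  have h2 : (univ.biUnion D).card ≤ n * n := by
    simpa using card_le_univ (univ.biUnion D)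
  have h3 : ∑ t, (D t).card = T * (2 * n + 1) := by
    simp [fun t => (hD t).1]
  omega

/-- With T ≥ d + 1 and d ≥ 2 this yields n ≥ 2d + 3 ≥ 7, the size required by the weight bound and
its application. -/
lemma HasDisjointBases.two_mul_lt {n T : ℕ} (h : HasDisjointBases n T) (hT : T ≠ 0) :
    2 * T < n := by
  have := h.mul_le
  have : 0 < T := Nat.pos_of_ne_zero hT
  by_contra! hn
  nlinarith

lemma HasDisjointBases.exists_cellsDet_ne_zero {n T : ℕ} (hn : n ≠ 0)
    (h : HasDisjointBases n T) :
    ∃ j : Fin T → Eqn n → Fin n × Fin n,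
      (Function.Injective fun x : Fin T × Eqn n => j x.1 x.2) ∧ ∀ t, cellsDet n (j t) ≠ 0 := by
  classical
  obtain ⟨D, hD, hdis⟩ := h
  have hcard : ∀ t, Fintype.card (Eqn n) = Fintype.card (D t) := fun t => by
    rw [card_eqn hn, Fintype.card_coe, (hD t).1]
  let f : ∀ t, Eqn n ≃ D t := fun t => Fintype.equivOfCardEq (hcard t)
  refine ⟨fun t r => (f t r : Fin n × Fin n), ?_, fun t => ?_⟩
  · rintro ⟨s, r⟩ ⟨t, r'⟩ hst
    simp only at hst
    have : s = t := by
      by_contra hne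
      exact disjoint_left.1 (hdis s t hne) (f s r).2 (hst ▸ (f t r').2)
    subst this
    rw [(f s).injective (Subtype.ext hst)]
  · have hli := (hD t).2.comp (f t) (f t).injective
    have hli' : LinearIndependent ℝ
        ((magicMatrix ℝ n).submatrix id fun r => (f t r : Fin n × Fin n)).col := hli
    rw [Matrix.linearIndependent_cols_iff_isUnit, Matrix.isUnit_iff_isUnit_det,
      det_submatrix_eq] at hli'
    exact_mod_cast hli'.ne_zero

/-- A prime in the middle half of `[0, X]`, as large as we please. -/
lemma exists_prime_mem_middle (P : ℕ) {X : ℝ} (hX : 9 ≤ X) (hP : 4 * P ≤ X) :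
    ∃ p : ℕ, p.Prime ∧ P ≤ p ∧ 1 / 4 * X < p ∧ (p : ℝ) < (1 - 1 / 4) * X := by
  have h4 : 0 ≤ X / 4 := by linarith
  -- Bertrand's postulate: p ≤ 2⌈X/4⌉ < X/2 + 2, which is below 3X/4 as X > 8.
  obtain ⟨p, hp, hlt, hle⟩ := Nat.exists_prime_lt_and_le_two_mul ⌈X / 4⌉₊
    (Nat.ceil_pos.2 (by linarith)).ne'
  have h1 : X / 4 ≤ (⌈X / 4⌉₊ : ℝ) := Nat.le_ceil _
  have h2 : (⌈X / 4⌉₊ : ℝ) < X / 4 + 1 := Nat.ceil_lt_add_one h4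
  have h3 : (⌈X / 4⌉₊ : ℝ) < p := by exact_mod_cast hlt
  have h5 : (p : ℝ) ≤ 2 * ⌈X / 4⌉₊ := by exact_mod_cast hle
  refine ⟨p, hp, ?_, by linarith, by linarith⟩
  have : (P : ℝ) ≤ p := by linarith
  exact_mod_cast this

/-- Keeps y₀ = (p₀/X)^d at distance κ = (1/4)^d from 0 and 1, uniformly in X. -/
lemma pow_mem_Icc {d : ℕ} (hd : d ≠ 0) {z : ℝ} (h1 : 1 / 4 ≤ z) (h2 : z ≤ 3 / 4) :
    (1 / 4 : ℝ) ^ d ≤ z ^ d ∧ z ^ d ≤ 1 - (1 / 4) ^ d := by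
  refine ⟨by gcongr, ?_⟩
  have h3 : z ^ d ≤ z := pow_le_of_le_one (by linarith) (by linarith) hd
  have h4 : (1 / 4 : ℝ) ^ d ≤ 1 / 4 := pow_le_of_le_one (by norm_num) (by norm_num) hd
  linarith

end MagicSquare

theorem proposition2p2 (n d : ℕ) (hd : 2 ≤ d)
    (hT : ((d : ℝ) * (2 * n + 2)) / (2 * n + 1) < (MagicSquare.Psi n : ℝ)) :
    ∃ c ε : ℝ, 0 < c ∧ 0 < ε ∧ ε < 1 / 2 ∧ ∃ X₀ : ℝ, 1 ≤ X₀ ∧ ∀ X : ℝ, X₀ ≤ X →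
      ∃ μ p₀ : ℕ, p₀.Prime ∧ ε * X < p₀ ∧ (p₀ : ℝ) < (1 - ε) * X ∧ μ = n * p₀ ^ d ∧
        Summable (fun q : ℕ+ => MagicSquare.A n d μ q) ∧
        MeasureTheory.Integrable (MagicSquare.singularIntegrand n d μ X) ∧
        (MagicSquare.singularSeries n d μ * MagicSquare.singularIntegral n d μ X).im = 0 ∧
        c < (MagicSquare.singularSeries n d μ * MagicSquare.singularIntegral n d μ X).re := by
  have hdT : d + 1 ≤ MagicSquare.Psi n := by
    have h1 : (d : ℝ) ≤ (d : ℝ) * (2 * n + 2) / (2 * n + 1) := by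
      rw [le_div_iff₀ (by positivity)]
      gcongr
      norm_num
    exact_mod_cast h1.trans_lt hT
  have hB := MagicSquare.hasDisjointBases_psi n
  have : NeZero (MagicSquare.Psi n) := ⟨by omega⟩
  have hn := hB.two_mul_lt (NeZero.ne _)
  obtain ⟨j, hj, hdet⟩ := hB.exists_cellsDet_ne_zero (by omega)
  obtain ⟨c₁, hc₁, P, hS⟩ := MagicSquare.exists_le_singularSeries hd hdT (by omega) j hj hdet
  obtain ⟨c₂, hc₂, hI⟩ := MagicSquare.exists_le_singularIntegral hd hdT j hj hdet
    (κ := (1 / 4) ^ d) (by positivity)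
  -- Halving makes the final inequality strict; X ≥ 4P forces p₀ ≥ P, as the singular series bound
  -- requires.
  refine ⟨c₁ * c₂ / 2, 1 / 4, by positivity, by norm_num, by norm_num, max 9 (4 * P),
    le_max_of_le_left (by norm_num), fun X hX => ?_⟩
  have hX9 : 9 ≤ X := (le_max_left _ _).trans hX
  obtain ⟨p, hp, hPp, hlt, hgt⟩ :=
    MagicSquare.exists_prime_mem_middle P hX9 ((le_max_right _ _).trans hX)
  have hX0 : 0 < X := by linarith
  obtain ⟨hy1, hy2⟩ := MagicSquare.pow_mem_Icc (d := d) (by omega) (z := p / X)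
    (by rw [le_div_iff₀ hX0]; exact hlt.le) (by rw [div_le_iff₀ hX0]; linarith)
  obtain ⟨hsum, x, hx, hxS⟩ := hS p hp hPp
  obtain ⟨y, hy, hyI⟩ := hI (n * p ^ d) X ((p / X) ^ d) hy1 hy2
    (by push_cast; rw [div_pow]; ring)
  refine ⟨n * p ^ d, p, hp, hlt, hgt, rfl, hsum, MagicSquare.integrable_singularIntegrand hd hdT j hj hdet _ _,
    ?_, ?_⟩
  · rw [hxS, hyI, ← Complex.ofReal_mul, Complex.ofReal_im]
  · rw [hxS, hyI, ← Complex.ofReal_mul, Complex.ofReal_re]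
    have h1 : c₁ * c₂ ≤ x * y := mul_le_mul hx hy hc₂.le (hc₁.le.trans hx)
    have h2 : 0 < c₁ * c₂ := mul_pos hc₁ hc₂
    linarith
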